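/- All matroids are finite. **Terminology.** A matroid is *$3$-connected* if it has no $1$- or $2$-separation, and it is *$3$-connected up to series and parallel sets* if it is connected and $\min\{r(X),r(Y)\}=1$ or $\min\{r^*(X),r^*(Y)\}=1$ for every $2$-separation $(X,Y)$. A *fan* of a matroid is a sequence $(e_1,\dots,e_n)$ of $n\ge 3$ distinct elements such that $\{e_1,e_2,e_3\},\{e_2,e_3,e_4\},\dots,\{e_{n-2},e_{n-1},e_n\}$ is an alternating sequence of triangles and triads. If $\{e_1,e_2,e_3\}$ is a triangle, then the $e_j$ with $j$ odd are *spoke* elements and those with $j$ even are *rim* elements; otherwise the labels are reversed. A sequence $F$ is *consistent* with $F'$ if it is a (not necessarily contiguous) subsequence of $F'$ or of the reversal of $F'$. It is *enclosed* in $F'$ if $F$ or its reversal is a contiguous subsequence of $F'$. A family of sequences $\mathcal F$ is *enclosed* in a family $\mathcal F'$ if there is a bijection $\mathcal F\to\mathcal F'$ such that every member of $\mathcal F$ is enclosed in its image. Let $N$ be a minor of $M$ and let $\mathcal F_N$ be a family of pairwise disjoint fans of $N$. A *covering family* of $M$ relative to $N$ and $\mathcal F_N$ is a family $\mathcal F$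 of pairwise disjoint fans of $M$ such that $|\mathcal F|=|\mathcal F_N|$, every member of $\mathcal F_N$ is consistent with some member of $\mathcal F$, and every element of $E(M)-E(N)$ is in some member of $\mathcal F$. **Core.** Let $N$ be a $3$-connected matroid with at least four elements that is neither a wheel nor a whirl, represented by a family of vectors over a field, and let $\mathcal F_0=(F_i)_{i=1}^t$ be a family of pairwise disjoint fans of $N$. For each $i$, let $F_i=(e_1,\dots,e_n)$, and add three new points $a_i,b_i,c_i$ to the representation. If $e_1$ is a spoke element, then $a_i$ is parallel to $e_1$; otherwise $a_i$ is the point that is both in the span of $\{e_1,e_2\}$ and in the span of $E(N)-F_i$. The point $c_i$ is defined in the same way from the reversal of $F_i$. The point $b_i$ is the point that is both in the span of the rim elements of $F_i$ and in the span of $E(N)-F_i$. Let $N^+$ be the resulting matroid on $E(N)\cup\bigcup_i\{a_i,b_i,c_i\}$. Then $\operatorname{Core}(N)$ is obtained from $N^+$ by deleting $\bigcup_iF_i$ and every other element of $E(N)$ that is parallel to some $a_i$ or $c_i$. Let $\mathcal T=(\{a_i,b_i,c_i\})_{i=1}^t$. We say that $\operatorname{Core}(N)$ and $\mathcal T$ are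 *determined* by $\mathcal F_0$. **Gluing wheels.** A *blueprint* $(N_0,\mathcal T,r,X)$ consists of a matroid $N_0$, a family $\mathcal T=(T_i)_{i=1}^t$ of triangles $T_i=\{a_i,b_i,c_i\}$ of $N_0$, integers $r(i)\ge 2$, and a set $X\subseteq\bigcup_iT_i$ such that, for every $i$, if $b_i\notin X$ then $b_i\in\{a_j,c_j\}$ for some $j$. Let $W_i$ be the wheel of rank $r(i)$ with spoke elements $x^i_1,\dots,x^i_{r(i)}$ and rim elements $y^i_1,\dots,y^i_{r(i)}$ in the cyclic order $x^i_1,y^i_1,x^i_2,y^i_2,\dots,x^i_{r(i)},y^i_{r(i)}$ (so $\{x^i_1,y^i_{r(i)},x^i_{r(i)}\}$ is a triangle), where $x^i_1=a_i$, $x^i_{r(i)}=c_i$, $y^i_{r(i)}=b_i$, and all other elements are new. For $i=1,\dots,t$ let $N_i$ be the generalized parallel connection of $N_{i-1}$ and $W_i$ across $T_i$. Here the generalized parallel connection of $M_1$ and $M_2$ across $T=E(M_1)\cap E(M_2)$ is defined if $M_1|T=M_2|T$, the closure $\operatorname{cl}_{M_2}(T)$ is a modular flat of $M_2$, and every element of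 $\operatorname{cl}_{M_2}(T)-T$ is a loop or parallel to an element of $T$; its flats are the sets $Z\subseteq E(M_1)\cup E(M_2)$ such that $Z\cap E(M_k)$ is a flat of $M_k$ for $k=1,2$. Put $\boxtimes(N_0,\mathcal T,r,X)=N_t\backslash X$. Its *canonical fans* are the sequences $(x^i_1,y^i_1,x^i_2,\dots,y^i_{r(i)-1},x^i_{r(i)})-X$ for $i=1,\dots,t$. **Lemma.** Let $N$ be a $3$-connected representable matroid with $|E(N)|\ge4$ that is neither a wheel nor a whirl, and fix a representation of $N$ over a field. Let $\mathcal F_N$ be a family of pairwise disjoint fans of $N$ such that no fan of $N$ contains (as a set) two distinct members of $\mathcal F_N$. Let $M$ be a $3$-connected matroid with $N$ as a minor such that every minor of $M$ with $N$ as a minor is $3$-connected up to series and parallel sets. Let $\mathcal F$ be a covering family of $M$ relative to $N$ and $\mathcal F_N$. Then there are a family $\mathcal F_0$ of pairwise disjoint fans of $N$ such that $\mathcal F_N$ is enclosed in $\mathcal F_0$, and a blueprint $(\operatorname{Core}(N),\mathcal T,r,X)$, where $\operatorname{Core}(N)$ and $\mathcal T$ are determined by $\mathcal F_0$, such that, up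 to relabeling the elements of $M$, $$M=\boxtimes(\operatorname{Core}(N),\mathcal T,r,X).$$ Furthermore, under this relabeling, $\mathcal F$ is enclosed in the family of canonical fans of $\boxtimes(\operatorname{Core}(N),\mathcal T,r,X)$ (which are indeed fans of this matroid). -/

import Mathlib

open Set

namespace Matroid

universe u v w

/-! ### Matroids from vector configurations -/

section Vector

variable {K : Type u} {V : Type v} {α : Type w} [Field K] [AddCommGroup V] [Module K V]

theorem vector_augment (f : α → V) {I J : Set α} (hIfin : I.Finite) (hJfin : J.Finite)
    (hI : LinearIndepOn K f I) (hJ : LinearIndepOn K f J) (hlt : I.ncard < J.ncard) :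
    ∃ e ∈ J, e ∉ I ∧ LinearIndepOn K f (insert e I) := by
  by_contra! hcon
  have hspan : ∀ e ∈ J, f e ∈ Submodule.span K (f '' I) := by
    intro e he
    by_cases heI : e ∈ I
    · exact Submodule.subset_span (mem_image_of_mem f heI)
    · by_contra hns
      exact hcon e he heI ((linearIndepOn_insert heI).2 ⟨hI, hns⟩)
  have hle : Submodule.span K (f '' J) ≤ Submodule.span K (f '' I) :=
    Submodule.span_le.2 (by rintro _ ⟨e, he, rfl⟩; exact hspan e he)
  have hcard : ∀ {A : Set α}, A.Finite → LinearIndepOn K f A →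
      Module.finrank K (Submodule.span K (f '' A)) = A.ncard := by
    intro A hA hind
    have := hA.fintype
    have h := finrank_span_eq_card (R := K) (b := fun x : A => f x) hind
    rw [show Set.range (fun x : A => f x) = f '' A from (image_eq_range f A).symm] at h
    rw [h, ← Nat.card_eq_fintype_card, Nat.card_coe_set_eq]
  have : Module.Finite K (Submodule.span K (f '' I)) :=
    Module.Finite.span_of_finite K (hIfin.image f)
  have := Submodule.finrank_mono hle
  rw [hcard hIfin hI, hcard hJfin hJ] at this
  omega

variable (K) in
/-- The vector matroid on ground set `E` of the family `f` of vectors: a subset of `E` is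
independent when `f` restricted to it is a linearly independent family. -/
def vectorMatroid (f : α → V) (E : Set α) : Matroid α :=
  (IndepMatroid.ofFinitaryCardAugment E (fun I => I ⊆ E ∧ LinearIndepOn K f I)
    ⟨empty_subset _, linearIndepOn_empty K f⟩
    (fun _ _ hJ hIJ => ⟨hIJ.trans hJ.1, hJ.2.mono hIJ⟩)
    (by
      intro I J hI hIfin hJ hJfin hlt
      obtain ⟨e, heJ, heI, he⟩ := vector_augment f hIfin hJfin hI.2 hJ.2 hlt
      exact ⟨e, heJ, heI, insert_subset (hJ.1 heJ) hI.1, he⟩)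
    (by
      intro I h
      refine ⟨fun e he => ?_, ?_⟩
      · exact (h {e} (singleton_subset_iff.2 he) (finite_singleton e)).1 rfl
      · refine linearIndepOn_of_finite I fun J hJ hJfin => (h J hJ hJfin).2)
    (fun _ hI => hI.1)).matroid

theorem vectorMatroid_indep_iff (f : α → V) (E I : Set α) :
    (vectorMatroid K f E).Indep I ↔ I ⊆ E ∧ LinearIndepOn K f I := by
  simp [vectorMatroid]

theorem vectorMatroid_ground (f : α → V) (E : Set α) : (vectorMatroid K f E).E = E := rfl

variable (K) in
/-- `f` represents `M` over `K`. -/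
def IsRepresentedBy (M : Matroid α) (f : α → V) : Prop :=
  ∀ I ⊆ M.E, M.Indep I ↔ LinearIndepOn K f I

end Vector

/-! ### Connectivity -/

section Connectivity

variable {α : Type u}

/-- `(X, Y)` is a `k`-separation of `M`. -/
def IsSeparation (M : Matroid α) (k : ℕ) (X Y : Set α) : Prop :=
  X ∪ Y = M.E ∧ Disjoint X Y ∧ (k : ℕ∞) ≤ X.encard ∧ (k : ℕ∞) ≤ Y.encard ∧
    M.eRk X + M.eRk Y < M.eRank + k

/-- `M` is `n`-connected: it has no `k`-separation with `1 ≤ k < n`. -/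
def IsConnectedOfOrder (M : Matroid α) (n : ℕ) : Prop :=
  ∀ k, 1 ≤ k → k < n → ∀ X Y, ¬ M.IsSeparation k X Y

/-- `M` is 3-connected up to series and parallel sets. -/
def IsThreeConnectedUpToSP (M : Matroid α) : Prop :=
  M.IsConnectedOfOrder 2 ∧
    ∀ X Y, M.IsSeparation 2 X Y →
      min (M.eRk X) (M.eRk Y) = 1 ∨ min (M✶.eRk X) (M✶.eRk Y) = 1

end Connectivity

/-! ### Wheels and whirls -/

section Wheel

/-- The `p`-th vector of the wheel with `r` spokes. The wheel graph has hub `none` and rim vertices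
`some 0, …, some (r - 1)`. Edge `2 * k` is the spoke from the hub to `some k`, edge `2 * k + 1` is
the rim edge from `some k` to `some (k + 1)`, indices modulo `r`. The vector of an edge is its
column in the vertex-edge incidence matrix over the two-element field. -/
def wheelVector (r p : ℕ) : Option ℕ → ZMod 2 :=
  if Even p then Pi.single none 1 + Pi.single (some (p / 2)) 1
  else Pi.single (some (p / 2)) 1 + Pi.single (some ((p / 2 + 1) % r)) 1

/-- The rank-`r` wheel (the cycle matroid of the wheel graph with `r` spokes), on the ground set
`{0, …, 2 r - 1}`, spokes and rim elements alternating in cyclic order. -/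
def wheel (r : ℕ) : Matroid ℕ := vectorMatroid (ZMod 2) (wheelVector r) {p | p < 2 * r}

variable {α : Type u}

/-- `M` is isomorphic to a wheel. -/
def IsWheel (M : Matroid α) : Prop :=
  ∃ r, 2 ≤ r ∧ ∃ (f : ℕ → α) (hf : InjOn f (wheel r).E), M = (wheel r).map f hf

/-- `M` is isomorphic to a whirl, that is, to the matroid obtained from a wheel by making its
rim (the set of odd positions) independent. -/
def IsWhirl (M : Matroid α) : Prop :=
  ∃ r, 2 ≤ r ∧ ∃ f : ℕ → α, InjOn f {p | p < 2 * r} ∧ M.E = f '' {p | p < 2 * r} ∧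
    ∀ I ⊆ {p | p < 2 * r},
      M.Indep (f '' I) ↔ ((wheel r).Indep I ∨ I = {p | p < 2 * r ∧ Odd p})

end Wheel

/-! ### Fans -/

section Fan

variable {α : Type u} {t : ℕ}

/-- The set of elements of a sequence. -/
def listSet (L : List α) : Set α := {x | x ∈ L}

/-- The set of the three consecutive terms of `L` that start at position `i` (counted from `0`). -/
def triple (L : List α) (i : ℕ) : Set α := listSet ((L.drop i).take 3)

/-- A triangle is a three-element circuit. -/
def IsTriangle (M : Matroid α) (T : Set α) : Prop := M.IsCircuit T ∧ T.encard = 3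

/-- A triad is a three-element cocircuit. -/
def IsTriad (M : Matroid α) (T : Set α) : Prop := M.IsCocircuit T ∧ T.encard = 3

/-- A fan: a sequence of at least three distinct elements whose consecutive triples form an
alternating sequence of triangles and triads. -/
def IsFan (M : Matroid α) (L : List α) : Prop :=
  3 ≤ L.length ∧ L.Nodup ∧
    ((∀ i, i + 3 ≤ L.length →
        (Even i → M.IsTriangle (triple L i)) ∧ (Odd i → M.IsTriad (triple L i))) ∨
      (∀ i, i + 3 ≤ L.length →
        (Even i → M.IsTriad (triple L i)) ∧ (Odd i → M.IsTriangle (triple L i))))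

/-- The rim elements of a fan: those in even places (counted from `1`) if the first triple is a
triangle, and those in odd places otherwise. -/
def rimSet (M : Matroid α) (L : List α) : Set α :=
  {x | ∃ i : ℕ, L[i]? = some x ∧ (Odd i ↔ M.IsTriangle (triple L 0))}

/-- `L` is consistent with `L'`: it is a subsequence of `L'` or of the reversal of `L'`. -/
def Consistent (L L' : List α) : Prop := List.Sublist L L' ∨ List.Sublist L L'.reverse

/-- `L` is enclosed in `L'`: it or its reversal is a contiguous subsequence of `L'`. -/
def Enclosed (L L' : List α) : Prop := List.IsInfix L L' ∨ List.IsInfix L.reverse L'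

/-- Enclosure of families: some bijection sends every member to one that encloses it. -/
def EnclosedFamily (F F' : Fin t → List α) : Prop :=
  ∃ σ : Equiv.Perm (Fin t), ∀ i, Enclosed (F i) (F' (σ i))

/-- `F` is a family of pairwise disjoint fans of `M`. -/
def IsDisjointFanFamily (M : Matroid α) (F : Fin t → List α) : Prop :=
  (∀ i, M.IsFan (F i)) ∧ ∀ i j, i ≠ j → Disjoint (listSet (F i)) (listSet (F j))

/-- `F` is a covering family of `M` relative to `N` and `FN`. The two families have the same size
because they have the same index set. -/
def IsCoveringFamily (M N : Matroid α) (FN F : Fin t → List α) : Prop :=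
  M.IsDisjointFanFamily F ∧ (∀ i, ∃ j, Consistent (FN i) (F j)) ∧
    ∀ e ∈ M.E \ N.E, ∃ j, e ∈ F j

end Fan

/-! ### Generalized parallel connection -/

section ParallelConnection

variable {α : Type u}

/-- A modular flat. -/
def IsModularFlat (M : Matroid α) (F : Set α) : Prop :=
  M.IsFlat F ∧ ∀ G, M.IsFlat G → M.eRk F + M.eRk G = M.eRk (F ∩ G) + M.eRk (F ∪ G)

/-- `P` is the generalized parallel connection of `M₁` and `M₂` across `T`. It is defined if
`T = E(M₁) ∩ E(M₂)`, the two matroids agree on `T`, the closure of `T` in `M₂` is a modular flat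
of `M₂`, and every element of this closure outside `T` is a loop or parallel to an element of `T`.
The flats of `P` are the sets that meet `E(M₁)` and `E(M₂)` in flats. -/
def IsGenParallelConnection (M₁ M₂ : Matroid α) (T : Set α) (P : Matroid α) : Prop :=
  M₁.E ∩ M₂.E = T ∧ M₁ ↾ T = M₂ ↾ T ∧ M₂.IsModularFlat (M₂.closure T) ∧
    (∀ x ∈ M₂.closure T \ T, M₂.IsLoop x ∨ ∃ y ∈ T, M₂.IsCircuit {x, y}) ∧
    P.E = M₁.E ∪ M₂.E ∧
    ∀ F, P.IsFlat F ↔ (F ⊆ M₁.E ∪ M₂.E ∧ M₁.IsFlat (F ∩ M₁.E) ∧ M₂.IsFlat (F ∩ M₂.E))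

end ParallelConnection

/-! ### Blueprints and gluing of wheels -/

section Gluing

variable {β : Type u} {t : ℕ}

/-- A blueprint. The `i`-th triangle of `base` has the elements `a = corner i 0`, `b = corner i 1`
and `c = corner i 2`, a wheel of rank `rank i` is to be glued to it, and `del` is the set of
elements that are deleted in the end. -/
structure Blueprint (β : Type u) (t : ℕ) where
  base : Matroid β
  corner : Fin t → Fin 3 → β
  rank : Fin t → ℕ
  del : Set β
  isTriangle : ∀ i, base.IsTriangle (range (corner i))
  two_le_rank : ∀ i, 2 ≤ rank i
  del_subset : del ⊆ ⋃ i, range (corner i)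
  of_notMem_del : ∀ i, corner i 1 ∉ del → ∃ j, corner i 1 = corner j 0 ∨ corner i 1 = corner j 2

/-- The label of the element of the `i`-th wheel in position `p`, where the positions
`0, 1, 2, …, 2 r - 1` carry `x₁, y₁, x₂, …, x_r, y_r`. Here `x₁ = a`, `x_r = c` and `y_r = b` are
elements of the base; the other elements of the wheel are new. -/
def Blueprint.label (B : Blueprint β t) (i : Fin t) (p : ℕ) : β ⊕ (Fin t × ℕ) :=
  if p = 0 then Sum.inl (B.corner i 0)
  else if p = 2 * B.rank i - 2 then Sum.inl (B.corner i 2)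
  else if p = 2 * B.rank i - 1 then Sum.inl (B.corner i 1)
  else Sum.inr (i, p)

/-- `G` is obtained from `B` by gluing wheels: starting from the base, the labelled wheels are
attached one after the other by generalized parallel connections across the triangles of `B`, and
then `B.del` is deleted. -/
def Blueprint.IsGluing (B : Blueprint β t) (G : Matroid (β ⊕ (Fin t × ℕ))) : Prop :=
  ∃ P : Fin (t + 1) → Matroid (β ⊕ (Fin t × ℕ)),
    P 0 = B.base.map Sum.inl Sum.inl_injective.injOn ∧
    (∀ i : Fin t, ∃ h : InjOn (B.label i) (wheel (B.rank i)).E,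
      IsGenParallelConnection (P i.castSucc) ((wheel (B.rank i)).map (B.label i) h)
        (Sum.inl '' range (B.corner i)) (P i.succ)) ∧
    G = P (Fin.last t) ＼ (Sum.inl '' B.del)

open Classical in
/-- The `i`-th canonical fan `(x₁, y₁, x₂, …, y_{r-1}, x_r) - X`, where `X = B.del`. -/
noncomputable def Blueprint.canonicalFan (B : Blueprint β t) (i : Fin t) :
    List (β ⊕ (Fin t × ℕ)) :=
  ((List.range (2 * B.rank i - 1)).map (B.label i)).filter (fun x => x ∉ Sum.inl '' B.del)

end Gluing

/-! ### The core -/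

section Core

variable {K : Type u} {V : Type v} {α : Type w} [Field K] [AddCommGroup V] [Module K V] {t : ℕ}

open Classical in
/-- A vector spanning the point in which two subspaces meet: a nonzero vector of `U ⊓ W` (unique up
to scalars when `U ⊓ W` is one-dimensional), and `0` if there is none. -/
noncomputable def meetPoint (U W : Submodule K V) : V :=
  if h : ∃ x ∈ U ⊓ W, x ≠ 0 then h.choose else 0

variable (K) in
open Classical in
/-- The vector of the point added at the start of the fan `L = (e₁, …, e_n)`: it is parallel to
`e₁` if `e₁` is a spoke element, and otherwise it is the point that is in the span of `{e₁, e₂}`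
and in the span of `E - L`. -/
noncomputable def endVector (N : Matroid α) (f : α → V)
    (L : List α) : V :=
  if N.IsTriangle (triple L 0) then L.head?.elim 0 f
  else meetPoint (Submodule.span K (f '' listSet (L.take 2)))
    (Submodule.span K (f '' (N.E \ listSet L)))

variable (K) in
/-- The vector of the point that is in the span of the rim elements of the fan `L` and in the span
of `E - L`. -/
noncomputable def rimVector (N : Matroid α) (f : α → V)
    (L : List α) : V :=
  meetPoint (Submodule.span K (f '' N.rimSet L)) (Submodule.span K (f '' (N.E \ listSet L)))

variable (K) in
/-- The vectors of the points `a` (index `0`), `b` (index `1`) and `c` (index `2`) determined by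
the fan `L`. -/
noncomputable def fanVector (N : Matroid α) (f : α → V)
    (L : List α) : Fin 3 → V :=
  ![endVector K N f L, rimVector K N f L, endVector K N f L.reverse]

variable (K) in
/-- The matroid `N⁺`: the points of `N`, labelled by `Sum.inl`, together with the points
`a`, `b`, `c` of the `i`-th fan, labelled `Sum.inr (i, 0)`, `Sum.inr (i, 1)`, `Sum.inr (i, 2)`. -/
noncomputable def plusMatroid (N : Matroid α) (f : α → V)
    (F : Fin t → List α) : Matroid (α ⊕ (Fin t × Fin 3)) :=
  vectorMatroid K (Sum.elim f (fun q => fanVector K N f (F q.1) q.2))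
    (Sum.inl '' N.E ∪ range Sum.inr)

variable (K) in
/-- `Core(N)`, determined by the family `F`: delete from `N⁺` all elements of the fans, and all
other elements of `N` that are parallel to some point `a` or `c`. -/
noncomputable def core (N : Matroid α) (f : α → V)
    (F : Fin t → List α) : Matroid (α ⊕ (Fin t × Fin 3)) :=
  plusMatroid K N f F ＼ (Sum.inl '' {e | e ∈ N.E ∧ ((∃ i, e ∈ F i) ∨
    ∃ i, (plusMatroid K N f F).IsCircuit {Sum.inl e, Sum.inr (i, 0)} ∨
      (plusMatroid K N f F).IsCircuit {Sum.inl e, Sum.inr (i, 2)})})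

end Core

end Matroid

/-!
The idea is to extend the given representation of `N` to a representation of `M`.

*Fans are pieces of wheels.* Number the elements of a fan by consecutive positions of a wheel, so
that spoke elements have even positions. If a fan of a represented matroid has positions in
`[lo, hi)`, then after rescaling there are vectors `u 0, …, u (r - 1)`, one for each rim vertex of
the wheel, such that the spoke element in position `2 * k` has the vector `u k`, and the rim element
in position `2 * k + 1` has the vector `u k - u (k + 1)`; the triads give functionals dual to the
interior vectors (`FanCoord`, `wv`). Since `N` is 3-connected and neither a wheel nor a whirl, at
least two elements lie outside the fan (`PosFan.two_le_encard_compl`). By 3-connectivity these span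
exactly the combinations of `u 0` and `u (r - 1)` within the span of the fan (`FanCoord.ends`), so
the points `a`, `b`, `c` of the core are `u 0`, `u 0 - u (r - 1)` and `u (r - 1)` up to scaling.

*Minors of fans.* Call a set cyclic if it is a union of circuits (`Cyc`), and call a list a weak fan
if its consecutive triples are alternately cyclic in the matroid and in its dual (`WeakFan`). Let a
weak fan of `M` have at least three elements in a minor `N` without cyclic or cocyclic pairs. Then
the elements of the fan outside `N` must be contracted if they are rim elements and deleted if they
are spoke elements (`WeakFan.isMinor_of_notMem`): otherwise the fan would collapse by series and
parallel reductions. They can be removed one at a time at the ends of the fan and in consecutive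
pairs in its interior, and such a step leaves a weak fan; an isolated element outside `N` cannot
occur in the interior (`WeakFan.not_isolated`), since its removal would make a pair of elements of
`N` cyclic or cocyclic. So the elements of the fan that belong to `N` form a weak fan of `N`
(`WeakFan.filter`). Moreover, each step can be undone in only one way (`WeakFan.eq_of_red_eq`), so
`M` is determined by `N` and the lists in `F` (`eq_of_weakFans`).

The fans of `N` obtained from the members of `F` form the family `F₀`. As no fan of `N` contains two
members of `FN`, the members of `F` correspond to those of `FN`, and in particular they all have at
least three elements in `N`. A fan of `N` that is a subsequence of another one is contiguous in it
(`PosFan.infix_of_sublist`), so `FN` is enclosed in `F₀`.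

*Gluing.* Take the vectors of the core, and for each fan of `F` new independent vectors for the
interior rim vertices of a wheel whose end vertices have the vectors `u 0` and `u (r - 1)`. These
vectors represent the matroid obtained from the core by gluing wheels (`CornerVec.isGluing`). Label
each element of `M` by one of these vectors: an element of a fan by that of its position, an element
parallel to a point `a` or `c` by that point, and every other element by itself. The matroid of the
labels has the lists in `F` as fans (`CornerVec.posFan`). Mapping the vectors of the interior rim
vertices to the appropriate vectors `u k` contracts the rim elements outside `N`, so `N` is a minor
(`FanPairs.isMinor`). Hence `eq_of_weakFans` identifies this matroid with `M`. The corners that are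
not used as labels are deleted; the points `b` are among them.
-/


open Set

namespace Matroid

/-! ### Unions of circuits -/

section Cyclic

variable {α : Type*} {M N : Matroid α} {S T : Set α} {a b c e x : α}

/-- A set is cyclic if it is a union of circuits; equivalently each of its elements is spanned by
the others. The cocyclic sets of `M`, the unions of cocircuits, are the cyclic sets of `M✶`. -/
def Cyc (M : Matroid α) (S : Set α) : Prop := ∀ e ∈ S, e ∈ M.closure (S \ {e})

theorem Cyc.subset_ground (h : M.Cyc S) : S ⊆ M.E := fun e he => mem_ground_of_mem_closure (h e he)

theorem IsCircuit.cyc (h : M.IsCircuit S) : M.Cyc S :=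
  fun _ he => h.mem_closure_sdiff_singleton_of_mem he

theorem dual_cyc_iff : M✶.Cyc S ↔ S ⊆ M.E ∧ ∀ e ∈ S, e ∉ M.closure (M.E \ S) := by
  have key : ∀ e ∈ S, e ∈ M.E → (e ∈ M✶.closure (S \ {e}) ↔ e ∉ M.closure (M.E \ S)) := by
    intro e he heE
    have h1 : (M✶ ／ (S \ {e})).IsLoop e ↔ e ∈ M✶.closure (S \ {e}) := by simp
    rw [← h1, ← dual_delete, dual_isLoop_iff_isColoop, delete_isColoop_iff]
    have : (M.E \ (S \ {e})) \ {e} = M.E \ S := by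
      ext y; by_cases hy : y = e
      · subst hy; simp [he]
      · simp [hy]
    rw [this]; simp [heE]
  constructor
  · intro h
    have hE : S ⊆ M.E := h.subset_ground
    exact ⟨hE, fun e he => (key e he (hE he)).1 (h e he)⟩
  · rintro ⟨hE, h⟩ e he
    exact (key e he (hE he)).2 (h e he)

theorem Cyc.delete (h : M.Cyc S) {D : Set α} (hD : Disjoint S D) : (M ＼ D).Cyc S := by
  intro e he
  rw [delete_closure_eq_of_disjoint _ (hD.mono_left sdiff_subset)]
  exact ⟨h e he, fun h' => hD.ne_of_mem he h' rfl⟩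

theorem Cyc.contract (h : M.Cyc S) (C : Set α) : (M ／ C).Cyc (S \ C) := by
  intro e he
  rw [contract_closure_eq]
  refine ⟨M.closure_subset_closure ?_ (h e he.1), he.2⟩
  intro y hy
  by_cases hyC : y ∈ C
  · exact Or.inr hyC
  · exact Or.inl ⟨⟨hy.1, hyC⟩, hy.2⟩

theorem Cyc.contract_of_eq (h : M.Cyc S) {C : Set α} (hT : S \ C = T) : (M ／ C).Cyc T :=
  hT ▸ h.contract C

theorem Cyc.dual_contract (h : M✶.Cyc S) {C : Set α} (hC : Disjoint S C) : (M ／ C)✶.Cyc S := by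
  rw [Matroid.dual_contract]; exact h.delete hC

theorem Cyc.dual_delete_of_eq (h : M✶.Cyc S) {D : Set α} (hT : S \ D = T) : (M ＼ D)✶.Cyc T := by
  rw [dual_delete]; exact h.contract_of_eq hT

theorem IsMinor.dual (h : N ≤m M) : N✶ ≤m M✶ := by
  obtain ⟨C, D, -, -, hCD, rfl⟩ := h.exists_eq_contract_delete_disjoint
  rw [dual_contract_delete, ← contract_delete_comm _ hCD.symm]
  exact contract_delete_isMinor _ _ _

theorem Cyc.of_isMinor (h : M.Cyc S) (hNM : N ≤m M) (hS : S ⊆ N.E) : N.Cyc S := by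
  obtain ⟨C, D, rfl⟩ := hNM
  have hSC : Disjoint S C := by
    rw [Set.disjoint_left]; intro y hy hyC
    exact (hS hy).1.2 hyC
  have hSD : Disjoint S D := by
    rw [Set.disjoint_left]; intro y hy hyC
    exact (hS hy).2 hyC
  exact (h.contract_of_eq hSC.sdiff_eq_left).delete hSD

/-- If two cyclic sets meet in a single element, their symmetric difference is cyclic. -/
theorem Cyc.elim (hS : M.Cyc S) (hT : M.Cyc T) (h : S ∩ T = {x}) : M.Cyc ((S ∪ T) \ {x}) := by
  have hx : x ∈ S ∩ T := h ▸ rfl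
  have aux : ∀ {A B : Set α}, M.Cyc A → M.Cyc B → A ∩ B = {x} → ∀ e ∈ A, e ≠ x →
      e ∈ M.closure (((A ∪ B) \ {x}) \ {e}) := by
    intro A B hA hB hAB e he hex
    have hxB : x ∈ B := (show x ∈ A ∩ B from hAB ▸ rfl).2
    have heB : e ∉ B := fun h' => hex (show e ∈ ({x} : Set α) from hAB ▸ ⟨he, h'⟩)
    refine M.closure_subset_closure_of_subset_closure ?_ (hA e he)
    intro y hy
    by_cases hyx : y = x
    · subst hyx
      refine M.closure_subset_closure ?_ (hB y hxB)
      exact fun z hz => ⟨⟨Or.inr hz.1, hz.2⟩, fun h' => heB ((show z = e from h') ▸ hz.1)⟩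
    · exact mem_closure_of_mem' _ ⟨⟨Or.inl hy.1, hyx⟩, hy.2⟩ (hA.subset_ground hy.1)
  rintro e ⟨he | he, hex⟩
  · exact aux hS hT h e he hex
  · rw [union_comm]; exact aux hT hS (by rw [inter_comm, h]) e he hex

theorem isMinor_contract_or_delete (hNM : N ≤m M) (hx : x ∉ N.E) :
    N ≤m M ／ {x} ∨ N ≤m M ＼ {x} := by
  by_cases hxM : x ∈ M.E
  swap
  · left; rwa [contractElem_eq_self hxM]
  obtain ⟨C, D, hCE, hDE, hCD, rfl⟩ := hNM.exists_eq_contract_delete_disjoint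
  by_cases hxC : x ∈ C
  · left
    refine ⟨C, D, ?_⟩
    rw [contract_contract, union_eq_self_of_subset_left (singleton_subset_iff.2 hxC)]
  · have hxD : x ∈ D := by
      by_contra hxD; exact hx ⟨⟨hxM, hxC⟩, hxD⟩
    right
    refine ⟨C, D, ?_⟩
    rw [← contract_delete_comm _ (by simpa using hxC), delete_delete,
      union_eq_self_of_subset_left (singleton_subset_iff.2 hxD)]

/-- A matroid without loops, coloops, parallel pairs and series pairs. -/
def Tame (N : Matroid α) : Prop := ∀ a b, ¬ N.Cyc {a, b} ∧ ¬ N✶.Cyc {a, b}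

theorem Tame.dual (h : N.Tame) : N✶.Tame := fun a b => ⟨(h a b).2, by simpa using (h a b).1⟩

theorem Tame.not_cyc_pair (h : N.Tame) (hNM : N ≤m M) (ha : a ∈ N.E) (hb : b ∈ N.E) :
    ¬ M.Cyc {a, b} := fun hc =>
  (h a b).1 (hc.of_isMinor hNM (insert_subset ha (singleton_subset_iff.2 hb)))

theorem Tame.not_mem_of_cyc_singleton (h : N.Tame) (hNM : N ≤m M) (hc : M.Cyc {a}) : a ∉ N.E :=
  fun ha => h.not_cyc_pair hNM ha ha (by simpa using hc)

end Cyclic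

/-! ### Weak fans -/

section WeakFan

variable {α : Type*} {M N M₁ M₂ : Matroid α} {S T : Set α} {a b c e x : α} {τ : α → Bool}
  {β : Bool} {L l l₁ l₂ : List α}

/-- Cyclic sets for `β = true`, cocyclic sets for `β = false`. -/
def BCyc (M : Matroid α) (β : Bool) (S : Set α) : Prop :=
  (β = true → M.Cyc S) ∧ (β = false → M✶.Cyc S)

theorem dual_bcyc : M✶.BCyc (!β) S ↔ M.BCyc β S := by
  cases β <;> simp [BCyc]

theorem BCyc.subset_ground (h : M.BCyc β S) : S ⊆ M.E := by
  cases β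
  · exact (h.2 rfl).subset_ground
  · exact (h.1 rfl).subset_ground

theorem BCyc.contract (h : M.BCyc β S) (hx : x ∉ S) : (M ／ {x}).BCyc β S :=
  ⟨fun hb => (h.1 hb).contract_of_eq (sdiff_singleton_eq_self hx),
    fun hb => (h.2 hb).dual_contract (disjoint_singleton_right.2 hx)⟩

theorem BCyc.delete (h : M.BCyc β S) (hx : x ∉ S) : (M ＼ {x}).BCyc β S :=
  ⟨fun hb => (h.1 hb).delete (disjoint_singleton_right.2 hx),
    fun hb => (h.2 hb).dual_delete_of_eq (sdiff_singleton_eq_self hx)⟩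

theorem BCyc.of_isMinor (h : M.BCyc β S) (hNM : N ≤m M) (hS : S ⊆ N.E) : N.BCyc β S :=
  ⟨fun hb => (h.1 hb).of_isMinor hNM hS, fun hb => (h.2 hb).of_isMinor hNM.dual hS⟩

/-- A weak fan with types `τ` (`true` for rim elements and `false` for spoke elements): the types
of consecutive elements alternate, and three consecutive elements form a cyclic set if the middle
one is a rim element, and a cocyclic set otherwise. In contrast to fans, weak fans may be short,
and they behave well under taking minors. -/
structure WeakFan (M : Matroid α) (τ : α → Bool) (L : List α) : Prop where
  nodup : L.Nodup
  alt : ∀ a b, [a, b] <:+: L → τ b = !τ a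
  triple : ∀ a b c, [a, b, c] <:+: L → M.BCyc (τ b) {a, b, c}

theorem WeakFan.dual (h : M.WeakFan τ L) : M✶.WeakFan (fun e => !τ e) L :=
  ⟨h.nodup, fun a b hab => by simp [h.alt a b hab],
    fun a b c habc => dual_bcyc.2 (h.triple a b c habc)⟩

theorem WeakFan.infix (h : M.WeakFan τ L) (hl : l <:+: L) : M.WeakFan τ l :=
  ⟨h.nodup.sublist hl.sublist, fun a b hab => h.alt a b (hab.trans hl),
    fun a b c habc => h.triple a b c (habc.trans hl)⟩

theorem WeakFan.tail (h : M.WeakFan τ (a :: l)) : M.WeakFan τ l :=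
  h.infix (List.suffix_cons a l).isInfix

theorem WeakFan.reverse (h : M.WeakFan τ L) : M.WeakFan τ L.reverse := by
  refine ⟨List.nodup_reverse.2 h.nodup, fun a b hab => ?_, fun a b c habc => ?_⟩
  · have := h.alt b a (by simpa using List.reverse_infix.2 hab)
    simp [this]
  · have := h.triple c b a (by simpa using List.reverse_infix.2 habc)
    rwa [show ({a, b, c} : Set α) = {c, b, a} by ext; simp; tauto]

theorem mem_of_triple_infix (h : [a, b, c] <:+: L) : a ∈ L ∧ b ∈ L ∧ c ∈ L := by
  have := h.subset
  simpa using this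

theorem WeakFan.contract (h : M.WeakFan τ L) (hx : x ∉ L) : (M ／ {x}).WeakFan τ L :=
  ⟨h.nodup, h.alt, fun a b c habc => (h.triple a b c habc).contract (by
    obtain ⟨ha, hb, hc⟩ := mem_of_triple_infix habc
    rintro (rfl | rfl | rfl) <;> contradiction)⟩

theorem WeakFan.delete (h : M.WeakFan τ L) (hx : x ∉ L) : (M ＼ {x}).WeakFan τ L :=
  ⟨h.nodup, h.alt, fun a b c habc => (h.triple a b c habc).delete (by
    obtain ⟨ha, hb, hc⟩ := mem_of_triple_infix habc
    rintro (rfl | rfl | rfl) <;> contradiction)⟩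

theorem WeakFan.of_isMinor (h : M.WeakFan τ L) (hNM : N ≤m M) (hL : ∀ x ∈ L, x ∈ N.E) :
    N.WeakFan τ L :=
  ⟨h.nodup, h.alt, fun a b c habc => (h.triple a b c habc).of_isMinor hNM (by
    obtain ⟨ha, hb, hc⟩ := mem_of_triple_infix habc
    rintro _ (rfl | rfl | rfl) <;> exact hL _ ‹_›)⟩

/-- In a matroid, let `z :: l` be a sequence in which `l = w :: u :: …` is a weak fan, `{z, w}` is a
series pair or a parallel pair, and `{z, w, u}` is cyclic or cocyclic, respectively. Then the whole
sequence is reduced to a single element by series-parallel reductions, and hence a tame minor has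
at most one of its elements. -/
theorem WeakFan.subsingleton_of_pair (n : ℕ) : ∀ (M N : Matroid α) (τ : α → Bool) (z : α)
    (l : List α), l.length = n → N.Tame → N ≤m M → (z :: l).Nodup → M.WeakFan τ l →
    (∀ w l', l = w :: l' → M.BCyc (!τ w) {z, w}) →
    (∀ w u l', l = w :: u :: l' → M.BCyc (τ w) {z, w, u}) →
    ({x | x ∈ z :: l} ∩ N.E).Subsingleton := by
  induction n using Nat.strong_induction_on with
  | _ n ih =>
  suffices main : ∀ (M N : Matroid α) (τ : α → Bool) (z w : α)
    (l : List α), τ w = true → (w :: l).length = n → N.Tame → N ≤m M → (z :: w :: l).Nodup →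
    M.WeakFan τ (w :: l) → M.BCyc false {z, w} →
    (∀ u l', l = u :: l' → M.BCyc true {z, w, u}) →
    ({x | x ∈ z :: w :: l} ∩ N.E).Subsingleton by
    intro M N τ z l hn hN hNM hnd hl h2 h3
    cases l with
    | nil =>
      rintro x ⟨hx, -⟩ y ⟨hy, -⟩
      simp only [mem_ofPred_eq, List.mem_singleton] at hx hy
      rw [hx, hy]
    | cons w l =>
      cases hw : τ w with
      | true =>
        exact main M N τ z w l hw hn hN hNM hnd hl (by simpa [hw] using h2 w l rfl)
          (fun u l' h => by simpa [hw] using h3 w u l' (by rw [h]))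
      | false =>
        have := main M✶ N✶ (fun e => !τ e) z w l (by simp [hw]) hn hN.dual hNM.dual hnd hl.dual
          (by simpa [hw] using dual_bcyc.2 (h2 w l rfl))
          (fun u l' h => by simpa [hw] using dual_bcyc.2 (h3 w u l' (by rw [h])))
        simpa using this
  intro M N τ z w l hw hn hN hNM hnd hl h2 h3
  have hzw : z ∈ N.E → w ∉ N.E := fun hz hw' =>
    hN.dual.not_cyc_pair hNM.dual hz hw' (h2.2 rfl)
  cases l with
  | nil =>
    rintro x ⟨hx, hxN⟩ y ⟨hy, hyN⟩
    simp only [mem_ofPred_eq, List.mem_cons, List.not_mem_nil, or_false] at hx hy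
    rcases hx with rfl | rfl <;> rcases hy with rfl | rfl
    · rfl
    · exact absurd hyN (hzw hxN)
    · exact absurd hxN (hzw hyN)
    · rfl
  | cons u l =>
    simp only [List.length_cons] at hn
    simp only [List.nodup_cons, List.mem_cons, not_or] at hnd
    obtain ⟨⟨hzw', hzu, hzl⟩, ⟨hwu, hwl⟩, hul, hld⟩ := hnd
    have hu : τ u = false := by
      have := hl.alt w u ⟨[], l, by simp⟩
      simpa [hw] using this
    have hT := (h3 u l rfl).1 rfl
    by_cases hz : z ∈ N.E
    · have hwN := hzw hz
      rcases isMinor_contract_or_delete hNM hwN with h | h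
      · have := ih (u :: l).length (by simp; omega) (M ／ {w}) N τ z (u :: l) rfl hN h
          (by simp [*]) (hl.tail.contract (by simp [*]))
          (by
            rintro _ _ ⟨rfl, rfl⟩
            rw [hu]
            refine ⟨fun _ => hT.contract_of_eq ?_, by simp⟩
            ext y; simp only [mem_sdiff, mem_insert_iff, mem_singleton_iff]
            constructor
            · tauto
            · rintro (rfl | rfl)
              · exact ⟨Or.inl rfl, hzw'⟩
              · exact ⟨Or.inr (Or.inr rfl), Ne.symm hwu⟩)
          (by
            rintro _ u' l' ⟨rfl, rfl⟩
            rw [hu]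
            simp only [List.mem_cons, not_or] at hzl hwl hul
            have h3' := (hl.triple w u u' ⟨[], l', by simp⟩).2 hu
            have := (h2.2 rfl).elim (x := w) h3' (by
              ext y; simp only [mem_inter_iff, mem_insert_iff, mem_singleton_iff]
              constructor
              · rintro ⟨rfl | rfl, h⟩ <;> tauto
              · rintro rfl; simp)
            refine ⟨by simp, fun _ => ?_⟩
            rw [Matroid.dual_contract]
            have := this.delete (D := {w}) (by simp)
            convert this using 1
            ext y; simp only [mem_sdiff, mem_union, mem_insert_iff, mem_singleton_iff]
            constructor
            · rintro (rfl | rfl | rfl)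
              · exact ⟨Or.inl (Or.inl rfl), hzw'⟩
              · exact ⟨Or.inr (Or.inr (Or.inl rfl)), Ne.symm hwu⟩
              · exact ⟨Or.inr (Or.inr (Or.inr rfl)), Ne.symm hwl.1⟩
            · tauto)
        rintro x ⟨hx, hxN⟩ y ⟨hy, hyN⟩
        refine this ⟨?_, hxN⟩ ⟨?_, hyN⟩
        · simp only [mem_ofPred_eq, List.mem_cons] at hx ⊢
          rcases hx with h | rfl | h
          · exact Or.inl h
          · exact absurd hxN hwN
          · exact Or.inr h
        · simp only [mem_ofPred_eq, List.mem_cons] at hy ⊢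
          rcases hy with h | rfl | h
          · exact Or.inl h
          · exact absurd hyN hwN
          · exact Or.inr h
      · refine absurd hz (hN.dual.not_mem_of_cyc_singleton h.dual ?_)
        refine (h2.2 rfl).dual_delete_of_eq ?_
        ext y; simp only [mem_sdiff, mem_insert_iff, mem_singleton_iff]
        constructor
        · tauto
        · rintro rfl; exact ⟨Or.inl rfl, hzw'⟩
    · suffices ({x | x ∈ w :: u :: l} ∩ N.E).Subsingleton by
        rintro x ⟨hx, hxN⟩ y ⟨hy, hyN⟩
        refine this ⟨?_, hxN⟩ ⟨?_, hyN⟩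
        · rcases List.mem_cons.1 hx with rfl | h
          · exact absurd hxN hz
          · exact h
        · rcases List.mem_cons.1 hy with rfl | h
          · exact absurd hyN hz
          · exact h
      rcases isMinor_contract_or_delete hNM hz with h | h
      · refine ih (u :: l).length (by simp; omega) (M ／ {z}) N τ w (u :: l) rfl hN h
          (by simp [*]) (hl.tail.contract (by simp [*]))
          (by
            rintro _ _ ⟨rfl, rfl⟩
            rw [hu]
            refine ⟨fun _ => hT.contract_of_eq ?_, by simp⟩
            ext y; simp only [mem_sdiff, mem_insert_iff, mem_singleton_iff]
            constructor
            · tauto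
            · rintro (rfl | rfl)
              · exact ⟨Or.inr (Or.inl rfl), Ne.symm hzw'⟩
              · exact ⟨Or.inr (Or.inr rfl), Ne.symm hzu⟩)
          (by
            rintro _ u' l' ⟨rfl, rfl⟩
            simp only [List.mem_cons, not_or] at hzl hwl hul
            refine (hl.triple w u u' ⟨[], l', by simp⟩).contract ?_
            simp [hzw', hzu, hzl.1])
      · have hw1 : (M ＼ {z})✶.Cyc {w} := (h2.2 rfl).dual_delete_of_eq (by
          ext y; simp only [mem_sdiff, mem_insert_iff, mem_singleton_iff]
          constructor
          · tauto
          · rintro rfl; exact ⟨Or.inr rfl, Ne.symm hzw'⟩)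
        have hwN : w ∉ N.E := hN.dual.not_mem_of_cyc_singleton h.dual hw1
        have h' : N ≤m M ＼ {z} ＼ {w} := by
          rcases isMinor_contract_or_delete h hwN with h' | h'
          · rwa [contract_eq_delete_of_subset_coloops] at h'
            rw [singleton_subset_iff, ← isColoop_iff_mem_coloops]
            have := hw1 w rfl
            rw [sdiff_self] at this
            exact this
          · exact h'
        have := ih l.length (by omega) (M ＼ {z} ＼ {w}) N τ u l rfl hN h' (by simp [*])
          ((hl.tail.tail.delete hzl).delete hwl)
          (by
            rintro u' l' rfl
            simp only [List.mem_cons, not_or] at hzl hwl hul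
            have hu' : τ u' = true := by
              have := hl.alt u u' ⟨[w], l', by simp⟩
              simpa [hu] using this
            rw [hu']
            have h3' := (hl.triple w u u' ⟨[], l', by simp⟩).delete (x := z)
              (by simp [hzw', hzu, hzl.1])
            refine ⟨by simp, fun _ => (h3'.2 hu).dual_delete_of_eq ?_⟩
            ext y; simp only [mem_sdiff, mem_insert_iff, mem_singleton_iff]
            constructor
            · tauto
            · rintro (rfl | rfl)
              · exact ⟨Or.inr (Or.inl rfl), Ne.symm hwu⟩
              · exact ⟨Or.inr (Or.inr rfl), Ne.symm hwl.1⟩)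
          (by
            rintro u' u'' l' rfl
            simp only [List.mem_cons, not_or] at hzl hwl hul
            refine ((hl.triple u u' u'' ⟨[w], l', by simp⟩).delete ?_).delete ?_
            · simp [hzu, hzl]
            · simp [hwu, hwl])
        rintro x ⟨hx, hxN⟩ y ⟨hy, hyN⟩
        refine this ⟨?_, hxN⟩ ⟨?_, hyN⟩
        · rcases List.mem_cons.1 hx with rfl | h
          · exact absurd hxN hwN
          · exact h
        · rcases List.mem_cons.1 hy with rfl | h
          · exact absurd hyN hwN
          · exact h

end WeakFan

section WeakFan

variable {α : Type*} {M N M₁ M₂ : Matroid α} {S T : Set α} {a b c e x p q : α} {τ : α → Bool}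
  {β : Bool} {L l l₁ l₂ : List α}

theorem WeakFan.subsingleton_of_delete_head (hN : N.Tame) (h : M.WeakFan τ (x :: l))
    (hx : τ x = true) (hNM : N ≤m M ＼ {x}) : ({y | y ∈ l} ∩ N.E).Subsingleton := by
  have hxl : x ∉ l := (List.nodup_cons.1 h.nodup).1
  cases l with
  | nil => simp
  | cons s l =>
    refine WeakFan.subsingleton_of_pair l.length _ N τ s l rfl hN hNM
      (List.nodup_cons.1 h.nodup).2 (h.tail.tail.delete (by simp_all)) ?_ ?_
    · rintro r l' rfl
      have h1 := h.alt x s ⟨[], r :: l', by simp⟩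
      have h2 := h.alt s r ⟨[x], l', by simp⟩
      have h3 := h.triple x s r ⟨[], l', by simp⟩
      have hs : τ s = false := by simp [h1, hx]
      rw [h2, hs]
      refine ⟨by simp, fun _ => (h3.2 hs).dual_delete_of_eq ?_⟩
      simp only [List.mem_cons, not_or] at hxl
      ext y; simp only [mem_sdiff, mem_insert_iff, mem_singleton_iff]
      constructor
      · tauto
      · rintro (rfl | rfl)
        · exact ⟨Or.inr (Or.inl rfl), Ne.symm hxl.1⟩
        · exact ⟨Or.inr (Or.inr rfl), Ne.symm hxl.2.1⟩
    · rintro r u l' rfl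
      simp only [List.mem_cons, not_or] at hxl
      exact (h.triple s r u ⟨[x], l', by simp⟩).delete (by simp [hxl])

/-- Deleting a rim element leaves at most one element of a tame minor on each side of it. -/
theorem WeakFan.encard_le_of_delete (hN : N.Tame) (h : M.WeakFan τ L) (hxL : x ∈ L)
    (hx : τ x = true) (hNM : N ≤m M ＼ {x}) : ({y | y ∈ L} ∩ N.E).encard ≤ 2 := by
  obtain ⟨l₁, l₂, rfl⟩ := List.append_of_mem hxL
  have h₂ : ({y | y ∈ l₂} ∩ N.E).Subsingleton :=
    WeakFan.subsingleton_of_delete_head hN (h.infix ⟨l₁, [], by simp⟩) hx hNM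
  have h₁ : ({y | y ∈ l₁.reverse} ∩ N.E).Subsingleton :=
    WeakFan.subsingleton_of_delete_head hN (h.reverse.infix ⟨l₂.reverse, [], by simp⟩) hx hNM
  have hxN : x ∉ N.E := fun h' => (hNM.subset h').2 rfl
  have : ({y | y ∈ l₁ ++ x :: l₂} ∩ N.E) ⊆ ({y | y ∈ l₁.reverse} ∩ N.E) ∪ ({y | y ∈ l₂} ∩ N.E) := by
    rintro y ⟨hy, hyN⟩
    simp only [mem_ofPred_eq, List.mem_append, List.mem_cons] at hy
    rcases hy with hy | rfl | hy
    · exact Or.inl ⟨by simpa using hy, hyN⟩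
    · exact absurd hyN hxN
    · exact Or.inr ⟨hy, hyN⟩
  calc _ ≤ _ := encard_le_encard this
    _ ≤ _ := encard_union_le _ _
    _ ≤ 1 + 1 := add_le_add (encard_le_one_iff_subsingleton.2 h₁)
      (encard_le_one_iff_subsingleton.2 h₂)
    _ = 2 := by norm_num

/-- If a tame minor keeps at least three elements of a weak fan, then it arises by contracting
the missing rim elements and deleting the missing spoke elements. -/
theorem WeakFan.isMinor_of_notMem (hN : N.Tame) (hNM : N ≤m M) (h : M.WeakFan τ L)
    (h3 : 3 ≤ ({y | y ∈ L} ∩ N.E).encard) (hxL : x ∈ L) (hxN : x ∉ N.E) :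
    (τ x = true → N ≤m M ／ {x} ∧ ¬ N ≤m M ＼ {x}) ∧
      (τ x = false → N ≤m M ＼ {x} ∧ ¬ N ≤m M ／ {x}) := by
  have h3' : ¬ ({y | y ∈ L} ∩ N.E).encard ≤ 2 := fun h' => absurd (h3.trans h') (by norm_num)
  constructor
  · intro hx
    have : ¬ N ≤m M ＼ {x} := fun h' => h3' (h.encard_le_of_delete hN hxL hx h')
    exact ⟨(isMinor_contract_or_delete hNM hxN).resolve_right this, this⟩
  · intro hx
    have : ¬ N ≤m M ／ {x} := fun h' => h3' (by
      have h1 := h.dual.encard_le_of_delete hN.dual hxL (by simp [hx])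
        (by simpa using h'.dual)
      simpa using h1)
    exact ⟨(isMinor_contract_or_delete hNM hxN).resolve_left this, this⟩

theorem WeakFan.isMinor_contract_delete (hN : N.Tame) (hNM : N ≤m M) (h : M.WeakFan τ L)
    (h3 : 3 ≤ ({y | y ∈ L} ∩ N.E).encard) (hpL : p ∈ L) (hpN : p ∉ N.E) (hp : τ p = true)
    (hqL : q ∈ L) (hqN : q ∉ N.E) (hq : τ q = false) : N ≤m M ／ {p} ＼ {q} := by
  have h1 := ((h.isMinor_of_notMem hN hNM h3 hpL hpN).1 hp).1
  refine (isMinor_contract_or_delete h1 hqN).resolve_left fun h2 => ?_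
  refine ((h.isMinor_of_notMem hN hNM h3 hqL hqN).2 hq).2 (h2.trans ?_)
  rw [contract_comm]
  exact ⟨{p}, ∅, by simp⟩

/-- Removing two consecutive elements of a weak fan, the rim element by contraction and the spoke
element by deletion, leaves a weak fan. -/
theorem WeakFan.contract_delete (h : M.WeakFan τ (l₁ ++ p :: q :: l₂)) (hp : τ p = true) :
    (M ／ {p} ＼ {q}).WeakFan τ (l₁ ++ l₂) := by
  have hq : τ q = false := by simpa [hp] using h.alt p q ⟨l₁, l₂, by simp⟩
  have hnd := h.nodup
  simp only [List.nodup_append, List.nodup_cons, List.mem_cons, not_or] at hnd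
  obtain ⟨hnd1, ⟨⟨hpq, hp2⟩, hq2, hnd2⟩, hdis⟩ := hnd
  have hp1 : p ∉ l₁ := fun h' => hdis p h' p (Or.inl rfl) rfl
  have hq1 : q ∉ l₁ := fun h' => hdis q h' q (Or.inr (Or.inl rfl)) rfl
  have hdis' : ∀ a ∈ l₁, ∀ b ∈ l₂, a ≠ b := fun a ha b hb => hdis a ha b (Or.inr (Or.inr hb))
  have hw1 := ((h.infix (l := l₁) ⟨[], p :: q :: l₂, by simp⟩).contract hp1).delete hq1
  have hw2 := ((h.infix (l := l₂) ⟨l₁ ++ [p, q], [], by simp⟩).contract hp2).delete hq2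
  refine ⟨List.nodup_append.2 ⟨hnd1, hnd2, hdis'⟩, fun a b hab => ?_, fun a b c habc => ?_⟩
  · rcases List.infix_append_iff.1 hab with h' | h' | ⟨k₁, k₂, hk, h1, h2⟩
    · exact hw1.alt a b h'
    · exact hw2.alt a b h'
    · match k₁, hk with
      | [], hk => exact hw2.alt a b (by simpa using hk ▸ h2.isInfix)
      | [a'], hk =>
        simp only [List.cons_append, List.nil_append, List.cons.injEq] at hk
        obtain ⟨rfl, rfl⟩ := hk
        obtain ⟨m₁, rfl⟩ := h1
        obtain ⟨m₂, rfl⟩ := h2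
        have e1 := h.alt a p ⟨m₁, q :: ([b] ++ m₂), by simp⟩
        have e2 := h.alt q b ⟨m₁ ++ [a, p], m₂, by simp⟩
        rw [e2, hq, ← e1, hp]; rfl
      | [a', b'], hk =>
        simp only [List.cons_append, List.nil_append, List.cons.injEq] at hk
        obtain ⟨rfl, rfl, rfl⟩ := hk
        exact hw1.alt _ _ h1.isInfix
      | _ :: _ :: _ :: _, hk => simp at hk
  · rcases List.infix_append_iff.1 habc with h' | h' | ⟨k₁, k₂, hk, h1, h2⟩
    · exact hw1.triple a b c h'
    · exact hw2.triple a b c h'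
    · match k₁, hk with
      | [], hk => exact hw2.triple a b c (by simpa using hk ▸ h2.isInfix)
      | [a'], hk =>
        simp only [List.cons_append, List.nil_append, List.cons.injEq] at hk
        obtain ⟨rfl, rfl⟩ := hk
        obtain ⟨m₁, rfl⟩ := h1
        obtain ⟨m₂, rfl⟩ := h2
        simp only [List.mem_append, List.mem_cons, List.not_mem_nil, or_false, not_or]
          at hp1 hq1 hp2 hq2 hdis'
        have e2 := h.alt q b ⟨m₁ ++ [a, p], c :: m₂, by simp⟩
        have hab := hdis' a (by simp) b (by simp)
        have hac := hdis' a (by simp) c (by simp)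
        have t1 := (h.triple a p q ⟨m₁, b :: c :: m₂, by simp⟩).1 hp
        have t2 := (h.triple q b c ⟨m₁ ++ [a, p], m₂, by simp⟩).1 (by simp [e2, hq])
        have t1' : (M ／ {p}).Cyc {a, q} := t1.contract_of_eq (by
          ext y; simp only [mem_sdiff, mem_insert_iff, mem_singleton_iff]; grind)
        have t2' : (M ／ {p}).Cyc {q, b, c} := t2.contract_of_eq (by
          ext y; simp only [mem_sdiff, mem_insert_iff, mem_singleton_iff]; grind)
        have t3 := t1'.elim (x := q) t2' (by
          ext y; simp only [mem_inter_iff, mem_insert_iff, mem_singleton_iff]; grind)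
        rw [e2, hq]
        refine ⟨fun _ => ?_, by simp⟩
        convert t3.delete (D := {q}) (by simp) using 1
        ext y; simp only [mem_sdiff, mem_union, mem_insert_iff, mem_singleton_iff]; grind
      | [a', b'], hk =>
        simp only [List.cons_append, List.nil_append, List.cons.injEq] at hk
        obtain ⟨rfl, rfl, rfl⟩ := hk
        obtain ⟨m₁, rfl⟩ := h1
        obtain ⟨m₂, rfl⟩ := h2
        simp only [List.mem_append, List.mem_cons, List.not_mem_nil, or_false, not_or]
          at hp1 hq1 hp2 hq2 hdis'
        have e2 := h.alt b p ⟨m₁ ++ [a], q :: c :: m₂, by simp⟩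
        have hab := hdis' a (by simp) c (by simp)
        have hac := hdis' b (by simp) c (by simp)
        have hb : τ b = false := by rw [hp] at e2; simpa using e2
        have t1 := (h.triple a b p ⟨m₁, q :: c :: m₂, by simp⟩).2 hb
        have t2 := (h.triple p q c ⟨m₁ ++ [a, b], m₂, by simp⟩).2 hq
        have t3 := t1.elim (x := p) t2 (by
          ext y; simp only [mem_inter_iff, mem_insert_iff, mem_singleton_iff]; grind)
        have t4 := Cyc.dual_contract (C := {p}) t3 (by simp)
        rw [hb]
        refine ⟨by simp, fun _ => t4.dual_delete_of_eq ?_⟩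
        ext y; simp only [mem_sdiff, mem_union, mem_insert_iff, mem_singleton_iff]; grind
      | [a', b', c'], hk =>
        simp only [List.cons_append, List.nil_append, List.cons.injEq] at hk
        obtain ⟨rfl, rfl, rfl, rfl⟩ := hk
        exact hw1.triple _ _ _ h1.isInfix
      | _ :: _ :: _ :: _ :: _, hk => simp at hk

/-- A sequence with an element satisfying `P` has such an element at an end, or two consecutive
ones, or an isolated one in the interior. -/
theorem exists_end_or_pair_or_isolated (P : α → Prop) (hx : x ∈ L) (hPx : P x) :
    (∃ q l, L = q :: l ∧ P q) ∨ (∃ q l, L = l ++ [q] ∧ P q) ∨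
      (∃ l₁ p q l₂, L = l₁ ++ p :: q :: l₂ ∧ P p ∧ P q ∧ l₁ ≠ [] ∧ l₂ ≠ []) ∨
      (∃ l₁ a q b l₂, L = l₁ ++ a :: q :: b :: l₂ ∧ ¬ P a ∧ P q ∧ ¬ P b) := by
  obtain ⟨l₁, l₂, rfl⟩ := List.append_of_mem hx
  rcases List.eq_nil_or_concat l₁ with rfl | ⟨k₁, a, rfl⟩
  · exact Or.inl ⟨x, l₂, by simp, hPx⟩
  cases l₂ with
  | nil => exact Or.inr (Or.inl ⟨x, _, rfl, hPx⟩)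
  | cons b k₂ =>
    by_cases ha : P a
    · by_cases hk : k₁ = []
      · subst hk; exact Or.inl ⟨a, x :: b :: k₂, by simp, ha⟩
      · exact Or.inr (Or.inr (Or.inl ⟨k₁, a, x, b :: k₂, by simp, ha, hPx, hk, by simp⟩))
    · by_cases hb : P b
      · by_cases hk : k₂ = []
        · subst hk; exact Or.inr (Or.inl ⟨b, k₁ ++ [a, x], by simp, hb⟩)
        · exact Or.inr (Or.inr (Or.inl ⟨k₁ ++ [a], x, b, k₂, by simp, hPx, hb, by simp, hk⟩))
      · exact Or.inr (Or.inr (Or.inr ⟨k₁, a, x, b, k₂, by simp, ha, hPx, hb⟩))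

/-- A tame minor that keeps three elements of a weak fan does not miss a single element between two
elements that it keeps. -/
theorem WeakFan.not_isolated (hN : N.Tame) (hNM : N ≤m M) (h : M.WeakFan τ L)
    (h3 : 3 ≤ ({y | y ∈ L} ∩ N.E).encard) (habc : [a, x, b] <:+: L) (ha : a ∈ N.E) (hb : b ∈ N.E) :
    x ∈ N.E := by
  by_contra hxN
  have h' := h.isMinor_of_notMem hN hNM h3 (mem_of_triple_infix habc).2.1 hxN
  have ht := h.triple _ _ _ habc
  have hs : ({a, x, b} : Set α) \ {x} = {a, b} := by
    ext y; simp only [mem_sdiff, mem_insert_iff, mem_singleton_iff]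
    constructor
    · tauto
    · rintro (rfl | rfl)
      · exact ⟨Or.inl rfl, fun h => hxN (h ▸ ha)⟩
      · exact ⟨Or.inr (Or.inr rfl), fun h => hxN (h ▸ hb)⟩
  cases hx : τ x with
  | true => exact hN.not_cyc_pair (h'.1 hx).1 ha hb ((ht.1 hx).contract_of_eq hs)
  | false => exact hN.dual.not_cyc_pair (h'.2 hx).1.dual ha hb ((ht.2 hx).dual_delete_of_eq hs)

end WeakFan

/-! ### A matroid is determined by a minor and its weak fans -/

section Determined

variable {α : Type*} {M N M₁ M₂ : Matroid α} {S T : Set α} {a b c d e x y p q e₁ e₂ e₃ : α}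
  {τ : α → Bool} {β : Bool} {L l l₁ l₂ : List α}

/-- The contraction of a rim element (`β = true`) or the deletion of a spoke element. -/
def red (M : Matroid α) (β : Bool) (x : α) : Matroid α := bif β then M ／ {x} else M ＼ {x}

@[simp] theorem red_ground : (M.red β x).E = M.E \ {x} := by cases β <;> rfl

theorem dual_red : (M.red β x)✶ = M✶.red (!β) x := by
  cases β <;> simp [red]

theorem BCyc.red_of_eq (h : M.BCyc β S) (hT : S \ {x} = T) : (M.red β x).BCyc β T := by
  cases β
  · exact ⟨by simp, fun _ => (h.2 rfl).dual_delete_of_eq hT⟩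
  · exact ⟨fun _ => (h.1 rfl).contract_of_eq hT, by simp⟩

theorem WeakFan.red (h : M.WeakFan τ L) (hx : x ∉ L) : (M.red β x).WeakFan τ L := by
  cases β
  · exact h.delete hx
  · exact h.contract hx

theorem WeakFan.isMinor_red (hN : N.Tame) (hNM : N ≤m M) (h : M.WeakFan τ L)
    (h3 : 3 ≤ ({y | y ∈ L} ∩ N.E).encard) (hxL : x ∈ L) (hxN : x ∉ N.E) :
    N ≤m M.red (τ x) x := by
  have := h.isMinor_of_notMem hN hNM h3 hxL hxN
  cases hx : τ x with
  | false => exact (this.2 hx).1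
  | true => exact (this.1 hx).1

theorem WeakFan.isMinor_red_red (hN : N.Tame) (hNM : N ≤m M) (h : M.WeakFan τ (l₁ ++ p :: q :: l₂))
    (h3 : 3 ≤ ({y | y ∈ l₁ ++ p :: q :: l₂} ∩ N.E).encard) (hp : p ∉ N.E) (hq : q ∉ N.E) :
    N ≤m (M.red (τ p) p).red (τ q) q ∧ ((M.red (τ p) p).red (τ q) q).WeakFan τ (l₁ ++ l₂) := by
  have hpq := h.alt p q ⟨l₁, l₂, by simp⟩
  have hne : p ≠ q := by
    rintro rfl; revert hpq; cases τ p <;> simp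
  cases hp' : τ p with
  | true =>
    have hq' : τ q = false := by simp [hpq, hp']
    rw [hq']
    exact ⟨h.isMinor_contract_delete hN hNM h3 (by simp) hp hp' (by simp) hq hq',
      h.contract_delete hp'⟩
  | false =>
    have hq' : τ q = true := by simp [hpq, hp']
    have : (M.red false p).red true q = M ／ {q} ＼ {p} := by
      exact (contract_delete_comm M (by simpa using hne.symm)).symm
    rw [hq', this]
    refine ⟨h.isMinor_contract_delete hN hNM h3 (by simp) hq hq' (by simp) hp hp', ?_⟩
    have h' := h.reverse
    simp only [List.reverse_append, List.reverse_cons, List.append_assoc, List.cons_append,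
      List.nil_append] at h'
    simpa using (h'.contract_delete hq').reverse

theorem inter_ground_cons (hq : q ∉ N.E) :
    {y | y ∈ q :: l} ∩ N.E = {y | y ∈ l} ∩ N.E := by
  ext y; simp only [mem_inter_iff, mem_ofPred_eq, List.mem_cons]
  constructor
  · rintro ⟨rfl | h, h'⟩
    · contradiction
    · exact ⟨h, h'⟩
  · tauto

theorem inter_ground_append_cons (hq : q ∉ N.E) :
    {y | y ∈ l₁ ++ q :: l₂} ∩ N.E = {y | y ∈ l₁ ++ l₂} ∩ N.E := by
  ext y; simp only [mem_inter_iff, mem_ofPred_eq, List.mem_append, List.mem_cons]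
  constructor
  · rintro ⟨h | rfl | h, h'⟩
    · exact ⟨Or.inl h, h'⟩
    · contradiction
    · exact ⟨Or.inr h, h'⟩
  · tauto

open Classical in
/-- The elements of a weak fan that belong to a tame minor form a weak fan of the minor, if there
are at least three of them. -/
theorem WeakFan.filter (n : ℕ) : ∀ (M : Matroid α) (L : List α), L.length = n → N.Tame → N ≤m M →
    M.WeakFan τ L → 3 ≤ ({y | y ∈ L} ∩ N.E).encard →
    N.WeakFan τ (L.filter (fun x => x ∈ N.E)) := by
  induction n using Nat.strong_induction_on with
  | _ n ih =>
  intro M L hn hN hNM h h3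
  by_cases hall : ∀ x ∈ L, x ∈ N.E
  · rw [List.filter_eq_self.2 (by simpa using hall)]
    exact h.of_isMinor hNM hall
  push Not at hall
  obtain ⟨x, hxL, hxN⟩ := hall
  rcases exists_end_or_pair_or_isolated (fun x => x ∉ N.E) hxL hxN with
    ⟨q, l, rfl, hq⟩ | ⟨q, l, rfl, hq⟩ | ⟨l₁, p, q, l₂, rfl, hp, hq, -, -⟩ |
      ⟨l₁, a, q, b, l₂, rfl, ha, hq, hb⟩
  · have := ih l.length (by simp at hn; omega) (M.red (τ q) q) l rfl hN
      (h.isMinor_red hN hNM h3 (by simp) hq) (h.tail.red (List.nodup_cons.1 h.nodup).1)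
      (by rwa [inter_ground_cons hq] at h3)
    simpa [hq] using this
  · have := ih l.length (by simp at hn; omega) (M.red (τ q) q) l rfl hN
      (h.isMinor_red hN hNM h3 (by simp) hq)
      ((h.infix (List.prefix_append l [q]).isInfix).red (by
        have := h.nodup
        simp only [List.nodup_append] at this
        exact fun h' => this.2.2 q h' q (by simp) rfl))
      (by rwa [inter_ground_append_cons hq, List.append_nil] at h3)
    simpa [hq] using this
  · obtain ⟨h1, h2⟩ := h.isMinor_red_red hN hNM h3 hp hq
    have := ih (l₁ ++ l₂).length (by simp at hn ⊢; omega) _ _ rfl hN h1 h2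
      (by rwa [inter_ground_append_cons hp, inter_ground_append_cons hq] at h3)
    simpa [hp, hq] using this
  · exact absurd (h.not_isolated hN hNM h3 ⟨l₁, l₂, by simp⟩ (not_not.1 ha) (not_not.1 hb)) hq

theorem ext_of_delete (hE : M₁.E = M₂.E) (h : M₁ ＼ {q} = M₂ ＼ {q})
    (hq : ∀ F ⊆ M₁.E, q ∉ F → (q ∈ M₁.closure F ↔ q ∈ M₂.closure F)) : M₁ = M₂ := by
  have key : ∀ J, q ∉ J → (M₁.Indep J ↔ M₂.Indep J) := fun J hJ => by
    rw [indep_iff_delete_of_disjoint (disjoint_singleton_right.2 hJ), h,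
      ← indep_iff_delete_of_disjoint (disjoint_singleton_right.2 hJ)]
  refine ext_indep hE fun I hI => ?_
  by_cases hqI : q ∈ I
  swap
  · exact key I hqI
  have hins : insert q (I \ {q}) = I := insert_sdiff_self_of_mem hqI
  have hqI' : q ∉ I \ {q} := fun h => h.2 rfl
  have hmem : q ∈ M₁.E \ M₁.closure (I \ {q}) ↔ q ∈ M₂.E \ M₂.closure (I \ {q}) :=
    and_congr (by rw [hE]) (not_congr (hq _ (sdiff_subset.trans hI) hqI'))
  rw [← hins, insert_indep_iff, insert_indep_iff, key _ hqI', hmem]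

theorem mem_closure_iff_of_delete_eq (h : M₁ ＼ {q} = M₂ ＼ {q}) {F : Set α} (hF : q ∉ F)
    (he : e ≠ q) : e ∈ M₁.closure F ↔ e ∈ M₂.closure F := by
  have h1 : ∀ M : Matroid α, e ∈ M.closure F ↔ e ∈ (M ＼ {q}).closure F := fun M => by
    rw [delete_closure_eq_of_disjoint _ (disjoint_singleton_right.2 hF)]; simp [he]
  rw [h1, h, ← h1]

theorem Cyc.mem_closure_of_triple (h : M.Cyc {a, b, c}) {X : Set α} (hb : b ∈ M.closure X)
    (hc : c ∈ M.closure X) : a ∈ M.closure X := by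
  refine M.closure_subset_closure_of_subset_closure ?_ (h a (by simp))
  rintro y ⟨rfl | rfl | rfl, hy⟩
  · exact absurd rfl hy
  · exact hb
  · exact hc

/-- An element `q` on the line through `e₁` and `e₂` whose position is forced because it avoids the
triad `{e₁, e₂, e₃}`: the sets that span it can be read off from the deletion of `q`. -/
theorem mem_closure_iff_of_triangle_triad (hq1 : q ≠ e₁) (hq2 : q ≠ e₂) (hq3 : q ≠ e₃)
    (ht : M.Cyc {q, e₁, e₂}) (hd : M✶.Cyc {e₁, e₂, e₃}) {F : Set α} (hF : F ⊆ M.E) (hqF : q ∉ F) :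
    q ∈ M.closure F ↔ (e₁ ∈ M.closure F ∧ e₂ ∈ M.closure F) ∨
      (e₁ ∉ M.closure F ∧ e₂ ∉ M.closure F ∧ e₂ ∈ M.closure (insert e₁ (F \ {e₃}))) := by
  obtain ⟨hdE, hd⟩ := dual_cyc_iff.1 hd
  have ht1 : M.Cyc {e₁, e₂, q} := by
    rwa [show ({e₁, e₂, q} : Set α) = {q, e₁, e₂} by ext; simp; tauto]
  have ht2 : M.Cyc {e₂, q, e₁} := by
    rwa [show ({e₂, q, e₁} : Set α) = {q, e₁, e₂} by ext; simp; tauto]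
  have hqE : q ∈ M.E := ht.subset_ground (by simp)
  have he1E : e₁ ∈ M.E := hdE (by simp)
  by_cases h1 : e₁ ∈ M.closure F
  · simp only [h1, true_and, not_true, false_and, or_false]
    exact ⟨fun hq => ht2.mem_closure_of_triple hq h1, fun h2 => ht.mem_closure_of_triple h1 h2⟩
  by_cases h2 : e₂ ∈ M.closure F
  · simp only [h1, h2, not_true, false_and, and_false, or_false, iff_false]
    exact fun hq => h1 (ht1.mem_closure_of_triple h2 hq)
  simp only [h1, h2, false_and, not_false_iff, true_and, false_or]
  have hsub : insert q (F \ {e₃}) ⊆ M.E \ {e₁, e₂, e₃} := by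
    have a1 : e₁ ∉ F := fun h => h1 (mem_closure_of_mem _ h)
    have a2 : e₂ ∉ F := fun h => h2 (mem_closure_of_mem _ h)
    rintro y (rfl | ⟨hy, hy3⟩)
    · exact ⟨hqE, by simp [hq1, hq2, hq3]⟩
    · refine ⟨hF hy, ?_⟩
      rintro (rfl | rfl | rfl)
      · exact a1 hy
      · exact a2 hy
      · exact hy3 rfl
  have hq_of : ∀ e ∈ ({e₁, e₂, e₃} : Set α), q ∈ M.closure (insert e (F \ {e₃})) →
      q ∈ M.closure (F \ {e₃}) := by
    intro e he hqe
    by_contra hq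
    exact hd e he (M.closure_subset_closure hsub (closure_exchange ⟨hqe, hq⟩).1)
  constructor
  · intro hq
    have hq' : q ∈ M.closure (F \ {e₃}) := by
      refine hq_of e₃ (by simp) (M.closure_subset_closure ?_ hq)
      intro y hy
      by_cases hy3 : y = e₃
      · exact Or.inl hy3
      · exact Or.inr ⟨hy, hy3⟩
    exact ht2.mem_closure_of_triple (M.closure_subset_closure (subset_insert _ _) hq')
      (mem_closure_of_mem' _ (mem_insert _ _) he1E)
  · intro h
    refine M.closure_subset_closure sdiff_subset (hq_of e₁ (by simp) ?_)
    exact ht.mem_closure_of_triple (mem_closure_of_mem' _ (mem_insert _ _) he1E) h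

theorem eq_of_delete_eq_of_triangle_triad (hq1 : q ≠ e₁) (hq2 : q ≠ e₂) (hq3 : q ≠ e₃)
    (ht₁ : M₁.Cyc {q, e₁, e₂}) (hd₁ : M₁✶.Cyc {e₁, e₂, e₃})
    (ht₂ : M₂.Cyc {q, e₁, e₂}) (hd₂ : M₂✶.Cyc {e₁, e₂, e₃}) (hE : M₁.E = M₂.E)
    (h : M₁ ＼ {q} = M₂ ＼ {q}) : M₁ = M₂ := by
  refine ext_of_delete hE h fun F hF hqF => ?_
  rw [mem_closure_iff_of_triangle_triad hq1 hq2 hq3 ht₁ hd₁ hF hqF,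
    mem_closure_iff_of_triangle_triad hq1 hq2 hq3 ht₂ hd₂ (hE ▸ hF) hqF,
    mem_closure_iff_of_delete_eq h hqF hq1.symm, mem_closure_iff_of_delete_eq h hqF hq2.symm,
    mem_closure_iff_of_delete_eq h (F := insert e₁ (F \ {e₃})) (by simp [hq1, hqF]) hq2.symm]

theorem eq_of_delete_eq_of_parallel (hqe : q ≠ e) (h₁ : M₁.Cyc {q, e}) (h₂ : M₂.Cyc {q, e})
    (hE : M₁.E = M₂.E) (h : M₁ ＼ {q} = M₂ ＼ {q}) : M₁ = M₂ := by
  have key : ∀ M : Matroid α, M.Cyc {q, e} → ∀ F, q ∈ M.closure F ↔ e ∈ M.closure F := by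
    intro M hM F
    refine ⟨fun h => ?_, fun h => ?_⟩
    · refine M.closure_subset_closure_of_subset_closure ?_ (hM e (by simp))
      rintro y ⟨rfl | rfl, hy⟩
      · exact h
      · exact absurd rfl hy
    · refine M.closure_subset_closure_of_subset_closure ?_ (hM q (by simp))
      rintro y ⟨rfl | rfl, hy⟩
      · exact absurd rfl hy
      · exact h
  refine ext_of_delete hE h fun F _ hqF => ?_
  rw [key _ h₁, key _ h₂, mem_closure_iff_of_delete_eq h hqF hqe.symm]

theorem eq_of_red_eq_of_pair (hqe : q ≠ e) (h₁ : M₁.BCyc (!β) {q, e}) (h₂ : M₂.BCyc (!β) {q, e})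
    (hE : M₁.E = M₂.E) (h : M₁.red β q = M₂.red β q) : M₁ = M₂ := by
  cases β with
  | false => exact eq_of_delete_eq_of_parallel hqe (h₁.1 rfl) (h₂.1 rfl) hE h
  | true =>
    have h' := congr_arg Matroid.dual h
    rw [dual_red, dual_red] at h'
    exact dual_inj.1 (eq_of_delete_eq_of_parallel hqe (h₁.2 rfl) (h₂.2 rfl) hE h')

/-- A matroid with the weak fan `(q, e₁, e₂, e₃)` is determined by the matroid from which the end
`q` has been removed. -/
theorem WeakFan.eq_of_red_eq (h₁ : M₁.WeakFan τ [q, e₁, e₂, e₃])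
    (h₂ : M₂.WeakFan τ [q, e₁, e₂, e₃]) (hE : M₁.E = M₂.E)
    (h : M₁.red (τ q) q = M₂.red (τ q) q) : M₁ = M₂ := by
  have hnd := h₁.nodup
  simp only [List.nodup_cons, List.mem_cons, List.not_mem_nil, or_false, not_or] at hnd
  have a1 : τ e₁ = !τ q := h₁.alt q e₁ ⟨[], [e₂, e₃], rfl⟩
  have a2 : τ e₂ = !τ e₁ := h₁.alt e₁ e₂ ⟨[q], [e₃], rfl⟩
  have t₁ := h₁.triple q e₁ e₂ ⟨[], [e₃], rfl⟩
  have t₂ := h₂.triple q e₁ e₂ ⟨[], [e₃], rfl⟩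
  have d₁ := h₁.triple e₁ e₂ e₃ ⟨[q], [], rfl⟩
  have d₂ := h₂.triple e₁ e₂ e₃ ⟨[q], [], rfl⟩
  cases hq : τ q with
  | false =>
    simp only [hq, Bool.not_false] at a1
    simp only [a1, Bool.not_true] at a2
    rw [hq] at h; rw [a1] at t₁ t₂; rw [a2] at d₁ d₂
    exact eq_of_delete_eq_of_triangle_triad hnd.1.1 hnd.1.2.1 hnd.1.2.2 (t₁.1 rfl) (d₁.2 rfl)
      (t₂.1 rfl) (d₂.2 rfl) hE h
  | true =>
    simp only [hq, Bool.not_true] at a1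
    simp only [a1, Bool.not_false] at a2
    rw [hq] at h; rw [a1] at t₁ t₂; rw [a2] at d₁ d₂
    have h' := congr_arg Matroid.dual h
    rw [dual_red, dual_red] at h'
    exact dual_inj.1 (eq_of_delete_eq_of_triangle_triad hnd.1.1 hnd.1.2.1 hnd.1.2.2 (t₁.2 rfl)
      (by simpa using d₁.1 rfl) (t₂.2 rfl) (by simpa using d₂.1 rfl) hE h')

theorem WeakFan.eq_of_red_red_eq (h₁ : M₁.WeakFan τ [d, p, q, a, b])
    (h₂ : M₂.WeakFan τ [d, p, q, a, b]) (hE : M₁.E = M₂.E)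
    (h : (M₁.red (τ p) p).red (τ q) q = (M₂.red (τ p) p).red (τ q) q) : M₁ = M₂ := by
  refine WeakFan.eq_of_red_eq (h₁.infix ⟨[d], [], rfl⟩) (h₂.infix ⟨[d], [], rfl⟩) hE ?_
  have hnd := h₁.nodup
  simp only [List.nodup_cons, List.mem_cons, List.not_mem_nil, or_false, not_or] at hnd
  have a2 : τ q = !τ p := h₁.alt p q ⟨[d], [a, b], rfl⟩
  have t₁ := h₁.triple d p q ⟨[], [a, b], rfl⟩
  have t₂ := h₂.triple d p q ⟨[], [a, b], rfl⟩
  have hs : ({d, p, q} : Set α) \ {p} = {q, d} := by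
    ext y; simp only [mem_sdiff, mem_insert_iff, mem_singleton_iff]; grind
  rw [a2] at h
  exact eq_of_red_eq_of_pair (e := d) (by grind) (by simpa using t₁.red_of_eq hs)
    (by simpa using t₂.red_of_eq hs) (by simp [hE]) h

theorem encard_red_ground_sdiff_le {n : ℕ} (hx : x ∈ M.E) (hxN : x ∉ N.E)
    (h : (M.E \ N.E).encard ≤ (n + 1 : ℕ)) : ((M.red β x).E \ N.E).encard ≤ n := by
  have hx' : x ∈ M.E \ N.E := ⟨hx, hxN⟩
  have h1 := encard_sdiff_singleton_add_one hx'
  rw [red_ground, sdiff_sdiff_comm]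
  rw [← h1, Nat.cast_add, Nat.cast_one] at h
  exact (ENat.add_le_add_iff_right (by simp)).1 h

theorem le_length_of_le_encard {l : List α} {S : Set α} {n : ℕ}
    (h : (n : ℕ∞) ≤ ({y | y ∈ l} ∩ S).encard) : n ≤ l.length := by
  classical
  have h1 : ({y | y ∈ l} ∩ S).encard ≤ l.length := by
    calc _ ≤ ({y | y ∈ l} : Set α).encard := encard_le_encard inter_subset_left
      _ = (l.toFinset : Set α).encard := by congr 1; ext; simp
      _ = l.toFinset.card := encard_coe_eq_coe_finsetCard _
      _ ≤ _ := by exact_mod_cast l.toFinset_card_le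
  exact_mod_cast h.trans h1

/-- A matroid is determined by a tame minor `N` and by disjoint weak fans that cover the elements
outside `N` and that each have at least three elements in `N`. -/
theorem eq_of_weakFans {ι : Type*} (hN : N.Tame) (τ : ι → α → Bool) (n : ℕ) :
    ∀ (M₁ M₂ : Matroid α) (F : ι → List α), (M₁.E \ N.E).encard ≤ n → M₁.E = M₂.E →
    N ≤m M₁ → N ≤m M₂ → (∀ j, M₁.WeakFan (τ j) (F j)) → (∀ j, M₂.WeakFan (τ j) (F j)) →
    (∀ i j, i ≠ j → ∀ x ∈ F i, x ∉ F j) → (∀ x ∈ M₁.E \ N.E, ∃ j, x ∈ F j) →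
    (∀ j, 3 ≤ ({y | y ∈ F j} ∩ N.E).encard) → M₁ = M₂ := by
  classical
  induction n with
  | zero =>
    intro M₁ M₂ F hn hE h₁ h₂ _ _ _ _ _
    have : M₁.E \ N.E = ∅ := by simpa using hn
    have hs : M₁.E ⊆ N.E := sdiff_eq_empty.1 this
    rw [h₁.eq_of_ground_subset hs, h₂.eq_of_ground_subset (hE ▸ hs)]
  | succ n ih =>
  intro M₁ M₂ F hn hE h₁ h₂ hF₁ hF₂ hdis hcov h3
  by_cases hs : M₁.E ⊆ N.E
  · rw [h₁.eq_of_ground_subset hs, h₂.eq_of_ground_subset (hE ▸ hs)]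
  obtain ⟨x, hxM, hxN⟩ := not_subset.1 hs
  obtain ⟨j, hxj⟩ := hcov x ⟨hxM, hxN⟩
  -- removing elements of the `j`-th weak fan leaves a situation of the same kind
  have step : ∀ (M₁' M₂' : Matroid α) (l : List α), (M₁'.E \ N.E).encard ≤ n → M₁'.E = M₂'.E →
      N ≤m M₁' → N ≤m M₂' → (∀ x ∈ M₁'.E, x ∈ M₁.E) → l ⊆ F j →
      (∀ x ∈ F j, x ∈ l ∨ x ∉ M₁'.E) → (∀ k, k ≠ j → M₁'.WeakFan (τ k) (F k)) →
      (∀ k, k ≠ j → M₂'.WeakFan (τ k) (F k)) → M₁'.WeakFan (τ j) l → M₂'.WeakFan (τ j) l →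
      M₁' = M₂' := by
    intro M₁' M₂' l hn' hE' h₁' h₂' hsub hl hl' hk₁ hk₂ hj₁ hj₂
    refine ih M₁' M₂' (Function.update F j l) hn' hE' h₁' h₂' ?_ ?_ ?_ ?_ ?_
    · intro k
      by_cases hk : k = j
      · subst hk; simpa using hj₁
      · simpa [hk] using hk₁ k hk
    · intro k
      by_cases hk : k = j
      · subst hk; simpa using hj₂
      · simpa [hk] using hk₂ k hk
    · intro i k hik x hx
      by_cases hi : i = j
      · subst hi
        rw [Function.update_self] at hx
        rw [Function.update_of_ne hik.symm]
        exact hdis i k hik x (hl hx)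
      · rw [Function.update_of_ne hi] at hx
        by_cases hk : k = j
        · subst hk
          rw [Function.update_self]
          exact fun h => hdis i k hik x hx (hl h)
        · rw [Function.update_of_ne hk]
          exact hdis i k hik x hx
    · rintro x ⟨hx, hxN⟩
      obtain ⟨k, hk⟩ := hcov x ⟨hsub x hx, hxN⟩
      by_cases hkj : k = j
      · subst hkj
        exact ⟨k, by simpa using (hl' x hk).resolve_right (not_not.2 hx)⟩
      · exact ⟨k, by simpa [hkj] using hk⟩
    · intro k
      by_cases hk : k = j
      · subst hk
        rw [Function.update_self]
        refine (h3 k).trans (encard_le_encard ?_)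
        rintro y ⟨hy, hyN⟩
        exact ⟨(hl' y hy).resolve_right (not_not.2 (h₁'.subset hyN)), hyN⟩
      · simpa [hk] using h3 k
  have hother : ∀ y ∈ F j, ∀ k, k ≠ j → y ∉ F k := fun y hy k hk => hdis j k hk.symm y hy
  have hend : ∀ q l, (∀ M : Matroid α, M.WeakFan (τ j) (F j) → M.WeakFan (τ j) (q :: l)) →
      (∀ x, x ∈ F j ↔ x ∈ q :: l) → q ∉ N.E → M₁ = M₂ := by
    intro q l hw hmem hq
    have hw₁ := hw _ (hF₁ j)
    have hw₂ := hw _ (hF₂ j)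
    have h3' : 3 ≤ ({y | y ∈ q :: l} ∩ N.E).encard := by
      simp_rw [← hmem]; exact h3 j
    have hql : q ∉ l := (List.nodup_cons.1 hw₁.nodup).1
    have hlen : 3 ≤ l.length := le_length_of_le_encard (S := N.E)
      (by rwa [inter_ground_cons hq] at h3')
    have hqM : q ∈ M₁.E := by
      match l, hlen with
      | a :: b :: l, _ => exact (hw₁.triple q a b ⟨[], l, rfl⟩).subset_ground (by simp)
    have hqF : q ∈ F j := (hmem q).2 (by simp)
    have heq : M₁.red (τ j q) q = M₂.red (τ j q) q := by
      refine step _ _ l (encard_red_ground_sdiff_le hqM hq hn) (by simp [hE])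
        (hw₁.isMinor_red hN h₁ h3' (by simp) hq) (hw₂.isMinor_red hN h₂ h3' (by simp) hq)
        (fun x hx => by simp at hx; exact hx.1) (fun x hx => (hmem x).2 (by simp [hx]))
        (fun x hx => ?_) (fun k hk => (hF₁ k).red (hother q hqF k hk))
        (fun k hk => (hF₂ k).red (hother q hqF k hk)) (hw₁.tail.red hql) (hw₂.tail.red hql)
      rcases List.mem_cons.1 ((hmem x).1 hx) with rfl | h
      · right; simp
      · exact Or.inl h
    match l, hlen with
    | a :: b :: c :: l, _ =>
      exact WeakFan.eq_of_red_eq (hw₁.infix ⟨[], l, rfl⟩) (hw₂.infix ⟨[], l, rfl⟩) hE heq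
  have hpair : ∀ l₁ p q l₂,
      (∀ M : Matroid α, M.WeakFan (τ j) (F j) → M.WeakFan (τ j) (l₁ ++ p :: q :: l₂)) →
      (∀ x, x ∈ F j ↔ x ∈ l₁ ++ p :: q :: l₂) → p ∉ N.E → q ∉ N.E → l₁ ≠ [] → 2 ≤ l₂.length →
      M₁ = M₂ := by
    intro l₁ p q l₂ hw hmem hp hq hl₁ hl₂
    have hw₁ := hw _ (hF₁ j)
    have hw₂ := hw _ (hF₂ j)
    have h3' : 3 ≤ ({y | y ∈ l₁ ++ p :: q :: l₂} ∩ N.E).encard := by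
      simp_rw [← hmem]; exact h3 j
    have hpF : p ∈ F j := (hmem p).2 (by simp)
    have hqF : q ∈ F j := (hmem q).2 (by simp)
    have hpM : p ∈ M₁.E := by
      match l₂, hl₂ with
      | a :: b :: l, _ =>
        exact (hw₁.triple p q a ⟨l₁, b :: l, by simp⟩).subset_ground (by simp)
    have heq : (M₁.red (τ j p) p).red (τ j q) q = (M₂.red (τ j p) p).red (τ j q) q := by
      obtain ⟨m₁, w₁⟩ := hw₁.isMinor_red_red hN h₁ h3' hp hq
      obtain ⟨m₂, w₂⟩ := hw₂.isMinor_red_red hN h₂ h3' hp hq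
      refine step _ _ (l₁ ++ l₂) ?_ (by simp [hE]) m₁ m₂ (fun x hx => by simp at hx; exact hx.1.1)
        (fun x hx => (hmem x).2 ?_) (fun x hx => ?_)
        (fun k hk => ((hF₁ k).red (hother p hpF k hk)).red (hother q hqF k hk))
        (fun k hk => ((hF₂ k).red (hother p hpF k hk)).red (hother q hqF k hk)) w₁ w₂
      · refine (encard_le_encard ?_).trans (encard_red_ground_sdiff_le (β := true) hpM hp hn)
        simp only [red_ground]
        exact sdiff_subset_sdiff_left sdiff_subset
      · simp only [List.mem_append, List.mem_cons] at hx ⊢; tauto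
      · have := (hmem x).1 hx
        simp only [List.mem_append, List.mem_cons] at this ⊢
        rcases this with h | rfl | rfl | h
        · exact Or.inl (Or.inl h)
        · right; simp
        · right; simp
        · exact Or.inl (Or.inr h)
    obtain ⟨k₁, d, rfl⟩ := (List.eq_nil_or_concat l₁).resolve_left hl₁
    match l₂, hl₂ with
    | a :: b :: l, _ =>
      exact WeakFan.eq_of_red_red_eq (d := d) (a := a) (b := b) (hw₁.infix ⟨k₁, l, by simp⟩)
        (hw₂.infix ⟨k₁, l, by simp⟩) hE heq
  rcases exists_end_or_pair_or_isolated (fun x => x ∉ N.E) hxj hxN with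
    ⟨q, l, hl, hq⟩ | ⟨q, l, hl, hq⟩ | ⟨l₁, p, q, l₂, hl, hp, hq, hne₁, hne₂⟩ |
      ⟨l₁, a, q, b, l₂, hl, ha, hq, hb⟩
  · exact hend q l (fun M hM => hl ▸ hM) (fun x => by rw [hl]) hq
  · refine hend q l.reverse (fun M hM => ?_) (fun x => ?_) hq
    · have := hM.reverse
      rw [hl] at this
      simpa using this
    · simp [hl, or_comm]
  · by_cases h2 : 2 ≤ l₂.length
    · exact hpair l₁ p q l₂ (fun M hM => hl ▸ hM) (fun x => by rw [hl]) hp hq hne₁ h2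
    · refine hpair l₂.reverse q p l₁.reverse (fun M hM => ?_) (fun x => ?_) hq hp
        (by simpa using hne₂) ?_
      · have := hM.reverse
        rw [hl] at this
        simpa using this
      · simp only [hl, List.mem_append, List.mem_cons, List.mem_reverse]; tauto
      · have h3' := h3 j
        rw [hl, inter_ground_append_cons hp, inter_ground_append_cons hq] at h3'
        have := le_length_of_le_encard (S := N.E) (n := 3) (by exact_mod_cast h3')
        simp only [List.length_append, List.length_reverse] at this ⊢
        omega
  · exact absurd ((hF₁ j).not_isolated hN h₁ (h3 j) ⟨l₁, l₂, by simp [hl]⟩ (not_not.1 ha)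
      (not_not.1 hb)) hq

end Determined

/-! ### Represented matroids -/

section Represented

variable {K V α : Type*} [Field K] [AddCommGroup V] [Module K V] {M N : Matroid α} {f : α → V}
  {X Y I S : Set α} {a b c e : α}

theorem vectorMatroid_isRepresentedBy (f : α → V) (E : Set α) :
    (vectorMatroid K f E).IsRepresentedBy K f := fun I hI => by
  rw [vectorMatroid_indep_iff]
  exact and_iff_right hI

theorem IsRepresentedBy.mem_span_of_isBasis (hf : N.IsRepresentedBy K f) (hI : N.IsBasis I X)
    (he : e ∈ N.E) : e ∈ N.closure X ↔ f e ∈ Submodule.span K (f '' I) := by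
  rw [← hI.closure_eq_closure]
  by_cases heI : e ∈ I
  · exact iff_of_true (mem_closure_of_mem _ heI hI.indep.subset_ground)
      (Submodule.subset_span (mem_image_of_mem f heI))
  · rw [hI.indep.mem_closure_iff_of_notMem heI, ← not_indep_iff
      (insert_subset he hI.indep.subset_ground), hf _ (insert_subset he hI.indep.subset_ground),
      linearIndepOn_insert heI, not_and, not_not]
    exact forall_prop_of_true ((hf I hI.indep.subset_ground).1 hI.indep)

theorem IsRepresentedBy.span_eq_of_isBasis (hf : N.IsRepresentedBy K f) (hI : N.IsBasis I X) :
    Submodule.span K (f '' I) = Submodule.span K (f '' X) := by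
  refine le_antisymm (Submodule.span_mono (image_mono hI.subset)) (Submodule.span_le.2 ?_)
  rintro _ ⟨x, hx, rfl⟩
  have hxE := hI.subset_ground hx
  exact (hf.mem_span_of_isBasis hI hxE).1 (mem_closure_of_mem _ hx hI.subset_ground)

theorem IsRepresentedBy.mem_closure_iff (hf : N.IsRepresentedBy K f) (hX : X ⊆ N.E)
    (he : e ∈ N.E) : e ∈ N.closure X ↔ f e ∈ Submodule.span K (f '' X) := by
  obtain ⟨I, hI⟩ := N.exists_isBasis X
  rw [hf.mem_span_of_isBasis hI he, hf.span_eq_of_isBasis hI]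

theorem finrank_span_image_eq_ncard (hI : LinearIndepOn K f I) (hfin : I.Finite) :
    Module.finrank K (Submodule.span K (f '' I)) = I.ncard := by
  have := hfin.fintype
  have h := finrank_span_eq_card (R := K) (b := fun x : I => f x) hI
  rw [show Set.range (fun x : I => f x) = f '' I from (image_eq_range f I).symm] at h
  rw [h, ← Nat.card_eq_fintype_card, Nat.card_coe_set_eq]

theorem IsRepresentedBy.eRk_eq_finrank (hf : N.IsRepresentedBy K f) (hX : X ⊆ N.E)
    (hfin : X.Finite) : N.eRk X = Module.finrank K (Submodule.span K (f '' X)) := by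
  obtain ⟨I, hI⟩ := N.exists_isBasis X
  have hIfin := hfin.subset hI.subset
  rw [← hf.span_eq_of_isBasis hI, ← hI.encard_eq_eRk,
    finrank_span_image_eq_ncard ((hf I hI.indep.subset_ground).1 hI.indep) hIfin,
    hIfin.cast_ncard_eq]

/-- A set of elements on which some linear functional is nonzero, and off which it vanishes, is a
union of cocircuits. -/
theorem IsRepresentedBy.dual_cyc_of_functional (hf : N.IsRepresentedBy K f) (hS : S ⊆ N.E)
    (h : V →ₗ[K] K) (h0 : ∀ e ∈ N.E, e ∉ S → h (f e) = 0) (h1 : ∀ e ∈ S, h (f e) ≠ 0) :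
    N✶.Cyc S := by
  refine dual_cyc_iff.2 ⟨hS, fun e he hcl => h1 e he ?_⟩
  rw [hf.mem_closure_iff sdiff_subset (hS he)] at hcl
  have : Submodule.span K (f '' (N.E \ S)) ≤ LinearMap.ker h := by
    refine Submodule.span_le.2 ?_
    rintro _ ⟨y, hy, rfl⟩
    exact h0 y hy.1 hy.2
  exact this hcl

theorem IsRepresentedBy.cyc_iff (hf : N.IsRepresentedBy K f) (hS : S ⊆ N.E) :
    N.Cyc S ↔ ∀ e ∈ S, f e ∈ Submodule.span K (f '' (S \ {e})) :=
  forall₂_congr fun _ he => hf.mem_closure_iff (sdiff_subset.trans hS) (hS he)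

theorem IsRepresentedBy.cyc_pair_of_smul (hf : N.IsRepresentedBy K f) (ha : a ∈ N.E) (hb : b ∈ N.E)
    (hab : a ≠ b) {k : K} (hk : k ≠ 0) (h : f a = k • f b) : N.Cyc {a, b} := by
  rw [hf.cyc_iff (insert_subset ha (singleton_subset_iff.2 hb))]
  rintro e (rfl | rfl)
  · rw [h]
    exact Submodule.smul_mem _ _ (Submodule.subset_span ⟨b, ⟨by simp, hab.symm⟩, rfl⟩)
  · have : f e = k⁻¹ • f a := by rw [h, smul_smul, inv_mul_cancel₀ hk, one_smul]
    rw [this]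
    exact Submodule.smul_mem _ _ (Submodule.subset_span ⟨a, ⟨by simp, hab⟩, rfl⟩)

theorem IsRepresentedBy.cyc_singleton_of_zero (hf : N.IsRepresentedBy K f) (ha : a ∈ N.E)
    (h : f a = 0) : N.Cyc {a, a} := by
  rw [hf.cyc_iff (by simpa using ha)]
  rintro e (rfl | rfl) <;> simp [h]

theorem Tame.ne_zero (hN : N.Tame) (hf : N.IsRepresentedBy K f) (ha : a ∈ N.E) : f a ≠ 0 :=
  fun h => (hN a a).1 (hf.cyc_singleton_of_zero ha h)

theorem Tame.not_smul (hN : N.Tame) (hf : N.IsRepresentedBy K f) (ha : a ∈ N.E) (hb : b ∈ N.E)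
    (hab : a ≠ b) (k : K) : f a ≠ k • f b := by
  intro h
  by_cases hk : k = 0
  · exact hN.ne_zero hf ha (by rw [h, hk, zero_smul])
  · exact (hN a b).1 (hf.cyc_pair_of_smul ha hb hab hk h)

theorem IsRepresentedBy.cyc_triple_of_relation (hf : N.IsRepresentedBy K f) (ha : a ∈ N.E)
    (hb : b ∈ N.E) (hc : c ∈ N.E) (hab : a ≠ b) (hac : a ≠ c) (hbc : b ≠ c) {x y z : K}
    (hx : x ≠ 0) (hy : y ≠ 0) (hz : z ≠ 0) (h : x • f a + y • f b + z • f c = 0) :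
    N.Cyc {a, b, c} := by
  rw [hf.cyc_iff (by rintro _ (rfl | rfl | rfl) <;> assumption)]
  have key : ∀ {a b c : α} {x y z : K}, x ≠ 0 → a ≠ b → a ≠ c → x • f a + y • f b + z • f c = 0 →
      f a ∈ Submodule.span K (f '' ({a, b, c} \ {a})) := by
    intro a b c x y z hx hab hac h
    have : f a = (-(x⁻¹ * y)) • f b + (-(x⁻¹ * z)) • f c := by
      rw [neg_smul, neg_smul, mul_smul, mul_smul, ← neg_add, ← smul_add, eq_neg_iff_add_eq_zero]
      nth_rw 1 [← one_smul K (f a), ← inv_mul_cancel₀ hx, mul_smul]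
      rw [← smul_add, ← add_assoc, h, smul_zero]
    rw [this]
    exact Submodule.add_mem _
      (Submodule.smul_mem _ _ (Submodule.subset_span ⟨b, ⟨by simp, hab.symm⟩, rfl⟩))
      (Submodule.smul_mem _ _ (Submodule.subset_span ⟨c, ⟨by simp, hac.symm⟩, rfl⟩))
  rintro e (rfl | rfl | rfl)
  · exact key hx hab hac h
  · have := key (b := a) (c := c) hy hab.symm hbc (by rw [← h]; abel)
    rwa [insert_comm] at this
  · have := key (b := a) (c := b) hz hac.symm hbc.symm (by rw [← h]; abel)
    rwa [show ({a, b, e} : Set α) = {e, a, b} by ext; simp; tauto]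

theorem Tame.relation_of_cyc_triple (hN : N.Tame) (hf : N.IsRepresentedBy K f)
    (hab : a ≠ b) (hac : a ≠ c) (h : N.Cyc {a, b, c}) :
    ∃ x y z : K, x ≠ 0 ∧ y ≠ 0 ∧ z ≠ 0 ∧ x • f a + y • f b + z • f c = 0 := by
  have hE := h.subset_ground
  have ha : a ∈ N.E := hE (by simp)
  have hb : b ∈ N.E := hE (by simp)
  have hc : c ∈ N.E := hE (by simp)
  rw [hf.cyc_iff hE] at h
  have h1 := h a (by simp)
  rw [show ({a, b, c} : Set α) \ {a} = {b, c} by ext; simp; grind, image_pair,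
    Submodule.mem_span_pair] at h1
  obtain ⟨y, z, h1⟩ := h1
  refine ⟨-1, y, z, by simp, ?_, ?_, by rw [← h1]; module⟩
  · rintro rfl
    exact hN.not_smul hf ha hc hac z (by rw [← h1]; module)
  · rintro rfl
    exact hN.not_smul hf ha hb hab y (by rw [← h1]; module)

theorem Tame.mem_closure_compl_pair (hN : N.Tame) (ha : a ∈ N.E) (hc : c ∈ N.E) :
    a ∈ N.closure (N.E \ {a, c}) := by
  by_contra h
  by_cases hc' : c ∈ N.closure (N.E \ {a, c})
  · refine (hN a a).2 (dual_cyc_iff.2 ⟨by simpa using ha, ?_⟩)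
    rintro e (rfl | rfl) <;>
    · intro h'
      refine h (N.closure_subset_closure_of_subset_closure ?_ h')
      rintro y ⟨hy, hya⟩
      by_cases hyc : y = c
      · rwa [hyc]
      · exact mem_closure_of_mem' _ ⟨hy, by simp_all⟩ hy
  · refine (hN a c).2 (dual_cyc_iff.2 ⟨insert_subset ha (singleton_subset_iff.2 hc), ?_⟩)
    rintro e (rfl | rfl) <;> assumption

/-- In a represented tame matroid, a cocyclic set with three elements is the support of a linear
functional. -/
theorem Tame.functional_of_dual_cyc_triple (hN : N.Tame) (hf : N.IsRepresentedBy K f)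
    (h : N✶.Cyc {a, b, c}) : ∃ g : V →ₗ[K] K, (∀ e ∈ N.E, e ∉ ({a, b, c} : Set α) → g (f e) = 0) ∧
      g (f a) ≠ 0 ∧ g (f b) ≠ 0 ∧ g (f c) ≠ 0 := by
  obtain ⟨hE, hT⟩ := dual_cyc_iff.1 h
  have ha : a ∈ N.E := hE (by simp)
  have hb : b ∈ N.E := hE (by simp)
  have hc : c ∈ N.E := hE (by simp)
  have h1 := hT a (by simp)
  rw [hf.mem_closure_iff sdiff_subset ha] at h1
  obtain ⟨g, hga, hg⟩ := Submodule.exists_le_ker_of_notMem h1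
  have hg0 : ∀ e ∈ N.E, e ∉ ({a, b, c} : Set α) → g (f e) = 0 := fun e he heT =>
    hg (Submodule.subset_span ⟨e, ⟨he, heT⟩, rfl⟩)
  have key : ∀ d d', ({a, b, c} : Set α) ⊆ {a, d, d'} → g (f d) ≠ 0 := by
    intro d d' hd h0
    by_cases hd' : d' ∈ N.E
    swap
    · have h2 := hN.mem_closure_compl_pair ha ha
      rw [hf.mem_closure_iff sdiff_subset ha] at h2
      refine hga ((Submodule.span_le.2 ?_ : _ ≤ LinearMap.ker g) h2)
      rintro _ ⟨y, ⟨hy, hy'⟩, rfl⟩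
      by_cases hyT : y ∈ ({a, b, c} : Set α)
      · rcases hd hyT with rfl | rfl | rfl
        · simp at hy'
        · exact h0
        · exact absurd hy hd'
      · exact hg0 y hy hyT
    have h2 := hN.mem_closure_compl_pair ha hd'
    rw [hf.mem_closure_iff sdiff_subset ha] at h2
    refine hga ((Submodule.span_le.2 ?_ : _ ≤ LinearMap.ker g) h2)
    rintro _ ⟨y, ⟨hy, hy'⟩, rfl⟩
    by_cases hyT : y ∈ ({a, b, c} : Set α)
    · rcases hd hyT with rfl | rfl | rfl
      · simp at hy'
      · exact h0
      · simp at hy'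
    · exact hg0 y hy hyT
  exact ⟨g, hg0, hga, key b c subset_rfl, key c b (by intro; simp; tauto)⟩

end Represented

/-! ### 3-connected matroids -/

section Connected

variable {α : Type*} {M N : Matroid α} {X T : Set α} {a b c e : α}

theorem IsConnectedOfOrder.le_of_encard [N.Finite] {n k : ℕ} (hN : N.IsConnectedOfOrder n)
    (hk : 1 ≤ k) (hkn : k < n) (hX : X ⊆ N.E) (h1 : (k : ℕ∞) ≤ X.encard)
    (h2 : (k : ℕ∞) ≤ (N.E \ X).encard) : N.eRank + k ≤ N.eRk X + N.eRk (N.E \ X) := by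
  by_contra h
  exact hN k hk hkn X (N.E \ X) ⟨union_sdiff_cancel hX, disjoint_sdiff_right, h1, h2, not_le.1 h⟩

theorem eRk_compl_add_one_le_of_dual_cyc (hT : N✶.Cyc T) (he : e ∈ T) :
    N.eRk (N.E \ T) + 1 ≤ N.eRank := by
  obtain ⟨hE, h⟩ := dual_cyc_iff.1 hT
  rw [← eRk_insert_eq_add_one ⟨hE he, h e he⟩]
  exact eRk_le_eRank _ _

theorem IsConnectedOfOrder.tame [N.Finite] (hN : N.IsConnectedOfOrder 3) (hE : 4 ≤ N.E.encard) :
    N.Tame := by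
  have hr : N.eRank ≠ ⊤ := by
    exact (eRank_ne_top_iff N).2 inferInstance
  have hcompl : ∀ {a b}, a ∈ N.E → b ∈ N.E → 2 ≤ (N.E \ {a, b}).encard := by
    intro a b ha hb
    have h1 := encard_sdiff_add_encard_of_subset (insert_subset ha (singleton_subset_iff.2 hb))
    rw [← h1] at hE
    have h2 : ({a, b} : Set α).encard ≤ 2 := by
      refine (encard_insert_le _ _).trans ?_
      rw [encard_singleton]; norm_num
    have h3 : (2 + 2 : ℕ∞) ≤ (N.E \ {a, b}).encard + 2 :=
      (show (2 + 2 : ℕ∞) = 4 by norm_num) ▸ hE.trans (by gcongr)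
    exact (ENat.add_le_add_iff_right (by simp)).1 h3
  intro a b
  constructor
  · intro h
    have ha : a ∈ N.E := h.subset_ground (by simp)
    have hb : b ∈ N.E := h.subset_ground (by simp)
    have h2 := hcompl ha hb
    by_cases hab : a = b
    · subst hab
      have h1 := hN.le_of_encard (k := 1) (X := {a, a}) le_rfl (by norm_num) h.subset_ground
        (by simp) (le_trans (by norm_num) h2)
      have h3 : N.eRk {a, a} = 0 := by
        rw [eRk_eq_zero_iff h.subset_ground]
        intro x hx
        have := h x hx
        rw [show x = a by simpa using hx] at this ⊢
        simpa [loops] using this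
      rw [h3, zero_add] at h1
      have h4 := h1.trans (eRk_le_eRank _ _)
      exact absurd h4 (not_le.2 (ENat.lt_add_one_iff hr |>.2 le_rfl))
    · have h1 := hN.le_of_encard (k := 2) (X := {a, b}) (by norm_num) (by norm_num)
        h.subset_ground (by simp [encard_pair hab]) h2
      have h3 : N.eRk {a, b} ≤ 1 := by
        have h4 := h a (by simp)
        rw [show ({a, b} : Set α) \ {a} = {b} by ext; simp; grind] at h4
        have h5 : N.closure {a, b} = N.closure {b} := closure_insert_eq_of_mem_closure h4
        rw [← eRk_closure_eq, h5, eRk_closure_eq]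
        exact (N.eRk_le_encard {b}).trans_eq (by simp)
      have h4 : N.eRank + 2 ≤ 1 + N.eRank :=
        h1.trans (add_le_add h3 (eRk_le_eRank _ _))
      rw [add_comm] at h4
      have := (ENat.add_le_add_iff_right hr).1 h4
      norm_num at this
  · intro h
    have hE' := (dual_cyc_iff.1 h).1
    have ha : a ∈ N.E := hE' (by simp)
    have hb : b ∈ N.E := hE' (by simp)
    have h2 := hcompl ha hb
    have h3 := eRk_compl_add_one_le_of_dual_cyc h (e := a) (by simp)
    have hr' : N.eRk (N.E \ {a, b}) ≠ ⊤ := fun h' => by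
      rw [h'] at h3; exact hr (by simpa using h3)
    have aux : ∀ k : ℕ, N.eRk {a, b} ≤ k → ¬ N.eRank + k ≤ N.eRk {a, b} + N.eRk (N.E \ {a, b}) := by
      intro k hk h4
      have h5 : N.eRk (N.E \ {a, b}) + 1 + k ≤ k + N.eRk (N.E \ {a, b}) :=
        ((add_le_add h3 le_rfl).trans h4).trans (add_le_add hk le_rfl)
      rw [add_comm _ (k : ℕ∞), ] at h5
      have h6 := (ENat.add_le_add_iff_left (by simp)).1 h5
      exact absurd h6 (not_le.2 (ENat.lt_add_one_iff hr' |>.2 le_rfl))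
    by_cases hab : a = b
    · subst hab
      refine aux 1 ((N.eRk_le_encard _).trans (by simp)) ?_
      exact hN.le_of_encard (k := 1) (X := {a, a}) le_rfl (by norm_num) hE'
        (by simp) (le_trans (by norm_num) h2)
    · refine aux 2 ((N.eRk_le_encard _).trans (by simp [encard_pair hab])) ?_
      exact hN.le_of_encard (k := 2) (X := {a, b}) (by norm_num) (by norm_num) hE'
        (by simp [encard_pair hab]) h2

end Connected

/-! ### Coordinates of a fan -/

section PosFan

variable {K V α : Type*} [Field K] [AddCommGroup V] [Module K V] {N : Matroid α} {f : α → V}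
  {lo hi r : ℕ} {el : ℕ → α}

/-- A weak fan whose elements `el p` are indexed by an interval `[lo, hi)` of positions in a wheel:
the spoke elements are in the even positions and the rim elements in the odd ones. -/
structure PosFan (N : Matroid α) (lo hi : ℕ) (el : ℕ → α) : Prop where
  inj : ∀ p q, lo ≤ p → p < hi → lo ≤ q → q < hi → el p = el q → p = q
  triple : ∀ p, lo ≤ p → p + 2 < hi → N.BCyc (decide (Even p)) {el p, el (p + 1), el (p + 2)}

/-- The elements of a positioned fan. -/
def posSet (lo hi : ℕ) (el : ℕ → α) : Set α := {x | ∃ p, lo ≤ p ∧ p < hi ∧ el p = x}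

theorem PosFan.triangle (h : N.PosFan lo hi el) {p : ℕ} (hp : Even p) (h1 : lo ≤ p)
    (h2 : p + 2 < hi) : N.Cyc {el p, el (p + 1), el (p + 2)} := (h.triple p h1 h2).1 (by simpa)

theorem PosFan.triad (h : N.PosFan lo hi el) {p : ℕ} (hp : Odd p) (h1 : lo ≤ p)
    (h2 : p + 2 < hi) : N✶.Cyc {el p, el (p + 1), el (p + 2)} :=
  (h.triple p h1 h2).2 (by simpa using hp)

theorem PosFan.mem_ground (h : N.PosFan lo hi el) (hlen : lo + 3 ≤ hi) {p : ℕ} (h1 : lo ≤ p)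
    (h2 : p < hi) : el p ∈ N.E := by
  by_cases hp : p + 2 < hi
  · exact (h.triple p h1 hp).subset_ground (by simp)
  · by_cases hp' : p + 1 < hi
    · have := (h.triple (p - 1) (by omega) (by omega)).subset_ground
      exact this (by simp [show p - 1 + 1 = p by omega])
    · have := (h.triple (p - 2) (by omega) (by omega)).subset_ground
      exact this (by simp [show p - 2 + 2 = p by omega])

/-- The vector of the element in position `p` of a wheel in which the hub has the vector `0` and
the `k`-th rim vertex has the vector `u k`. -/
def wv (u : ℕ → V) (p : ℕ) : V := if Even p then u (p / 2) else u (p / 2) - u (p / 2 + 1)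

@[simp] theorem wv_even (u : ℕ → V) (k : ℕ) : wv u (2 * k) = u k := by simp [wv]

@[simp] theorem wv_odd (u : ℕ → V) (k : ℕ) : wv u (2 * k + 1) = u k - u (k + 1) := by
  have : (2 * k + 1) / 2 = k := by omega
  simp [wv, this]

/-- Along a chain of triangles the spoke vectors can be rescaled so that the rim vectors become
multiples of the differences of consecutive spoke vectors. -/
theorem exists_rescaling (v : ℕ → V) (r : ℕ)
    (h : ∀ k, k + 1 < r → ∃ x y z : K, x ≠ 0 ∧ y ≠ 0 ∧ z ≠ 0 ∧
      x • v (2 * k) + y • v (2 * k + 1) + z • v (2 * k + 2) = 0) :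
    ∃ u : ℕ → V, (∀ k, k < r → ∃ c : K, c ≠ 0 ∧ u k = c • v (2 * k)) ∧
      ∀ k, k + 1 < r → ∃ c : K, c ≠ 0 ∧ v (2 * k + 1) = c • (u k - u (k + 1)) := by
  choose! x y z hx hy hz hrel using h
  let c : ℕ → K := fun k => Nat.rec 1 (fun k c => if k + 1 < r then -(c * z k * (x k)⁻¹) else 1) k
  have hc1 : ∀ k, k + 1 < r → c (k + 1) = -(c k * z k * (x k)⁻¹) := fun k hk => if_pos hk
  have hc : ∀ k, k < r → c k ≠ 0 := by
    intro k
    induction k with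
    | zero => intro _; exact one_ne_zero
    | succ k ih =>
      intro hk
      rw [hc1 k hk]
      exact neg_ne_zero.2 (mul_ne_zero (mul_ne_zero (ih (by omega)) (hz k hk))
        (inv_ne_zero (hx k hk)))
  refine ⟨fun k => c k • v (2 * k), fun k hk => ⟨c k, hc k hk, rfl⟩, fun k hk => ?_⟩
  have hck := hc k (by omega)
  have hxk := hx k hk
  have hyk := hy k hk
  refine ⟨-(x k * ((c k)⁻¹ * (y k)⁻¹)), neg_ne_zero.2 (mul_ne_zero hxk
    (mul_ne_zero (inv_ne_zero hck) (inv_ne_zero hyk))), ?_⟩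
  have hv : v (2 * k + 1) = -((y k)⁻¹ • (x k • v (2 * k) + z k • v (2 * k + 2))) := by
    have : y k • v (2 * k + 1) = -(x k • v (2 * k) + z k • v (2 * k + 2)) := by
      rw [eq_neg_iff_add_eq_zero, ← hrel k hk]; abel
    rw [← smul_neg, ← this, smul_smul, inv_mul_cancel₀ hyk, one_smul]
  change _ = _ • (c k • v (2 * k) - c (k + 1) • v (2 * (k + 1)))
  rw [hv, hc1 k hk, show 2 * (k + 1) = 2 * k + 2 by ring]
  simp only [smul_add, smul_smul, neg_smul, neg_add, sub_neg_eq_add]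
  rw [← neg_smul, ← neg_smul]
  congr 1
  · congr 1; field_simp
  · congr 1; field_simp

/-- Coordinates for a fan in positions `[lo, hi)` of a wheel of rank `r`: vectors `u k` for the rim
vertices of the wheel, such that the elements of the fan have the vectors of the corresponding
edges, up to scaling, and linear functionals `g l` dual to the interior rim vertices, which vanish
off the fan. -/
structure FanCoord (K : Type*) {V α : Type*} [Field K] [AddCommGroup V] [Module K V]
    (N : Matroid α) (f : α → V) (lo hi r : ℕ) (el : ℕ → α) (u : ℕ → V)
    (g : ℕ → V →ₗ[K] K) : Prop where
  vec : ∀ p, lo ≤ p → p < hi → ∃ c : K, c ≠ 0 ∧ f (el p) = c • wv u p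
  dual_self : ∀ l, 1 ≤ l → l + 2 ≤ r → g l (u l) = 1
  dual_ne : ∀ l, 1 ≤ l → l + 2 ≤ r → ∀ m, m < r → m ≠ l → g l (u m) = 0
  dual_off : ∀ l, 1 ≤ l → l + 2 ≤ r → ∀ e ∈ N.E, e ∉ posSet lo hi el → g l (f e) = 0
  first_mem : u 0 ∈ Submodule.span K (f '' {x | ∃ p, lo ≤ p ∧ p < lo + 2 ∧ el p = x})
  last_mem : u (r - 1) ∈ Submodule.span K (f '' {x | ∃ p, hi ≤ p + 2 ∧ p < hi ∧ el p = x})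

theorem exists_fanCoord (hN : N.Tame) (hf : N.IsRepresentedBy K f) (h : N.PosFan lo hi el)
    (hlo : lo ≤ 1) (hlen : lo + 3 ≤ hi) (hr : hi = 2 * r - 1 ∨ hi = 2 * r - 2) (hr2 : 2 ≤ r) :
    ∃ u g, FanCoord K N f lo hi r el u g := by
  have hE : ∀ p, lo ≤ p → p < hi → el p ∈ N.E := fun p h1 h2 => h.mem_ground hlen h1 h2
  have hg : ∀ l, 1 ≤ l → l + 2 ≤ r → ∃ g : V →ₗ[K] K,
      (∀ e ∈ N.E, e ≠ el (2 * l - 1) → e ≠ el (2 * l) → e ≠ el (2 * l + 1) → g (f e) = 0) ∧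
      g (f (el (2 * l - 1))) ≠ 0 ∧ g (f (el (2 * l))) ≠ 0 ∧ g (f (el (2 * l + 1))) ≠ 0 := by
    intro l hl1 hl2
    have h1 : 2 * l - 1 + 1 = 2 * l := by omega
    have h2 : 2 * l - 1 + 2 = 2 * l + 1 := by omega
    have ht := h.triad (p := 2 * l - 1) ⟨l - 1, by omega⟩ (by omega) (by omega)
    rw [h1, h2] at ht
    obtain ⟨g, hg0, hg1⟩ := hN.functional_of_dual_cyc_triple hf ht
    exact ⟨g, fun e he e1 e2 e3 => hg0 e he (by simp [e1, e2, e3]), hg1⟩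
  choose! g hg0 hg1 hg2 hg3 using hg
  have hoff : ∀ l, 1 ≤ l → l + 2 ≤ r → ∀ p, lo ≤ p → p < hi → p ≠ 2 * l - 1 → p ≠ 2 * l →
      p ≠ 2 * l + 1 → g l (f (el p)) = 0 := by
    intro l hl1 hl2 p hp1 hp2 n1 n2 n3
    refine hg0 l hl1 hl2 _ (hE p hp1 hp2) ?_ ?_ ?_ <;> intro he
    · exact n1 (h.inj _ _ hp1 hp2 (by omega) (by omega) he)
    · exact n2 (h.inj _ _ hp1 hp2 (by omega) (by omega) he)
    · exact n3 (h.inj _ _ hp1 hp2 (by omega) (by omega) he)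
  -- the vectors in all positions from `0` to `2 * r - 2`; a missing end of the fan gets a vector in
  -- the kernel of the nearest functional
  let v : ℕ → V := fun p =>
    if lo ≤ p ∧ p < hi then f (el p)
    else if p = 0 then g 1 (f (el 2)) • f (el 1) - g 1 (f (el 1)) • f (el 2)
    else g (r - 2) (f (el (2 * r - 4))) • f (el (2 * r - 3)) -
      g (r - 2) (f (el (2 * r - 3))) • f (el (2 * r - 4))
  have hv : ∀ p, lo ≤ p → p < hi → v p = f (el p) := fun p h1 h2 => if_pos ⟨h1, h2⟩
  have hv0 : lo = 1 → v 0 = g 1 (f (el 2)) • f (el 1) - g 1 (f (el 1)) • f (el 2) := by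
    intro hl; simp [v, hl]
  have hvl : hi = 2 * r - 2 → v (2 * r - 2) =
      g (r - 2) (f (el (2 * r - 4))) • f (el (2 * r - 3)) -
      g (r - 2) (f (el (2 * r - 3))) • f (el (2 * r - 4)) := by
    intro hh
    simp only [v]
    rw [if_neg (by omega), if_neg (by omega)]
  have hrel : ∀ k, k + 1 < r → ∃ x y z : K, x ≠ 0 ∧ y ≠ 0 ∧ z ≠ 0 ∧
      x • v (2 * k) + y • v (2 * k + 1) + z • v (2 * k + 2) = 0 := by
    intro k hk
    by_cases h1 : lo ≤ 2 * k
    · by_cases h2 : 2 * k + 2 < hi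
      · rw [hv _ h1 (by omega), hv _ (by omega) (by omega), hv _ (by omega) h2]
        refine hN.relation_of_cyc_triple hf ?_ ?_ (h.triangle (by simp) h1 h2) <;> intro he
        · have := h.inj _ _ h1 (by omega) (by omega) (by omega) he; omega
        · have := h.inj _ _ h1 (by omega) (by omega) (by omega) he; omega
      · have hh : hi = 2 * r - 2 := by omega
        have hkr : k = r - 2 := by omega
        have e1 : 2 * k = 2 * r - 4 := by omega
        have e2 : 2 * k + 1 = 2 * r - 3 := by omega
        have e3 : 2 * k + 2 = 2 * r - 2 := by omega
        have a2 := hg2 (r - 2) (by omega) (by omega)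
        have a1 := hg3 (r - 2) (by omega) (by omega)
        rw [show 2 * (r - 2) = 2 * r - 4 by omega] at a2
        rw [show 2 * (r - 2) + 1 = 2 * r - 3 by omega] at a1
        refine ⟨g (r - 2) (f (el (2 * r - 3))), -g (r - 2) (f (el (2 * r - 4))), 1, a1,
          neg_ne_zero.2 a2, one_ne_zero, ?_⟩
        rw [e3, e2, e1, hvl hh, hv _ (by omega) (by omega), hv _ (by omega) (by omega)]
        module
    · have hl : lo = 1 := by omega
      have hk0 : k = 0 := by omega
      subst hk0
      simp only [mul_zero, zero_add]
      refine ⟨1, -g 1 (f (el 2)), g 1 (f (el 1)), one_ne_zero,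
        neg_ne_zero.2 (hg2 1 le_rfl (by omega)), hg1 1 le_rfl (by omega), ?_⟩
      rw [hv0 hl, hv _ (by omega) (by omega), hv _ (by omega) (by omega)]
      module
  obtain ⟨u, hu1, hu2⟩ := exists_rescaling v r hrel
  have hgv : ∀ l, 1 ≤ l → l + 2 ≤ r → ∀ m, m < r → m ≠ l → g l (v (2 * m)) = 0 := by
    intro l hl1 hl2 m hm hml
    by_cases h1 : lo ≤ 2 * m
    · by_cases h2 : 2 * m < hi
      · rw [hv _ h1 h2]
        exact hoff l hl1 hl2 _ h1 h2 (by omega) (by omega) (by omega)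
      · have hh : hi = 2 * r - 2 := by omega
        rw [show 2 * m = 2 * r - 2 by omega, hvl hh, map_sub, map_smul, map_smul]
        by_cases hlr : l = r - 2
        · subst hlr
          simp only [smul_eq_mul]; ring
        · rw [hoff l hl1 hl2 _ (by omega) (by omega) (by omega) (by omega) (by omega),
            hoff l hl1 hl2 _ (by omega) (by omega) (by omega) (by omega) (by omega)]
          simp
    · have hl : lo = 1 := by omega
      have hm0 : m = 0 := by omega
      subst hm0
      rw [mul_zero, hv0 hl, map_sub, map_smul, map_smul]
      by_cases hl1' : l = 1
      · subst hl1'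
        simp only [smul_eq_mul]; ring
      · rw [hoff l hl1 hl2 _ (by omega) (by omega) (by omega) (by omega) (by omega),
          hoff l hl1 hl2 _ (by omega) (by omega) (by omega) (by omega) (by omega)]
        simp
  have hgu : ∀ l, 1 ≤ l → l + 2 ≤ r → g l (u l) ≠ 0 := by
    intro l hl1 hl2
    obtain ⟨c, hc, hcu⟩ := hu1 l (by omega)
    rw [hcu, hv _ (by omega) (by omega), map_smul]
    exact mul_ne_zero hc (hg2 l hl1 hl2)
  refine ⟨u, fun l => (g l (u l))⁻¹ • g l, ?_, ?_, ?_, ?_, ?_, ?_⟩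
  · intro p hp1 hp2
    rw [← hv p hp1 hp2]
    rcases Nat.even_or_odd' p with ⟨k, rfl | rfl⟩
    · obtain ⟨c, hc, hcu⟩ := hu1 k (by omega)
      exact ⟨c⁻¹, inv_ne_zero hc, by rw [wv_even, hcu, smul_smul, inv_mul_cancel₀ hc, one_smul]⟩
    · rw [wv_odd]; exact hu2 k (by omega)
  · intro l hl1 hl2
    simpa using inv_mul_cancel₀ (hgu l hl1 hl2)
  · intro l hl1 hl2 m hm hml
    obtain ⟨c, -, hcu⟩ := hu1 m hm
    simp [hcu, hgv l hl1 hl2 m hm hml]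
  · intro l hl1 hl2 e he hel
    have : ∀ p, lo ≤ p → p < hi → e ≠ el p := fun p h1 h2 h3 => hel ⟨p, h1, h2, h3.symm⟩
    simp [hg0 l hl1 hl2 e he (this _ (by omega) (by omega)) (this _ (by omega) (by omega))
      (this _ (by omega) (by omega))]
  · obtain ⟨c, -, hcu⟩ := hu1 0 (by omega)
    rw [hcu]
    refine Submodule.smul_mem _ _ ?_
    rw [mul_zero]
    by_cases hl : lo = 0
    · rw [hv 0 (by omega) (by omega)]
      exact Submodule.subset_span ⟨_, ⟨0, by omega, by omega, rfl⟩, rfl⟩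
    · rw [hv0 (by omega)]
      exact Submodule.sub_mem _
        (Submodule.smul_mem _ _ (Submodule.subset_span ⟨_, ⟨1, by omega, by omega, rfl⟩, rfl⟩))
        (Submodule.smul_mem _ _ (Submodule.subset_span ⟨_, ⟨2, by omega, by omega, rfl⟩, rfl⟩))
  · obtain ⟨c, -, hcu⟩ := hu1 (r - 1) (by omega)
    rw [hcu]
    refine Submodule.smul_mem _ _ ?_
    rw [show 2 * (r - 1) = 2 * r - 2 by omega]
    by_cases hh : hi = 2 * r - 1
    · rw [hv _ (by omega) (by omega)]
      exact Submodule.subset_span ⟨_, ⟨2 * r - 2, by omega, by omega, rfl⟩, rfl⟩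
    · rw [hvl (by omega)]
      exact Submodule.sub_mem _
        (Submodule.smul_mem _ _
          (Submodule.subset_span ⟨_, ⟨2 * r - 3, by omega, by omega, rfl⟩, rfl⟩))
        (Submodule.smul_mem _ _
          (Submodule.subset_span ⟨_, ⟨2 * r - 4, by omega, by omega, rfl⟩, rfl⟩))

end PosFan

section FanCoord

variable {K V α : Type*} [Field K] [AddCommGroup V] [Module K V] {N : Matroid α} {f : α → V}
  {lo hi r : ℕ} {el : ℕ → α} {u : ℕ → V} {g : ℕ → V →ₗ[K] K}

theorem exists_functional_of_linearIndepOn {ι : Type*} {v : ι → V} {s : Set ι}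
    (hv : LinearIndepOn K v s) (a : ι → K) : ∃ σ : V →ₗ[K] K, ∀ i ∈ s, σ (v i) = a i := by
  let b := Module.Basis.span hv
  obtain ⟨σ, hσ⟩ := LinearMap.exists_extend (b.constr K (fun i : s => a i))
  refine ⟨σ, fun i hi => ?_⟩
  have h1 : ((b ⟨i, hi⟩ : Submodule.span K (range fun x : s => v x)) : V) = v i :=
    congr_arg Subtype.val (Module.Basis.span_apply hv ⟨i, hi⟩)
  have h2 := LinearMap.congr_fun hσ (b ⟨i, hi⟩)
  rw [Module.Basis.constr_basis, LinearMap.comp_apply, Submodule.subtype_apply, h1] at h2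
  exact h2

theorem sum_range_eq_ends {r : ℕ} (hr : 2 ≤ r) {a : ℕ → K} {u : ℕ → V}
    (h : ∀ l, 1 ≤ l → l + 2 ≤ r → a l = 0) :
    ∑ k ∈ Finset.range r, a k • u k = a 0 • u 0 + a (r - 1) • u (r - 1) := by
  rw [← Finset.sum_subset (s₁ := {0, r - 1}), Finset.sum_pair (by omega)]
  · intro x hx
    simp only [Finset.mem_insert, Finset.mem_singleton, Finset.mem_range] at *
    omega
  · intro x hx hx'
    simp only [Finset.mem_insert, Finset.mem_singleton, Finset.mem_range] at *
    rw [h x (by omega) (by omega), zero_smul]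

/-- The vectors of the rim vertices are independent as soon as the two ends are. -/
theorem FanCoord.linearIndepOn (h : FanCoord K N f lo hi r el u g) (hr : 2 ≤ r)
    (hu : ∀ a b : K, a • u 0 + b • u (r - 1) = 0 → a = 0 ∧ b = 0) :
    LinearIndepOn K u (Iio r) := by
  rw [← Finset.coe_range, linearIndepOn_finset_iff]
  intro a ha
  have h1 : ∀ l, 1 ≤ l → l + 2 ≤ r → a l = 0 := by
    intro l hl1 hl2
    have h2 := congr_arg (g l) ha
    rw [map_sum, map_zero, Finset.sum_eq_single l] at h2
    · simpa [h.dual_self l hl1 hl2] using h2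
    · intro m hm hml
      rw [map_smul, h.dual_ne l hl1 hl2 m (Finset.mem_range.1 hm) hml, smul_zero]
    · intro hl; exact absurd (Finset.mem_range.2 (by omega)) hl
  rw [sum_range_eq_ends hr h1] at ha
  obtain ⟨h2, h3⟩ := hu _ _ ha
  intro i hi
  rw [Finset.mem_range] at hi
  by_cases hi0 : i = 0
  · rwa [hi0]
  by_cases hir : i = r - 1
  · rwa [hir]
  exact h1 i (by omega) (by omega)

theorem FanCoord.mem_span (h : FanCoord K N f lo hi r el u g) (hlo : lo ≤ 1) (hlen : lo + 3 ≤ hi)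
    (hr : hi = 2 * r - 1 ∨ hi = 2 * r - 2) {k : ℕ} (hk : k < r) :
    u k ∈ Submodule.span K (f '' posSet lo hi el) := by
  by_cases h1 : lo ≤ 2 * k ∧ 2 * k < hi
  · obtain ⟨c, hc, hcu⟩ := h.vec _ h1.1 h1.2
    rw [wv_even] at hcu
    have : u k = c⁻¹ • f (el (2 * k)) := by rw [hcu, smul_smul, inv_mul_cancel₀ hc, one_smul]
    rw [this]
    exact Submodule.smul_mem _ _ (Submodule.subset_span ⟨_, ⟨_, h1.1, h1.2, rfl⟩, rfl⟩)
  · by_cases hk0 : k = 0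
    · subst hk0
      refine Submodule.span_mono (image_mono ?_) h.first_mem
      rintro _ ⟨p, h1, h2, rfl⟩
      exact ⟨p, h1, by omega, rfl⟩
    · have : k = r - 1 := by omega
      rw [this]
      refine Submodule.span_mono (image_mono ?_) h.last_mem
      rintro _ ⟨p, h1, h2, rfl⟩
      exact ⟨p, by omega, h2, rfl⟩

theorem FanCoord.span_le (h : FanCoord K N f lo hi r el u g)
    (hr : hi = 2 * r - 1 ∨ hi = 2 * r - 2) :
    Submodule.span K (f '' posSet lo hi el) ≤ Submodule.span K (u '' Iio r) := by
  refine Submodule.span_le.2 ?_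
  rintro _ ⟨_, ⟨p, h1, h2, rfl⟩, rfl⟩
  obtain ⟨c, -, hcu⟩ := h.vec p h1 h2
  have hu : ∀ k, k < r → u k ∈ Submodule.span K (u '' Iio r) := fun k hk =>
    Submodule.subset_span ⟨k, hk, rfl⟩
  rw [hcu]
  refine Submodule.smul_mem _ _ ?_
  rcases Nat.even_or_odd' p with ⟨k, rfl | rfl⟩
  · rw [wv_even]; exact hu k (by omega)
  · rw [wv_odd]; exact Submodule.sub_mem _ (hu k (by omega)) (hu _ (by omega))

theorem exists_coeff_of_mem_span_image_Iio {x : V} (hx : x ∈ Submodule.span K (u '' Iio r)) :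
    ∃ a : ℕ → K, x = ∑ k ∈ Finset.range r, a k • u k := by
  rw [← Finset.coe_range, Submodule.mem_span_image_finset_iff_exists_fun] at hx
  obtain ⟨a, ha⟩ := hx
  refine ⟨fun k => if h : k ∈ Finset.range r then a ⟨k, h⟩ else 0, ?_⟩
  rw [← ha, ← Finset.sum_coe_sort (Finset.range r)]
  exact Finset.sum_congr rfl fun k _ => by simp only [dif_pos k.2]

theorem FanCoord.dual_eq_zero (h : FanCoord K N f lo hi r el u g) {l : ℕ} (hl1 : 1 ≤ l)
    (hl2 : l + 2 ≤ r) {x : V} (hx : x ∈ Submodule.span K (f '' (N.E \ posSet lo hi el))) :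
    g l x = 0 := by
  have : Submodule.span K (f '' (N.E \ posSet lo hi el)) ≤ LinearMap.ker (g l) := by
    refine Submodule.span_le.2 ?_
    rintro _ ⟨y, hy, rfl⟩
    exact h.dual_off l hl1 hl2 y hy.1 hy.2
  exact this hx

/-- A vector spanned by the fan that is killed by all the functionals is spanned by the ends. -/
theorem FanCoord.eq_ends (h : FanCoord K N f lo hi r el u g) (hr2 : 2 ≤ r) {x : V}
    (hx : x ∈ Submodule.span K (u '' Iio r)) (hx0 : ∀ l, 1 ≤ l → l + 2 ≤ r → g l x = 0) :
    ∃ a b : K, x = a • u 0 + b • u (r - 1) := by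
  obtain ⟨a, rfl⟩ := exists_coeff_of_mem_span_image_Iio hx
  refine ⟨a 0, a (r - 1), sum_range_eq_ends hr2 fun l hl1 hl2 => ?_⟩
  have h2 := hx0 l hl1 hl2
  rw [map_sum, Finset.sum_eq_single l] at h2
  · simpa [h.dual_self l hl1 hl2] using h2
  · intro m hm hml
    rw [map_smul, h.dual_ne l hl1 hl2 m (Finset.mem_range.1 hm) hml, smul_zero]
  · intro hl; exact absurd (Finset.mem_range.2 (by omega)) hl

/-- In a 3-connected matroid the span of a fan meets the span of the other elements, of which there
are at least two, in the line spanned by the two ends. This is where 3-connectivity enters: the two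
spans meet in dimension at least two, and at most two by the functionals. -/
theorem FanCoord.ends [N.Finite] (h : FanCoord K N f lo hi r el u g)
    (hN : N.IsConnectedOfOrder 3) (hf : N.IsRepresentedBy K f) (hlo : lo ≤ 1) (hlen : lo + 3 ≤ hi)
    (hr : hi = 2 * r - 1 ∨ hi = 2 * r - 2) (hpos : N.PosFan lo hi el)
    (hout : 2 ≤ (N.E \ posSet lo hi el).encard) :
    u 0 ∈ Submodule.span K (f '' (N.E \ posSet lo hi el)) ∧
    u (r - 1) ∈ Submodule.span K (f '' (N.E \ posSet lo hi el)) ∧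
    ∀ a b : K, a • u 0 + b • u (r - 1) = 0 → a = 0 ∧ b = 0 := by
  set A := posSet lo hi el with hA
  set S := Submodule.span K (f '' A) with hS
  set Z := Submodule.span K (f '' (N.E \ A)) with hZ
  have hr2 : 2 ≤ r := by omega
  have hAE : A ⊆ N.E := by
    rintro _ ⟨p, h1, h2, rfl⟩; exact hpos.mem_ground hlen h1 h2
  have hAfin : A.Finite := N.ground_finite.subset hAE
  have hZfin : (N.E \ A).Finite := N.ground_finite.subset sdiff_subset
  have hSf : FiniteDimensional K S := FiniteDimensional.span_of_finite K (hAfin.image f)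
  have hZf : FiniteDimensional K Z := FiniteDimensional.span_of_finite K (hZfin.image f)
  have hcard : 2 ≤ A.encard := by
    have : ({el lo, el (lo + 1)} : Set α) ⊆ A := by
      rintro _ (rfl | rfl)
      · exact ⟨lo, le_rfl, by omega, rfl⟩
      · exact ⟨lo + 1, by omega, by omega, rfl⟩
    refine le_trans ?_ (encard_le_encard this)
    rw [encard_pair]
    intro he
    have := hpos.inj _ _ le_rfl (by omega) (by omega) (by omega) he
    omega
  have hconn := hN.le_of_encard (k := 2) (by norm_num) (by norm_num) hAE (by exact_mod_cast hcard)
    (by exact_mod_cast hout)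
  rw [← eRk_ground, hf.eRk_eq_finrank subset_rfl N.ground_finite,
    hf.eRk_eq_finrank hAE hAfin, hf.eRk_eq_finrank sdiff_subset hZfin] at hconn
  have hsup : Submodule.span K (f '' N.E) = S ⊔ Z := by
    rw [hS, hZ, ← Submodule.span_union, ← image_union, union_sdiff_cancel hAE]
  have hconn' : Module.finrank K (S ⊔ Z : Submodule K V) + 2 ≤
      Module.finrank K S + Module.finrank K Z := by
    rw [hsup] at hconn; exact_mod_cast hconn
  rw [← Submodule.finrank_sup_add_finrank_inf_eq S Z] at hconn'
  have hdim : 2 ≤ Module.finrank K (S ⊓ Z : Submodule K V) := by omega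
  have hle : S ⊓ Z ≤ Submodule.span K {u 0, u (r - 1)} := by
    rintro x ⟨hxS, hxZ⟩
    obtain ⟨a, b, rfl⟩ := h.eq_ends hr2 (h.span_le hr hxS)
      (fun l hl1 hl2 => h.dual_eq_zero hl1 hl2 hxZ)
    exact Submodule.mem_span_pair.2 ⟨a, b, rfl⟩
  have hfin2 : FiniteDimensional K (Submodule.span K {u 0, u (r - 1)}) :=
    FiniteDimensional.span_of_finite K (by simp)
  have hrange : range ![u 0, u (r - 1)] = {u 0, u (r - 1)} := by simp [pair_comm]
  have hle2 : Module.finrank K (Submodule.span K {u 0, u (r - 1)}) ≤ 2 := by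
    rw [← hrange]; exact (finrank_range_le_card _).trans (by simp)
  have heq : S ⊓ Z = Submodule.span K {u 0, u (r - 1)} :=
    Submodule.eq_of_le_of_finrank_le hle (hle2.trans hdim)
  have hm : ∀ x ∈ ({u 0, u (r - 1)} : Set V), x ∈ S ⊓ Z := fun x hx =>
    heq ▸ Submodule.subset_span hx
  refine ⟨(hm _ (by simp)).2, (hm _ (by simp)).2, ?_⟩
  have hli : LinearIndependent K ![u 0, u (r - 1)] := by
    rw [linearIndependent_iff_card_le_finrank_span]
    have : Set.finrank K (range ![u 0, u (r - 1)]) =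
        Module.finrank K (Submodule.span K {u 0, u (r - 1)}) := by rw [hrange]; rfl
    rw [this, ← heq]; simpa using hdim
  exact fun a b hab => LinearIndependent.pair_iff.1 hli a b hab

theorem PosFan.reverse (h : N.PosFan lo hi el) :
    N.PosFan (2 * r - 1 - hi) (2 * r - 1 - lo) (fun p => el (2 * r - 2 - p)) := by
  refine ⟨fun p q hp1 hp2 hq1 hq2 he => ?_, fun p hp1 hp2 => ?_⟩
  · have := h.inj _ _ (by omega) (by omega) (by omega) (by omega) he
    omega
  · have := h.triple (2 * r - 2 - (p + 2)) (by omega) (by omega)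
    rw [show 2 * r - 2 - (p + 2) + 1 = 2 * r - 2 - (p + 1) by omega,
      show 2 * r - 2 - (p + 2) + 2 = 2 * r - 2 - p by omega] at this
    rw [show ({el (2 * r - 2 - p), el (2 * r - 2 - (p + 1)), el (2 * r - 2 - (p + 2))} : Set α) =
      {el (2 * r - 2 - (p + 2)), el (2 * r - 2 - (p + 1)), el (2 * r - 2 - p)} by
        ext; simp; tauto]
    convert this using 2
    have : (2 * r - 2 - (p + 2)) + p + 2 = 2 * (r - 1) := by omega
    have h2 : Even ((2 * r - 2 - (p + 2)) + p) := ⟨r - 2, by omega⟩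
    rw [Nat.even_add] at h2
    exact h2.symm

theorem posSet_reverse (hr : hi ≤ 2 * r - 1) :
    posSet (2 * r - 1 - hi) (2 * r - 1 - lo) (fun p => el (2 * r - 2 - p)) = posSet lo hi el := by
  ext x; constructor
  · rintro ⟨p, h1, h2, rfl⟩; exact ⟨2 * r - 2 - p, by omega, by omega, rfl⟩
  · rintro ⟨p, h1, h2, rfl⟩
    refine ⟨2 * r - 2 - p, by omega, by omega, ?_⟩
    change el _ = _
    congr 1; omega

theorem FanCoord.reverse (h : FanCoord K N f lo hi r el u g) (hr : hi ≤ 2 * r - 1)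
    (hlen : lo + 3 ≤ hi) :
    FanCoord K N f (2 * r - 1 - hi) (2 * r - 1 - lo) r (fun p => el (2 * r - 2 - p))
      (fun k => u (r - 1 - k)) (fun k => g (r - 1 - k)) := by
  refine ⟨fun p hp1 hp2 => ?_, fun l hl1 hl2 => ?_, fun l hl1 hl2 m hm hml => ?_,
    fun l hl1 hl2 e he hel => ?_, ?_, ?_⟩
  · obtain ⟨c, hc, hcu⟩ := h.vec (2 * r - 2 - p) (by omega) (by omega)
    rcases Nat.even_or_odd' p with ⟨k, rfl | rfl⟩
    · refine ⟨c, hc, ?_⟩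
      rw [wv_even, hcu, show 2 * r - 2 - 2 * k = 2 * (r - 1 - k) by omega, wv_even]
    · refine ⟨-c, neg_ne_zero.2 hc, ?_⟩
      rw [wv_odd, hcu, show 2 * r - 2 - (2 * k + 1) = 2 * (r - 1 - (k + 1)) + 1 by omega, wv_odd,
        show r - 1 - (k + 1) + 1 = r - 1 - k by omega]
      module
  · exact h.dual_self _ (by omega) (by omega)
  · exact h.dual_ne _ (by omega) (by omega) _ (by omega) (by omega)
  · refine h.dual_off _ (by omega) (by omega) e he ?_
    rwa [posSet_reverse hr] at hel
  · have := h.last_mem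
    simp only [Nat.sub_zero]
    refine Submodule.span_mono (image_mono ?_) this
    rintro _ ⟨p, h1, h2, rfl⟩
    refine ⟨2 * r - 2 - p, by omega, by omega, ?_⟩
    congr 1; omega
  · have := h.first_mem
    rw [show r - 1 - (r - 1) = 0 by omega]
    refine Submodule.span_mono (image_mono ?_) this
    rintro _ ⟨p, h1, h2, rfl⟩
    refine ⟨2 * r - 2 - p, by omega, by omega, ?_⟩
    congr 1; omega

end FanCoord

/-! ### Fans as lists and fans as intervals of positions -/

section PosList

variable {α : Type*} {N : Matroid α} {lo hi r : ℕ} {el : ℕ → α} {L : List α}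

/-- The elements in the positions `lo, …, hi - 1`, as a list. -/
def posList (lo hi : ℕ) (el : ℕ → α) : List α := (List.range' lo (hi - lo)).map el

@[simp] theorem length_posList : (posList lo hi el).length = hi - lo := by simp [posList]

theorem getElem?_posList {i : ℕ} (hi' : lo + i < hi) : (posList lo hi el)[i]? = some (el (lo + i)) := by
  simp [posList, List.getElem?_range' (show i < hi - lo by omega)]

theorem getElem?_posList_eq_some {i : ℕ} {x : α} :
    (posList lo hi el)[i]? = some x ↔ lo + i < hi ∧ el (lo + i) = x := by
  by_cases h : lo + i < hi
  · simp [getElem?_posList h, h]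
  · have : (posList lo hi el)[i]? = none := by
      rw [List.getElem?_eq_none_iff, length_posList]; omega
    simp [this, h]

theorem mem_posList {x : α} : x ∈ posList lo hi el ↔ ∃ p, lo ≤ p ∧ p < hi ∧ el p = x := by
  rw [List.mem_iff_getElem?]
  simp only [getElem?_posList_eq_some]
  constructor
  · rintro ⟨i, h1, h2⟩; exact ⟨lo + i, by omega, h1, h2⟩
  · rintro ⟨p, h1, h2, h3⟩
    exact ⟨p - lo, by omega, by rwa [show lo + (p - lo) = p by omega]⟩

theorem listSet_posList : listSet (posList lo hi el) = posSet lo hi el := by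
  ext x; exact mem_posList

theorem triple_posList {i : ℕ} (h : lo + i + 2 < hi) :
    triple (posList lo hi el) i = {el (lo + i), el (lo + i + 1), el (lo + i + 2)} := by
  ext x
  rw [triple, listSet, mem_ofPred_eq, List.mem_iff_getElem?]
  constructor
  · rintro ⟨j, hj⟩
    rw [List.getElem?_take] at hj
    split_ifs at hj with hj3
    rw [List.getElem?_drop, getElem?_posList_eq_some] at hj
    have hj' : j = 0 ∨ j = 1 ∨ j = 2 := by omega
    obtain ⟨-, rfl⟩ := hj
    rcases hj' with rfl | rfl | rfl <;> simp [add_assoc]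
  · have key : ∀ j, j < 3 → ∃ i' : ℕ, (List.take 3 (List.drop i (posList lo hi el)))[i']? =
        some (el (lo + i + j)) := by
      intro j hj
      refine ⟨j, ?_⟩
      rw [List.getElem?_take, if_pos hj, List.getElem?_drop, getElem?_posList (by omega), add_assoc]
    rintro (rfl | rfl | rfl)
    · exact key 0 (by norm_num)
    · exact key 1 (by norm_num)
    · exact key 2 (by norm_num)

theorem listSet_take_two_posList (h : lo + 2 ≤ hi) :
    listSet ((posList lo hi el).take 2) = {x | ∃ p, lo ≤ p ∧ p < lo + 2 ∧ el p = x} := by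
  ext x
  rw [listSet, mem_ofPred_eq, List.mem_iff_getElem?, mem_ofPred_eq]
  simp only [List.getElem?_take]
  constructor
  · rintro ⟨j, hj⟩
    split_ifs at hj with hj3
    rw [getElem?_posList_eq_some] at hj
    exact ⟨lo + j, by omega, by omega, hj.2⟩
  · rintro ⟨p, h1, h2, rfl⟩
    refine ⟨p - lo, ?_⟩
    rw [if_pos (by omega), getElem?_posList (by omega), show lo + (p - lo) = p by omega]

theorem head?_posList (h : lo < hi) : (posList lo hi el).head? = some (el lo) := by
  rw [List.head?_eq_getElem?, getElem?_posList (by omega), add_zero]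

theorem posList_reverse (hr : hi ≤ 2 * r - 1) :
    (posList lo hi el).reverse =
      posList (2 * r - 1 - hi) (2 * r - 1 - lo) (fun p => el (2 * r - 2 - p)) := by
  refine List.ext_getElem? fun i => ?_
  by_cases hi' : i < hi - lo
  · rw [List.getElem?_reverse (by simpa using hi'), length_posList,
      getElem?_posList (by omega), getElem?_posList (by omega)]
    congr 2; omega
  · rw [List.getElem?_eq_none, List.getElem?_eq_none]
    · simp; omega
    · simp; omega

theorem exists_eq_posList (s : ℕ) (hL : L ≠ []) :
    ∃ el : ℕ → α, L = posList s (s + L.length) el := by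
  refine ⟨fun p => L.getD (p - s) (L.head hL), List.ext_getElem? fun i => ?_⟩
  by_cases hi' : i < L.length
  · rw [getElem?_posList (by omega)]
    simp [hi']
  · rw [List.getElem?_eq_none (by omega), List.getElem?_eq_none (by simp; omega)]

theorem nodup_posList (h : ∀ p q, lo ≤ p → p < hi → lo ≤ q → q < hi → el p = el q → p = q) :
    (posList lo hi el).Nodup := by
  refine List.Nodup.map_on ?_ List.nodup_range'
  intro x hx y hy hxy
  rw [List.mem_range'_1] at hx hy
  exact h x y hx.1 (by omega) hy.1 (by omega) hxy

theorem inj_of_nodup_posList (h : (posList lo hi el).Nodup) :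
    ∀ p q, lo ≤ p → p < hi → lo ≤ q → q < hi → el p = el q → p = q := by
  intro p q hp1 hp2 hq1 hq2 he
  exact List.inj_on_of_nodup_map h (List.mem_range'_1.2 ⟨hp1, by omega⟩)
    (List.mem_range'_1.2 ⟨hq1, by omega⟩) he

/-- The position of an end of a fan says whether this end is a spoke element. -/
theorem IsFan.exists_posFan (h : N.IsFan L) :
    ∃ lo hi el, lo ≤ 1 ∧ lo + 3 ≤ hi ∧ L = posList lo hi el ∧ N.PosFan lo hi el := by
  obtain ⟨h3, hnd, h | h⟩ := h
  · obtain ⟨el, hel⟩ := exists_eq_posList (L := L) 0 (by rintro rfl; simp at h3)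
    refine ⟨0, 0 + L.length, el, by omega, by omega, hel, ?_, fun p hp1 hp2 => ?_⟩
    · exact inj_of_nodup_posList (by rwa [← hel])
    · have hp := h p (by omega)
      rw [hel, triple_posList (by omega), zero_add] at hp
      exact ⟨fun hb => (hp.1 (by simpa using hb)).1.cyc,
        fun hb => (hp.2 (by simpa using hb)).1.isCircuit.cyc⟩
  · obtain ⟨el, hel⟩ := exists_eq_posList (L := L) 1 (by rintro rfl; simp at h3)
    refine ⟨1, 1 + L.length, el, by omega, by omega, hel, ?_, fun p hp1 hp2 => ?_⟩
    · exact inj_of_nodup_posList (by rwa [← hel])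
    · have hp := h (p - 1) (by omega)
      rw [hel, triple_posList (by omega), show 1 + (p - 1) = p by omega] at hp
      refine ⟨fun hb => (hp.2 ?_).1.cyc, fun hb => (hp.1 ?_).1.isCircuit.cyc⟩
      · have : Even p := by simpa using hb
        rw [show p = p - 1 + 1 by omega, Nat.even_add_one] at this
        simpa using this
      · have : ¬ Even p := by simpa using hb
        rw [show p = p - 1 + 1 by omega, Nat.even_add_one] at this
        simpa using this

theorem Tame.isTriangle (hN : N.Tame) {a b c : α} (hab : a ≠ b) (hac : a ≠ c) (hbc : b ≠ c)
    (h : N.Cyc {a, b, c}) : N.IsTriangle {a, b, c} := by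
  have hcard : ({a, b, c} : Set α).encard = 3 := encard_eq_three.2 ⟨a, b, c, hab, hac, hbc, rfl⟩
  refine ⟨?_, hcard⟩
  have hdep : N.Dep {a, b, c} := by
    refine ⟨fun hi => ?_, h.subset_ground⟩
    exact hi.notMem_closure_sdiff_of_mem (show a ∈ _ by simp) (h a (by simp))
  obtain ⟨C, hC, hCi⟩ := hdep.exists_isCircuit_subset
  by_cases hC3 : C = {a, b, c}
  · rwa [hC3] at hCi
  exfalso
  have hpair : ∀ x y, C ⊆ {x, y} → False := by
    intro x y hxy
    rcases subset_pair_iff_eq.1 hxy with rfl | rfl | rfl | rfl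
    · exact hCi.nonempty.ne_empty rfl
    · exact (hN x x).1 (by rw [pair_eq_singleton]; exact hCi.cyc)
    · exact (hN y y).1 (by rw [pair_eq_singleton]; exact hCi.cyc)
    · exact (hN x y).1 hCi.cyc
  obtain ⟨z, hz, hzC⟩ := exists_of_ssubset (hC.ssubset_of_ne hC3)
  have hC' : ∀ y ∈ C, y ≠ z ∧ (y = a ∨ y = b ∨ y = c) := fun y hy =>
    ⟨fun h => hzC (h ▸ hy), hC hy⟩
  rcases hz with rfl | rfl | rfl
  · exact hpair b c fun y hy => by have := hC' y hy; simp; tauto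
  · exact hpair a c fun y hy => by have := hC' y hy; simp; tauto
  · exact hpair a b fun y hy => by have := hC' y hy; simp; tauto

theorem Tame.isTriad (hN : N.Tame) {a b c : α} (hab : a ≠ b) (hac : a ≠ c) (hbc : b ≠ c)
    (h : N✶.Cyc {a, b, c}) : N.IsTriad {a, b, c} := by
  obtain ⟨h1, h2⟩ := hN.dual.isTriangle hab hac hbc h
  exact ⟨h1, h2⟩

theorem PosFan.ne (h : N.PosFan lo hi el) {p q : ℕ} (hp : lo ≤ p) (hpq : p < q) (hq : q < hi) :
    el p ≠ el q := fun he => hpq.ne (h.inj p q hp (by omega) (by omega) hq he)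

theorem PosFan.isTriangle (h : N.PosFan lo hi el) (hN : N.Tame) {p : ℕ} (hp : Even p) (h1 : lo ≤ p)
    (h2 : p + 2 < hi) : N.IsTriangle {el p, el (p + 1), el (p + 2)} :=
  hN.isTriangle (h.ne h1 (by omega) (by omega)) (h.ne h1 (by omega) (by omega))
    (h.ne (by omega) (by omega) (by omega)) (h.triangle hp h1 h2)

theorem PosFan.isTriad (h : N.PosFan lo hi el) (hN : N.Tame) {p : ℕ} (hp : Odd p) (h1 : lo ≤ p)
    (h2 : p + 2 < hi) : N.IsTriad {el p, el (p + 1), el (p + 2)} :=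
  hN.isTriad (h.ne h1 (by omega) (by omega)) (h.ne h1 (by omega) (by omega))
    (h.ne (by omega) (by omega) (by omega)) (h.triad hp h1 h2)

theorem PosFan.isFan (h : N.PosFan lo hi el) (hN : N.Tame) (hlen : lo + 3 ≤ hi) :
    N.IsFan (posList lo hi el) := by
  refine ⟨by simp; omega, nodup_posList h.inj, ?_⟩
  rcases Nat.even_or_odd lo with hlo | hlo
  · left
    intro i hi'
    rw [length_posList] at hi'
    rw [triple_posList (by omega)]
    exact ⟨fun he => h.isTriangle hN (hlo.add he) (by omega) (by omega),
      fun he => h.isTriad hN (hlo.add_odd he) (by omega) (by omega)⟩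
  · right
    intro i hi'
    rw [length_posList] at hi'
    rw [triple_posList (by omega)]
    exact ⟨fun he => h.isTriad hN (hlo.add_even he) (by omega) (by omega),
      fun he => h.isTriangle hN (hlo.add_odd he) (by omega) (by omega)⟩

theorem PosFan.weakFan (h : N.PosFan lo hi el) {τ : α → Bool}
    (hτ : ∀ p, lo ≤ p → p < hi → τ (el p) = decide (Odd p)) : N.WeakFan τ (posList lo hi el) := by
  refine ⟨nodup_posList h.inj, fun a b hab => ?_, fun a b c habc => ?_⟩
  · rw [List.infix_iff_getElem?] at hab
    obtain ⟨k, hk, hab⟩ := hab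
    have h0 := hab 0 (by simp)
    have h1 := hab 1 (by simp)
    rw [getElem?_posList_eq_some] at h0 h1
    simp only [List.getElem_cons_zero, List.getElem_cons_succ] at h0 h1
    rw [← h0.2, ← h1.2, hτ _ (by omega) (by omega), hτ _ (by omega) (by omega)]
    rw [show lo + (1 + k) = lo + (0 + k) + 1 by ring]
    simp [Nat.odd_add_one, -Nat.not_odd_iff_even]
  · rw [List.infix_iff_getElem?] at habc
    obtain ⟨k, hk, habc⟩ := habc
    have h0 := habc 0 (by simp)
    have h1 := habc 1 (by simp)
    have h2 := habc 2 (by simp)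
    rw [getElem?_posList_eq_some] at h0 h1 h2
    simp only [List.getElem_cons_zero, List.getElem_cons_succ] at h0 h1 h2
    rw [← h0.2, ← h1.2, ← h2.2, hτ _ (by omega) (by omega)]
    have := h.triple (lo + (0 + k)) (by omega) (by omega)
    rw [show lo + (1 + k) = lo + (0 + k) + 1 by ring, show lo + (2 + k) = lo + (0 + k) + 2 by ring]
    simpa [Nat.odd_add_one] using this

theorem WeakFan.posFan {τ : α → Bool} (h : N.WeakFan τ (posList lo hi el))
    (h0 : τ (el lo) = decide (Odd lo)) :
    N.PosFan lo hi el ∧ ∀ p, lo ≤ p → p < hi → τ (el p) = decide (Odd p) := by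
  have hτ : ∀ i, lo + i < hi → τ (el (lo + i)) = decide (Odd (lo + i)) := by
    intro i
    induction i with
    | zero => exact fun _ => h0
    | succ i ih =>
      intro hi'
      rw [h.alt (el (lo + i)) (el (lo + (i + 1))) ?_, ih (by omega), ← add_assoc]
      · simp [Nat.odd_add_one, -Nat.not_odd_iff_even]
      · rw [List.infix_iff_getElem?]
        refine ⟨i, by simp; omega, fun j hj => ?_⟩
        simp only [List.length_cons, List.length_nil] at hj
        rw [getElem?_posList (by omega)]
        interval_cases j <;> simp [add_comm]
  have hτ' : ∀ p, lo ≤ p → p < hi → τ (el p) = decide (Odd p) := by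
    intro p h1 h2
    have := hτ (p - lo) (by omega)
    rwa [show lo + (p - lo) = p by omega] at this
  refine ⟨⟨inj_of_nodup_posList h.nodup, fun p hp1 hp2 => ?_⟩, hτ'⟩
  have := h.triple (el p) (el (p + 1)) (el (p + 2)) ?_
  · rw [hτ' _ (by omega) (by omega)] at this
    simpa [Nat.odd_add_one] using this
  · rw [List.infix_iff_getElem?]
    refine ⟨p - lo, by simp; omega, fun j hj => ?_⟩
    simp only [List.length_cons, List.length_nil] at hj
    rw [getElem?_posList (by omega), show lo + (j + (p - lo)) = p + j by omega]
    interval_cases j <;> simp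

theorem IsConnectedOfOrder.not_cyc_and_dual_cyc [N.Finite] (hN : N.IsConnectedOfOrder 3)
    {a b c : α} (hab : a ≠ b) (h : N.Cyc {a, b, c}) (h' : N✶.Cyc {a, b, c})
    (hout : 2 ≤ (N.E \ {a, b, c}).encard) : False := by
  have h1 := hN.le_of_encard (k := 2) (by norm_num) (by norm_num) h.subset_ground
    (by
      refine le_trans ?_ (encard_le_encard (show ({a, b} : Set α) ⊆ _ from ?_))
      · rw [encard_pair hab]; rfl
      · intro x; simp; tauto)
    (by exact_mod_cast hout)
  have h2 := eRk_compl_add_one_le_of_dual_cyc h' (show a ∈ _ by simp)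
  have h3 : N.eRk {a, b, c} ≤ 2 := by
    have : N.eRk {a, b, c} ≤ N.eRk {b, c} := by
      rw [← N.eRk_closure_eq {b, c}]
      refine N.eRk_mono ?_
      have hE := h.subset_ground
      have hbc : ({b, c} : Set α) ⊆ N.E := fun x hx => hE (by simp at hx ⊢; tauto)
      refine insert_subset ?_ (N.subset_closure _ hbc)
      refine N.closure_subset_closure ?_ (h a (by simp))
      intro x; simp; tauto
    refine this.trans ((N.eRk_le_encard _).trans ((encard_insert_le _ _).trans ?_))
    rw [encard_singleton]; rfl
  have hr : N.eRank ≠ ⊤ := (eRank_ne_top_iff N).2 inferInstance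
  have h4 : N.eRank + 2 + 1 ≤ N.eRank + 2 := calc
    N.eRank + 2 + 1 ≤ N.eRk {a, b, c} + N.eRk (N.E \ {a, b, c}) + 1 := by
        exact add_le_add_left h1 1
    _ ≤ 2 + N.eRank := by rw [add_assoc]; exact add_le_add h3 h2
    _ = _ := add_comm _ _
  lift N.eRank to ℕ using hr with n
  norm_cast at h4
  omega

end PosList

/-! ### The points added to the ends of a fan -/

section FanPoints

variable {K V α : Type*} [Field K] [AddCommGroup V] [Module K V] {N : Matroid α} {f : α → V}
  {lo hi r : ℕ} {el : ℕ → α} {u : ℕ → V} {g : ℕ → V →ₗ[K] K}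

/-- If two subspaces meet in the line spanned by `v`, then their `meetPoint` is a multiple of `v`. -/
theorem exists_meetPoint_eq_smul {U W : Submodule K V} {v : V} (hU : v ∈ U) (hW : v ∈ W)
    (hv : v ≠ 0) (h : ∀ x ∈ U, x ∈ W → ∃ c : K, x = c • v) :
    ∃ c : K, c ≠ 0 ∧ meetPoint U W = c • v := by
  have hex : ∃ x ∈ U ⊓ W, x ≠ 0 := ⟨v, ⟨hU, hW⟩, hv⟩
  obtain ⟨⟨h1, h2⟩, h3⟩ := hex.choose_spec
  obtain ⟨c, hc⟩ := h _ h1 h2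
  refine ⟨c, ?_, ?_⟩
  · rintro rfl
    rw [zero_smul] at hc
    exact h3 hc
  · rw [meetPoint, dif_pos hex]; exact hc

/-- The first triple of a fan with at least two elements outside is a triangle if and only if the
fan starts with a spoke element. -/
theorem PosFan.isTriangle_iff [N.Finite] (h : N.PosFan lo hi el) (hN : N.IsConnectedOfOrder 3)
    (ht : N.Tame) (hlo : lo ≤ 1) (hlen : lo + 3 ≤ hi)
    (hout : 2 ≤ (N.E \ posSet lo hi el).encard) :
    N.IsTriangle (Matroid.triple (posList lo hi el) 0) ↔ lo = 0 := by
  rw [triple_posList (by omega), add_zero]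
  constructor
  · intro hT
    by_contra hlo0
    refine hN.not_cyc_and_dual_cyc (h.ne (by omega) (by omega) (by omega)) hT.1.cyc
      (h.triad (show Odd lo by rw [show lo = 1 by omega]; exact odd_one) le_rfl (by omega)) ?_
    refine hout.trans (encard_le_encard (sdiff_subset_sdiff_right ?_))
    rintro _ (rfl | rfl | rfl)
    exacts [⟨_, by omega, by omega, rfl⟩, ⟨_, by omega, by omega, rfl⟩, ⟨_, by omega, by omega, rfl⟩]
  · rintro rfl
    exact h.isTriangle ht (by simp) le_rfl (by omega)

theorem PosFan.exists_endVector_eq [N.Finite] (hpos : N.PosFan lo hi el)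
    (h : FanCoord K N f lo hi r el u g)
    (hN : N.IsConnectedOfOrder 3) (ht : N.Tame) (hf : N.IsRepresentedBy K f) (hlo : lo ≤ 1)
    (hlen : lo + 3 ≤ hi) (hr : hi = 2 * r - 1 ∨ hi = 2 * r - 2)
    (hout : 2 ≤ (N.E \ posSet lo hi el).encard) :
    ∃ c : K, c ≠ 0 ∧ endVector K N f (posList lo hi el) = c • u 0 := by
  obtain ⟨h0, h1, hind⟩ := h.ends hN hf hlo hlen hr hpos hout
  rw [endVector]
  simp only [hpos.isTriangle_iff hN ht hlo hlen hout]
  split_ifs with hl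
  · rw [head?_posList (by omega)]
    obtain ⟨c, hc, hcu⟩ := h.vec lo (by omega) (by omega)
    refine ⟨c, hc, ?_⟩
    subst hl
    rw [show wv u 0 = u 0 from wv_even u 0] at hcu
    exact hcu
  · have hl1 : lo = 1 := by omega
    rw [listSet_take_two_posList (by omega), listSet_posList]
    have hli := h.linearIndepOn (by omega) hind
    obtain ⟨σ, hσ⟩ := exists_functional_of_linearIndepOn hli (fun k => if k = r - 1 then 1 else 0)
    refine exists_meetPoint_eq_smul h.first_mem h0 (hli.ne_zero (show (0 : ℕ) < r by omega)) ?_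
    intro x hxU hxW
    have hker : Submodule.span K (f '' {x | ∃ p, lo ≤ p ∧ p < lo + 2 ∧ el p = x}) ≤
        LinearMap.ker σ := by
      refine Submodule.span_le.2 ?_
      rintro _ ⟨_, ⟨p, hp1, hp2, rfl⟩, rfl⟩
      obtain ⟨c, -, hcu⟩ := h.vec p hp1 (by omega)
      have hp : p = 2 * 0 + 1 ∨ p = 2 * 1 := by omega
      have e0 := hσ 0 (show (0 : ℕ) < r by omega)
      have e1 := hσ 1 (show (1 : ℕ) < r by omega)
      rw [if_neg (by omega)] at e0 e1
      rcases hp with rfl | rfl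
      · rw [wv_odd] at hcu; simp [hcu, e0, e1]
      · rw [wv_even] at hcu; simp [hcu, e1]
    obtain ⟨a, b, rfl⟩ := h.eq_ends (by omega) (h.span_le hr (Submodule.span_mono (image_mono (by
      rintro _ ⟨p, h1, h2, rfl⟩; exact ⟨p, h1, by omega, rfl⟩)) hxU))
      (fun l hl1 hl2 => h.dual_eq_zero hl1 hl2 hxW)
    have hb : σ (a • u 0 + b • u (r - 1)) = 0 := hker hxU
    rw [map_add, map_smul, map_smul, hσ 0 (show (0 : ℕ) < r by omega),
      hσ (r - 1) (show r - 1 < r by omega), if_neg (by omega), if_pos rfl] at hb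
    simp only [smul_eq_mul, mul_zero, mul_one, zero_add] at hb
    exact ⟨a, by rw [hb, zero_smul, add_zero]⟩

theorem PosFan.exists_rimVector_eq [N.Finite] (hpos : N.PosFan lo hi el)
    (h : FanCoord K N f lo hi r el u g)
    (hN : N.IsConnectedOfOrder 3) (ht : N.Tame) (hf : N.IsRepresentedBy K f) (hlo : lo ≤ 1)
    (hlen : lo + 3 ≤ hi) (hr : hi = 2 * r - 1 ∨ hi = 2 * r - 2)
    (hout : 2 ≤ (N.E \ posSet lo hi el).encard) :
    ∃ c : K, c ≠ 0 ∧ rimVector K N f (posList lo hi el) = c • (u 0 - u (r - 1)) := by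
  obtain ⟨h0, h1, hind⟩ := h.ends hN hf hlo hlen hr hpos hout
  have hli := h.linearIndepOn (by omega) hind
  have hrim : N.rimSet (posList lo hi el) = {x | ∃ p, Odd p ∧ lo ≤ p ∧ p < hi ∧ el p = x} := by
    ext x
    simp only [rimSet, hpos.isTriangle_iff hN ht hlo hlen hout, getElem?_posList_eq_some,
      mem_ofPred_eq]
    have hodd : ∀ i, (Odd i ↔ lo = 0) ↔ Odd (lo + i) := by
      intro i
      have : lo = 0 ∨ lo = 1 := by omega
      rcases this with rfl | rfl
      · simp
      · rw [add_comm, Nat.odd_add_one]; simp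
    constructor
    · rintro ⟨i, ⟨hi1, rfl⟩, hi2⟩
      exact ⟨lo + i, (hodd i).1 hi2, by omega, hi1, rfl⟩
    · rintro ⟨p, hp, hp1, hp2, rfl⟩
      refine ⟨p - lo, ⟨by omega, by congr 1; omega⟩, (hodd _).2 ?_⟩
      rwa [show lo + (p - lo) = p by omega]
  rw [rimVector, hrim, listSet_posList]
  obtain ⟨σ, hσ⟩ := exists_functional_of_linearIndepOn hli (fun _ => 1)
  refine exists_meetPoint_eq_smul ?_ (Submodule.sub_mem _ h0 h1) ?_ ?_
  · have : ∀ k, k < r → u 0 - u k ∈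
        Submodule.span K (f '' {x | ∃ p, Odd p ∧ lo ≤ p ∧ p < hi ∧ el p = x}) := by
      intro k
      induction k with
      | zero => simp
      | succ k ih =>
        intro hk
        rw [← sub_add_sub_cancel _ (u k)]
        refine Submodule.add_mem _ (ih (by omega)) ?_
        obtain ⟨c, hc, hcu⟩ := h.vec (2 * k + 1) (by omega) (by omega)
        rw [wv_odd] at hcu
        rw [show u k - u (k + 1) = c⁻¹ • f (el (2 * k + 1)) by
          rw [hcu, smul_smul, inv_mul_cancel₀ hc, one_smul]]
        exact Submodule.smul_mem _ _
          (Submodule.subset_span ⟨_, ⟨_, by simp, by omega, by omega, rfl⟩, rfl⟩)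
    exact this _ (by omega)
  · intro he
    have := (hind 1 (-1) (by rw [one_smul, neg_one_smul, ← sub_eq_add_neg, he])).1
    exact one_ne_zero this
  · intro x hxU hxW
    have hker : Submodule.span K (f '' {x | ∃ p, Odd p ∧ lo ≤ p ∧ p < hi ∧ el p = x}) ≤
        LinearMap.ker σ := by
      refine Submodule.span_le.2 ?_
      rintro _ ⟨_, ⟨p, ⟨k, rfl⟩, hp1, hp2, rfl⟩, rfl⟩
      obtain ⟨c, -, hcu⟩ := h.vec _ hp1 hp2
      rw [wv_odd] at hcu
      simp [hcu, hσ k (show k < r by omega), hσ (k + 1) (show k + 1 < r by omega)]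
    obtain ⟨a, b, rfl⟩ := h.eq_ends (by omega) (h.span_le hr (Submodule.span_mono (image_mono (by
      rintro _ ⟨p, -, h1, h2, rfl⟩; exact ⟨p, h1, by omega, rfl⟩)) hxU))
      (fun l hl1 hl2 => h.dual_eq_zero hl1 hl2 hxW)
    have hb : σ (a • u 0 + b • u (r - 1)) = 0 := hker hxU
    rw [map_add, map_smul, map_smul, hσ 0 (show (0 : ℕ) < r by omega),
      hσ (r - 1) (show r - 1 < r by omega)] at hb
    simp only [smul_eq_mul, mul_one] at hb
    refine ⟨a, ?_⟩
    rw [eq_neg_of_add_eq_zero_right hb]; module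

theorem PosFan.exists_endVector_reverse_eq [N.Finite] (hpos : N.PosFan lo hi el)
    (h : FanCoord K N f lo hi r el u g)
    (hN : N.IsConnectedOfOrder 3) (ht : N.Tame) (hf : N.IsRepresentedBy K f) (hlo : lo ≤ 1)
    (hlen : lo + 3 ≤ hi) (hr : hi = 2 * r - 1 ∨ hi = 2 * r - 2)
    (hout : 2 ≤ (N.E \ posSet lo hi el).encard) :
    ∃ c : K, c ≠ 0 ∧ endVector K N f (posList lo hi el).reverse = c • u (r - 1) := by
  rw [posList_reverse (r := r) (by omega)]
  refine hpos.reverse.exists_endVector_eq (h.reverse (by omega) hlen) hN ht hf (by omega)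
    (by omega) (by omega) ?_
  rwa [posSet_reverse (by omega)]

end FanPoints

/-! ### Vector representations of wheels -/

section WheelRep

variable {K V : Type*} [Field K] [AddCommGroup V] [Module K V] {R : ℕ} {vec : ℕ → V}
  {b : Option ℕ → V} {S T I : Set ℕ}

/-- The rim vertex that every edge of the wheel has as its first end. -/
def wheelSrc (p : ℕ) : Option ℕ := some (p / 2)

/-- The second end of an edge of the wheel with `R` spokes. -/
def wheelTgt (R p : ℕ) : Option ℕ := if Even p then none else some ((p / 2 + 1) % R)

/-- The vertices of the wheel with `R` spokes. -/
def wheelVerts (R : ℕ) : Set (Option ℕ) := {x | ∀ k ∈ x, k < R}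

theorem wheelSrc_mem {p : ℕ} (hp : p < 2 * R) : wheelSrc p ∈ wheelVerts R := by
  intro k hk
  simp only [wheelSrc, Option.mem_def, Option.some.injEq] at hk
  omega

theorem wheelTgt_mem {p : ℕ} (hp : p < 2 * R) : wheelTgt R p ∈ wheelVerts R := by
  intro k hk
  unfold wheelTgt at hk
  split_ifs at hk
  · simp at hk
  · simp only [Option.mem_def, Option.some.injEq] at hk
    rw [← hk]
    exact Nat.mod_lt _ (by omega)

/-- `vec` represents the wheel with `R` spokes as a graph: up to scaling, the vector of an edge is
the difference of the vectors `b` of its ends, and each set of vertices is cut out by a linear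
functional on such differences. -/
structure WheelRep (K : Type*) {V : Type*} [Field K] [AddCommGroup V] [Module K V] (R : ℕ)
    (vec : ℕ → V) (b : Option ℕ → V) : Prop where
  vec : ∀ p, p < 2 * R → ∃ c : K, c ≠ 0 ∧ vec p = c • (b (wheelSrc p) - b (wheelTgt R p))
  sep : ∀ T : Set (Option ℕ), ∃ θ : V →ₗ[K] K, ∀ x ∈ wheelVerts R, ∀ y ∈ wheelVerts R,
    θ (b x - b y) = T.indicator 1 x - T.indicator 1 y

/-- Two vertices are connected by edges of the wheel whose positions are in `S`. -/
def WheelConn (R : ℕ) (S : Set ℕ) : Option ℕ → Option ℕ → Prop :=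
  Relation.EqvGen fun x y => ∃ p ∈ S, x = wheelSrc p ∧ y = wheelTgt R p

/-- The indicator of a class of connected vertices gives a functional that vanishes on the edges in
`S`. -/
theorem WheelRep.exists_functional (h : WheelRep K R vec b) (hS : S ⊆ {p | p < 2 * R})
    (z : Option ℕ) : ∃ θ : V →ₗ[K] K, (∀ v ∈ Submodule.span K (vec '' S), θ v = 0) ∧
      ∀ x ∈ wheelVerts R, ∀ y ∈ wheelVerts R, θ (b x - b y) =
        {x | WheelConn R S z x}.indicator 1 x - {x | WheelConn R S z x}.indicator 1 y := by
  obtain ⟨θ, hθ⟩ := h.sep {x | WheelConn R S z x}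
  refine ⟨θ, fun v hv => ?_, hθ⟩
  have hker : Submodule.span K (vec '' S) ≤ LinearMap.ker θ := by
    refine Submodule.span_le.2 ?_
    rintro _ ⟨p, hp, rfl⟩
    obtain ⟨c, -, hc⟩ := h.vec p (hS hp)
    have hpe : WheelConn R S (wheelSrc p) (wheelTgt R p) := .rel _ _ ⟨p, hp, rfl, rfl⟩
    have : ({x | WheelConn R S z x}.indicator 1 (wheelSrc p) : K) =
        {x | WheelConn R S z x}.indicator 1 (wheelTgt R p) := by
      by_cases h1 : WheelConn R S z (wheelSrc p)
      · rw [indicator_of_mem (show _ ∈ {x | WheelConn R S z x} from h1),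
          indicator_of_mem (show _ ∈ {x | WheelConn R S z x} from h1.trans _ _ _ hpe)]; rfl
      · rw [indicator_of_notMem (show _ ∉ {x | WheelConn R S z x} from h1), indicator_of_notMem]
        exact fun h2 => h1 (h2.trans _ _ _ (hpe.symm _ _))
    rw [SetLike.mem_coe, LinearMap.mem_ker, hc, map_smul,
      hθ _ (wheelSrc_mem (hS hp)) _ (wheelTgt_mem (hS hp)), this, sub_self, smul_zero]
  exact hker hv

theorem WheelRep.mem_span_iff (h : WheelRep K R vec b) (hS : S ⊆ {p | p < 2 * R})
    {x y : Option ℕ} (hx : x ∈ wheelVerts R) (hy : y ∈ wheelVerts R) :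
    b x - b y ∈ Submodule.span K (vec '' S) ↔ WheelConn R S x y := by
  constructor
  · intro hmem
    obtain ⟨θ, hker, hθ⟩ := h.exists_functional hS x
    have h0 := hker _ hmem
    rw [hθ x hx y hy, indicator_of_mem (show x ∈ {z | WheelConn R S x z} from .refl _)] at h0
    by_contra hcon
    rw [indicator_of_notMem (by exact hcon)] at h0
    simp at h0
  · intro hc
    induction hc with
    | rel x y hxy =>
      obtain ⟨p, hp, rfl, rfl⟩ := hxy
      obtain ⟨c, hc0, hc⟩ := h.vec p (hS hp)
      rw [show b (wheelSrc p) - b (wheelTgt R p) = c⁻¹ • vec p by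
        rw [hc, smul_smul, inv_mul_cancel₀ hc0, one_smul]]
      exact Submodule.smul_mem _ _ (Submodule.subset_span (mem_image_of_mem _ hp))
    | refl x => simp
    | symm x y _ ih => rw [← neg_sub]; exact Submodule.neg_mem _ (ih hy hx)
    | trans x z y hxz hzy ih1 ih2 =>
      have hz : z ∈ wheelVerts R := by
        have key : ∀ x y, WheelConn R S x y → (x ∈ wheelVerts R ↔ y ∈ wheelVerts R) := by
          intro x y hxy
          induction hxy with
          | rel x y hxy =>
            obtain ⟨p, hp, rfl, rfl⟩ := hxy
            exact iff_of_true (wheelSrc_mem (hS hp)) (wheelTgt_mem (hS hp))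
          | refl => rfl
          | symm _ _ _ ih => exact ih.symm
          | trans _ _ _ _ _ ih1 ih2 => exact ih1.trans ih2
        exact (key _ _ hxz).1 hx
      rw [← sub_add_sub_cancel _ (b z)]
      exact Submodule.add_mem _ (ih1 hx hz) (ih2 hz hy)

theorem WheelRep.vec_mem_span_iff (h : WheelRep K R vec b) (hS : S ⊆ {p | p < 2 * R})
    {p : ℕ} (hp : p < 2 * R) : vec p ∈ Submodule.span K (vec '' S) ↔
      WheelConn R S (wheelSrc p) (wheelTgt R p) := by
  rw [← h.mem_span_iff hS (wheelSrc_mem hp) (wheelTgt_mem hp)]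
  obtain ⟨c, hc0, hc⟩ := h.vec p hp
  rw [hc]
  exact Submodule.smul_mem_iff _ hc0

/-- Independence in a wheel does not depend on the field: a set is independent when it has no
redundant connection. -/
theorem WheelRep.linearIndepOn_iff (h : WheelRep K R vec b) (hI : I ⊆ {p | p < 2 * R}) :
    LinearIndepOn K vec I ↔ ∀ p ∈ I, ¬ WheelConn R (I \ {p}) (wheelSrc p) (wheelTgt R p) := by
  rw [linearIndepOn_iff_notMem_span]
  exact forall₂_congr fun p hp => not_congr (h.vec_mem_span_iff (sdiff_subset.trans hI) (hI hp))

theorem wheelRep_of_linearIndepOn {w : ℕ → V} (hw : LinearIndepOn K w (Iio R))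
    (hvec : ∀ p, p < 2 * R → ∃ c : K, c ≠ 0 ∧
      vec p = c • (if Even p then w (p / 2) else w (p / 2) - w ((p / 2 + 1) % R))) :
    WheelRep K R vec (fun x => x.elim 0 w) := by
  refine ⟨fun p hp => ?_, fun T => ?_⟩
  · obtain ⟨c, hc0, hc⟩ := hvec p hp
    refine ⟨c, hc0, ?_⟩
    rw [hc]
    by_cases hp : Even p <;> simp [hp, wheelSrc, wheelTgt]
  · obtain ⟨θ, hθ⟩ := exists_functional_of_linearIndepOn hw
      (fun k => T.indicator 1 (some k) - T.indicator 1 none)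
    have : ∀ x ∈ wheelVerts R, θ (x.elim 0 w) = T.indicator 1 x - T.indicator 1 none := by
      rintro (_ | k) hx
      · simp
      · exact hθ k (hx k rfl)
    refine ⟨θ, fun x hx y hy => ?_⟩
    rw [map_sub, this x hx, this y hy]; ring

theorem wheelRep_wheelVector (R : ℕ) :
    WheelRep (ZMod 2) R (wheelVector R) (fun x => Pi.single x 1) := by
  have hneg : ∀ v : Option ℕ → ZMod 2, -v = v := fun v => funext fun i => ZMod.neg_eq_self_mod_two _
  refine ⟨fun p hp => ⟨1, one_ne_zero, ?_⟩, fun T => ?_⟩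
  · rw [one_smul, sub_eq_add_neg, hneg]
    by_cases hp : Even p <;> simp [hp, wheelSrc, wheelTgt, wheelVector, add_comm]
  · have hli : LinearIndependent (ZMod 2)
        (fun x : Option ℕ => (Pi.single x 1 : Option ℕ → ZMod 2)) :=
      Pi.linearIndependent_single_one _ _
    obtain ⟨θ, hθ⟩ := exists_functional_of_linearIndepOn (s := univ) (linearIndepOn_univ_iff.2 hli)
      (fun x => T.indicator 1 x)
    exact ⟨θ, fun x _ y _ => by rw [map_sub, hθ x (mem_univ _), hθ y (mem_univ _)]⟩

theorem wheel_ground (R : ℕ) : (wheel R).E = {p | p < 2 * R} := rfl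

theorem WheelRep.wheel_indep_iff (h : WheelRep K R vec b) (hI : I ⊆ {p | p < 2 * R}) :
    (wheel R).Indep I ↔ LinearIndepOn K vec I := by
  rw [wheel, vectorMatroid_indep_iff, and_iff_right hI, (wheelRep_wheelVector R).linearIndepOn_iff hI,
    h.linearIndepOn_iff hI]

end WheelRep

/-! ### Recognizing wheels and whirls -/

section Recognize

variable {K V α : Type*} [Field K] [AddCommGroup V] [Module K V] {N : Matroid α} {f : α → V}

/-- A matroid represented by a basis `w`, the differences of consecutive members of `w` and a
vector `w (m - 1) - μ w 0` is a wheel if `μ = 1`, and a whirl otherwise: a set that misses a rim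
element is independent in the wheel if and only if it is independent here, as the members of `w` can
be rescaled. -/
theorem isWheel_or_isWhirl_of_vectors (hf : N.IsRepresentedBy K f) {m : ℕ} (hm : 2 ≤ m)
    {el : ℕ → α} (hinj : InjOn el {p | p < 2 * m}) (hE : N.E = el '' {p | p < 2 * m})
    {w : ℕ → V} (hw : LinearIndepOn K w (Iio m)) {μ : K} (hμ : μ ≠ 0)
    (hvec : ∀ p, p + 1 < 2 * m → ∃ c : K, c ≠ 0 ∧ f (el p) = c • wv w p)
    (hlast : ∃ c : K, c ≠ 0 ∧ f (el (2 * m - 1)) = c • (w (m - 1) - μ • w 0)) :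
    N.IsWheel ∨ N.IsWhirl := by
  have hNI : ∀ I ⊆ {p | p < 2 * m}, N.Indep (el '' I) ↔ LinearIndepOn K (f ∘ el) I := by
    intro I hI
    rw [hf _ (hE ▸ image_mono hI)]
    exact ⟨fun h => h.comp_of_image (hinj.mono hI), fun h => h.image_of_comp⟩
  set vec := f ∘ el with hvecdef
  have hmod : ∀ k, k + 1 < m → (k + 1) % m = k + 1 := fun k hk => Nat.mod_eq_of_lt hk
  have hodd : ∀ k, (2 * k + 1) / 2 = k := fun k => by omega
  obtain ⟨d, hd, hd'⟩ := hlast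
  by_cases hμ1 : μ = 1
  · left
    have hrep : WheelRep K m vec (fun x => x.elim 0 w) := by
      refine wheelRep_of_linearIndepOn hw fun p hp => ?_
      by_cases hp' : p + 1 < 2 * m
      · obtain ⟨c, hc0, hc⟩ := hvec p hp'
        refine ⟨c, hc0, ?_⟩
        rcases Nat.even_or_odd' p with ⟨k, rfl | rfl⟩
        · rw [wv_even] at hc
          rw [if_pos (by simp), Nat.mul_div_cancel_left _ (by norm_num)]
          exact hc
        · rw [wv_odd] at hc
          rw [if_neg (by simp), hodd, hmod k (by omega)]
          exact hc
      · refine ⟨d, hd, ?_⟩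
        rw [show p = 2 * m - 1 by omega, if_neg (by
          rw [Nat.not_even_iff_odd]; exact ⟨m - 1, by omega⟩),
          show (2 * m - 1) / 2 = m - 1 by omega, show m - 1 + 1 = m by omega, Nat.mod_self]
        rw [hμ1, one_smul] at hd'
        exact hd'
    have hinj' : InjOn el (wheel m).E := hinj
    refine ⟨m, hm, el, hinj', ext_indep (by rw [hE]; rfl) fun I hI => ?_⟩
    rw [map_indep_iff]
    rw [hE] at hI
    obtain ⟨I', hI', rfl⟩ := subset_image_iff.1 hI
    rw [hNI I' hI', ← hrep.wheel_indep_iff hI']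
    constructor
    · exact fun h => ⟨I', h, rfl⟩
    · rintro ⟨I'', h, h'⟩
      rwa [hinj.image_eq_image_iff hI' h.subset_ground |>.1 h']
  · right
    refine ⟨m, hm, el, hinj, hE, fun I hI => ?_⟩
    rw [hNI I hI]
    by_cases hrim : {p | p < 2 * m ∧ Odd p} ⊆ I
    · -- the rim is dependent in the wheel, and spans the whole space here
      have hdep : ¬ (wheel m).Indep I := by
        set vec0 : ℕ → V := fun p => if Even p then w (p / 2) else w (p / 2) - w ((p / 2 + 1) % m)
          with hvec0
        have hv0 : ∀ k, vec0 (2 * k + 1) = w k - w ((k + 1) % m) := fun k => by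
          simp only [hvec0]; rw [if_neg (by simp), hodd]
        rw [(wheelRep_of_linearIndepOn (vec := vec0) hw fun p _ =>
          ⟨1, one_ne_zero, (one_smul _ _).symm⟩).wheel_indep_iff hI,
          linearIndepOn_iff_notMem_span]
        intro h
        refine h (2 * (m - 1) + 1) (hrim ⟨by omega, by simp⟩) ?_
        rw [hv0, show m - 1 + 1 = m by omega, Nat.mod_self, ← neg_sub]
        refine Submodule.neg_mem _ ?_
        have : ∀ k, k + 1 ≤ m → w 0 - w k ∈
            Submodule.span K (vec0 '' (I \ {2 * (m - 1) + 1})) := by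
          intro k
          induction k with
          | zero => simp
          | succ k ih =>
            intro hk
            rw [← sub_add_sub_cancel _ (w k)]
            refine Submodule.add_mem _ (ih (by omega)) (Submodule.subset_span
              ⟨2 * k + 1, ⟨hrim ⟨by omega, by simp⟩, ?_⟩, by rw [hv0, hmod k (by omega)]⟩)
            simp only [mem_singleton_iff]; omega
        exact this _ (by omega)
      have hspan : ∀ k, k < m → w k ∈ Submodule.span K (vec '' {p | p < 2 * m ∧ Odd p}) := by
        set Z := Submodule.span K (vec '' {p | p < 2 * m ∧ Odd p})
        have h1 : ∀ k, k + 1 ≤ m → w 0 - w k ∈ Z := by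
          intro k
          induction k with
          | zero => simp
          | succ k ih =>
            intro hk
            rw [← sub_add_sub_cancel _ (w k)]
            refine Submodule.add_mem _ (ih (by omega)) ?_
            obtain ⟨c, hc0, hc⟩ := hvec (2 * k + 1) (by omega)
            rw [wv_odd] at hc
            rw [← Submodule.smul_mem_iff _ hc0, ← hc]
            exact Submodule.subset_span ⟨2 * k + 1, ⟨by omega, by simp⟩, rfl⟩
        have h2 : w (m - 1) - μ • w 0 ∈ Z := by
          rw [← Submodule.smul_mem_iff _ hd, ← hd']
          exact Submodule.subset_span ⟨2 * m - 1, ⟨by omega, ⟨m - 1, by omega⟩⟩, rfl⟩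
        have h3 : w 0 ∈ Z := by
          rw [← Submodule.smul_mem_iff _ (sub_ne_zero.2 (Ne.symm hμ1))]
          have := Submodule.add_mem _ (h1 (m - 1) (by omega)) h2
          rwa [sub_add_sub_cancel, show w 0 - μ • w 0 = (1 - μ) • w 0 by module] at this
        intro k hk
        have := Submodule.sub_mem _ h3 (h1 k (by omega))
        rwa [sub_sub_cancel] at this
      rw [or_iff_right hdep]
      constructor
      · intro hind
        refine subset_antisymm (fun p hp => ⟨hI hp, ?_⟩) hrim
        by_contra hp'
        rw [Nat.not_odd_iff_even, even_iff_exists_two_mul] at hp'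
        obtain ⟨k, rfl⟩ := hp'
        have hk : 2 * k < 2 * m := hI hp
        refine linearIndepOn_iff_notMem_span.1 hind _ hp ?_
        obtain ⟨c, hc0, hc⟩ := hvec (2 * k) (by omega)
        rw [wv_even] at hc
        change f (el (2 * k)) ∈ _
        rw [hc]
        refine Submodule.smul_mem _ _ (Submodule.span_mono (image_mono ?_) (hspan k (by omega)))
        rintro q hq
        refine ⟨hrim hq, ?_⟩
        rintro rfl
        exact absurd hq.2 (by simp)
      · rintro rfl
        obtain ⟨B, hB⟩ := (vectorMatroid K vec {p | p < 2 * m}).exists_isBasis _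
          (show {p | p < 2 * m ∧ Odd p} ⊆ {p | p < 2 * m} from fun p hp => hp.1)
        have hfin : {p | p < 2 * m ∧ Odd p}.Finite := (finite_lt_nat (2 * m)).subset fun p hp => hp.1
        have hBi := ((vectorMatroid_indep_iff _ _ _).1 hB.indep).2
        have hBfin := hfin.subset hB.subset
        have hsp := (vectorMatroid_isRepresentedBy vec {p | p < 2 * m}).span_eq_of_isBasis hB
        have hle : Submodule.span K (w '' Iio m) ≤ Submodule.span K (vec '' B) := by
          rw [hsp]
          refine Submodule.span_le.2 ?_
          rintro _ ⟨k, hk, rfl⟩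
          exact hspan k hk
        have : Module.Finite K (Submodule.span K (vec '' B)) :=
          Module.Finite.span_of_finite K (hBfin.image _)
        have h1 := Submodule.finrank_mono hle
        rw [finrank_span_image_eq_ncard hw (finite_Iio m),
          finrank_span_image_eq_ncard hBi hBfin] at h1
        have hcard : {p | p < 2 * m ∧ Odd p}.ncard ≤ m := by
          have : {p | p < 2 * m ∧ Odd p} = (fun k => 2 * k + 1) '' Iio m := by
            ext p; constructor
            · rintro ⟨h1, k, rfl⟩
              exact ⟨k, by simp only [mem_Iio]; omega, rfl⟩
            · rintro ⟨k, hk, rfl⟩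
              simp only [mem_Iio] at hk
              exact ⟨by change 2 * k + 1 < _; omega, by simp⟩
          rw [this]
          refine (ncard_image_le (finite_Iio m)).trans ?_
          simp
        have hIio : (Iio m).ncard = m := by simp
        rw [hIio] at h1
        have := eq_of_subset_of_ncard_le hB.subset (hcard.trans h1) hfin
        rwa [this] at hBi
    · -- rescale the members of `w` behind the missing rim element
      have hne : I ≠ {p | p < 2 * m ∧ Odd p} := fun h => hrim h.symm.subset
      rw [or_iff_left hne]
      obtain ⟨p₀, ⟨hp₀, k₀, rfl⟩, hpI⟩ := not_subset.1 hrim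
      set s : ℕ → K := fun k => if k ≤ k₀ then 1 else μ⁻¹ with hs
      have hs0 : ∀ k, s k ≠ 0 := fun k => by
        simp only [hs]; split_ifs
        exacts [one_ne_zero, inv_ne_zero hμ]
      have hw' : LinearIndepOn K (fun k => s k • w k) (Iio m) := by
        have := LinearIndependent.units_smul hw (fun k => Units.mk0 (s k) (hs0 k))
        exact this
      set vec' : ℕ → V := fun p => if p = 2 * k₀ + 1 then
        s k₀ • w k₀ - s ((k₀ + 1) % m) • w ((k₀ + 1) % m) else vec p with hvec'
      have hrep : WheelRep K m vec' (fun x => x.elim 0 (fun k => s k • w k)) := by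
        refine wheelRep_of_linearIndepOn hw' fun p hp => ?_
        by_cases hpp : p = 2 * k₀ + 1
        · subst hpp
          refine ⟨1, one_ne_zero, ?_⟩
          rw [if_neg (by simp), one_smul, hodd]
          exact if_pos rfl
        · rw [show vec' p = f (el p) from if_neg hpp]
          by_cases hp' : p + 1 < 2 * m
          · obtain ⟨c, hc0, hc⟩ := hvec p hp'
            rw [hc]
            rcases Nat.even_or_odd' p with ⟨k, rfl | rfl⟩
            · refine ⟨c * (s k)⁻¹, mul_ne_zero hc0 (inv_ne_zero (hs0 k)), ?_⟩
              rw [wv_even, if_pos (by simp), Nat.mul_div_cancel_left _ (by norm_num), smul_smul,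
                inv_mul_cancel_right₀ (hs0 k)]
            · refine ⟨c * (s k)⁻¹, mul_ne_zero hc0 (inv_ne_zero (hs0 k)), ?_⟩
              have hsk : s (k + 1) = s k := by
                simp only [hs]
                congr 1
                rw [eq_iff_iff]; omega
              rw [wv_odd, if_neg (by simp), hodd, hmod k (by omega), hsk, ← smul_sub, smul_smul,
                inv_mul_cancel_right₀ (hs0 k)]
          · have hp1 : p = 2 * m - 1 := by omega
            refine ⟨d * μ, mul_ne_zero hd hμ, ?_⟩
            rw [hp1, hd', if_neg (by rw [Nat.not_even_iff_odd]; exact ⟨m - 1, by omega⟩),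
              show (2 * m - 1) / 2 = m - 1 by omega, show m - 1 + 1 = m by omega, Nat.mod_self,
              show s (m - 1) = μ⁻¹ from if_neg (by omega), show s 0 = 1 from if_pos (by omega),
              mul_smul, one_smul, smul_sub μ, smul_smul μ, mul_inv_cancel₀ hμ, one_smul]
      rw [hrep.wheel_indep_iff hI]
      exact linearIndepOn_congr fun p hp => by
        simp only [hvec']
        rw [if_neg]
        rintro rfl
        exact hpI hp

end Recognize

/-! ### Fans with at most one element outside -/

section LargeFan

variable {K V α : Type*} [Field K] [AddCommGroup V] [Module K V] {N : Matroid α} {f : α → V}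
  {lo hi r : ℕ} {el : ℕ → α} {u : ℕ → V} {g : ℕ → V →ₗ[K] K}

theorem Tame.not_functional (ht : N.Tame) (hf : N.IsRepresentedBy K f) (σ : V →ₗ[K] K) {a b : α}
    (ha : a ∈ N.E) (hσ : ∀ e ∈ N.E, e ≠ a → e ≠ b → σ (f e) = 0) (h : σ (f a) ≠ 0) :
    b ∈ N.E → False := by
  intro hb
  by_cases hb0 : σ (f b) = 0
  · refine (ht a a).2 (hf.dual_cyc_of_functional (by simpa using ha) σ ?_ ?_)
    · intro e he hea
      by_cases heb : e = b
      · rw [heb, hb0]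
      · exact hσ e he (by simpa using hea) heb
    · rintro e (rfl | rfl) <;> exact h
  · refine (ht a b).2 (hf.dual_cyc_of_functional ?_ σ ?_ ?_)
    · rintro e (rfl | rfl) <;> assumption
    · intro e he hea
      simp only [mem_insert_iff, mem_singleton_iff, not_or] at hea
      exact hσ e he hea.1 hea.2
    · rintro e (rfl | rfl) <;> assumption

/-- If no functional separates the first end from the others, then the last end is a multiple of the
first. -/
theorem FanCoord.last_eq_smul (h : u 0 ≠ 0)
    (hdep : ¬ ∀ a b : K, a • u 0 + b • u (r - 1) = 0 → a = 0 ∧ b = 0) :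
    ∃ μ : K, u (r - 1) = μ • u 0 := by
  push Not at hdep
  obtain ⟨a, b, hab, hne⟩ := hdep
  have hb : b ≠ 0 := by
    rintro rfl
    rw [zero_smul, add_zero, smul_eq_zero, or_iff_left h] at hab
    exact hne hab rfl
  refine ⟨-(b⁻¹ * a), ?_⟩
  have : u (r - 1) = b⁻¹ • (b • u (r - 1)) := by rw [smul_smul, inv_mul_cancel₀ hb, one_smul]
  rw [this, eq_neg_of_add_eq_zero_right hab]
  module

theorem FanCoord.linearIndepOn_pred (h : FanCoord K N f lo hi r el u g) (hr : 2 ≤ r)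
    (h0 : u 0 ≠ 0) : LinearIndepOn K u (Iio (r - 1)) := by
  rw [← Finset.coe_range, linearIndepOn_finset_iff]
  intro a ha
  have h1 : ∀ l, 1 ≤ l → l + 2 ≤ r → a l = 0 := by
    intro l hl1 hl2
    have h2 := congr_arg (g l) ha
    rw [map_sum, map_zero, Finset.sum_eq_single l] at h2
    · simpa [h.dual_self l hl1 hl2] using h2
    · intro m hm hml
      rw [Finset.mem_range] at hm
      rw [map_smul, h.dual_ne l hl1 hl2 m (by omega) hml, smul_zero]
    · intro hl; exact absurd (Finset.mem_range.2 (by omega)) hl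
  have h2 : a 0 = 0 := by
    rw [Finset.sum_eq_single 0] at ha
    · rwa [smul_eq_zero, or_iff_left h0] at ha
    · intro m hm hml
      rw [Finset.mem_range] at hm
      rw [h1 m (by omega) (by omega), zero_smul]
    · intro hl; exact absurd (Finset.mem_range.2 (by omega)) hl
  intro i hi
  rw [Finset.mem_range] at hi
  by_cases hi0 : i = 0
  · rwa [hi0]
  · exact h1 i (by omega) (by omega)

/-- The element outside a fan, if there is one, is in the span of the two ends, as it is not a
coloop. -/
theorem FanCoord.outside_eq (h : FanCoord K N f lo hi r el u g) (ht : N.Tame)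
    (hf : N.IsRepresentedBy K f) (hr2 : 2 ≤ r)
    (hr : hi = 2 * r - 1 ∨ hi = 2 * r - 2) {z : α} (hz : z ∈ N.E)
    (hE : N.E \ posSet lo hi el ⊆ {z}) (hzA : z ∉ posSet lo hi el) :
    ∃ a b : K, f z = a • u 0 + b • u (r - 1) := by
  refine h.eq_ends hr2 ?_ fun l hl1 hl2 => h.dual_off l hl1 hl2 z hz hzA
  by_contra hns
  obtain ⟨σ, hσ, hσ'⟩ := Submodule.exists_le_ker_of_notMem hns
  refine ht.not_functional hf σ hz (b := z) (fun e he hez _ => ?_) hσ hz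
  have heA : e ∈ posSet lo hi el := by
    by_contra hcon
    exact hez (hE ⟨he, hcon⟩)
  exact hσ' (h.span_le hr (Submodule.subset_span (mem_image_of_mem f heA)))

theorem image_lt_eq_of_posSet (hE : N.E = posSet 0 hi el) {m : ℕ} (hm : 2 * m = hi) :
    N.E = el '' {p | p < 2 * m} := by
  rw [hE]; ext x; constructor
  · rintro ⟨p, -, h1, rfl⟩; exact ⟨p, by simp only [mem_ofPred_eq]; omega, rfl⟩
  · rintro ⟨p, h1, rfl⟩; exact ⟨p, by omega, by simp only [mem_ofPred_eq] at h1; omega, rfl⟩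

theorem PosFan.isWheel_or_isWhirl_of_first_spoke (hpos : N.PosFan 0 hi el)
    (h : FanCoord K N f 0 hi r el u g) (ht : N.Tame) (hf : N.IsRepresentedBy K f)
    (hlen : 3 ≤ hi) (hr : hi = 2 * r - 1 ∨ hi = 2 * r - 2)
    {z : α} (hz : z ∈ N.E) (hE : N.E \ posSet 0 hi el ⊆ {z}) :
    N.IsWheel ∨ N.IsWhirl := by
  have hr2 : 2 ≤ r := by omega
  have hmem : ∀ p, p < hi → el p ∈ N.E := fun p hp => hpos.mem_ground (by omega) (Nat.zero_le _) hp
  have hin : ∀ e ∈ N.E, e ≠ z → ∃ p, p < hi ∧ el p = e := by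
    intro e he hez
    by_contra hcon
    push Not at hcon
    refine hez (hE ⟨he, ?_⟩)
    rintro ⟨p, -, h1, h2⟩
    exact hcon p h1 h2
  have hinj : ∀ p q, p < hi → q < hi → el p = el q → p = q := fun p q hp hq =>
    hpos.inj p q (by omega) hp (by omega) hq
  obtain ⟨c0, hc0, hf0⟩ := h.vec 0 le_rfl (by omega)
  rw [show wv u 0 = u 0 from wv_even u 0] at hf0
  have hu0 : u 0 ≠ 0 := by
    intro h0
    exact ht.ne_zero hf (hmem 0 (by omega)) (by rw [hf0, h0, smul_zero])
  by_cases hind : ∀ a b : K, a • u 0 + b • u (r - 1) = 0 → a = 0 ∧ b = 0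
  · have hli := h.linearIndepOn hr2 hind
    -- the functionals dual to the two ends
    have hσvec : ∀ k₀, k₀ < r → ∃ σ : V →ₗ[K] K, (∀ k, k < r → σ (u k) = if k = k₀ then 1 else 0) := by
      intro k₀ _
      obtain ⟨σ, hσ⟩ := exists_functional_of_linearIndepOn hli (fun k => if k = k₀ then 1 else 0)
      exact ⟨σ, fun k hk => hσ k hk⟩
    by_cases hzA : z ∈ posSet 0 hi el
    · exfalso
      obtain ⟨σ, hσ⟩ := hσvec 0 (by omega)
      refine ht.not_functional hf σ (hmem 0 (by omega)) (b := el 1) (fun e he he0 he1 => ?_) ?_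
        (hmem 1 (by omega))
      · obtain ⟨p, hp, rfl⟩ : ∃ p, p < hi ∧ el p = e := by
          by_cases hez : e = z
          · obtain ⟨p, -, h1, h2⟩ := hzA; exact ⟨p, h1, h2.trans hez.symm⟩
          · exact hin e he hez
        obtain ⟨c, -, hc⟩ := h.vec p (by omega) hp
        rcases Nat.even_or_odd' p with ⟨k, rfl | rfl⟩
        · have : k ≠ 0 := by rintro rfl; exact he0 rfl
          rw [wv_even] at hc
          rw [hc, map_smul, hσ k (by omega), if_neg this, smul_zero]
        · have : k ≠ 0 := by rintro rfl; exact he1 rfl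
          rw [wv_odd] at hc
          rw [hc, map_smul, map_sub, hσ k (by omega), hσ (k + 1) (by omega), if_neg this,
            if_neg (by omega), sub_zero, smul_zero]
      · rw [hf0, map_smul, hσ 0 (by omega), if_pos rfl, smul_eq_mul, mul_one]; exact hc0
    · obtain ⟨a, b, hab⟩ := h.outside_eq ht hf hr2 hr hz hE hzA
      have hzp : ∀ p, p < hi → el p ≠ z := fun p hp hpz => hzA ⟨p, by omega, hp, hpz⟩
      rcases hr with hr | hr
      · -- the outside element is the missing rim element
        obtain ⟨c1, hc1, hf1⟩ := h.vec (2 * (r - 1)) (by omega) (by omega)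
        rw [wv_even] at hf1
        have ha : a ≠ 0 := by
          rintro rfl
          refine ht.not_smul hf hz (hmem (2 * (r - 1)) (by omega)) (hzp _ (by omega)).symm
            (b * c1⁻¹) ?_
          rw [hf1, hab, smul_smul, inv_mul_cancel_right₀ hc1, zero_smul, zero_add]
        have hb : b ≠ 0 := by
          rintro rfl
          refine ht.not_smul hf hz (hmem 0 (by omega)) (hzp _ (by omega)).symm (a * c0⁻¹) ?_
          rw [hf0, hab, smul_smul, inv_mul_cancel_right₀ hc0, zero_smul, add_zero]
        have hu1 : ∀ p, p < hi → Function.update el (2 * r - 1) z p = el p := fun p hp =>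
          Function.update_of_ne (by omega) _ _
        have hu2 : Function.update el (2 * r - 1) z (2 * r - 1) = z := Function.update_self _ _ _
        refine isWheel_or_isWhirl_of_vectors hf hr2 (el := Function.update el (2 * r - 1) z)
          ?_ ?_ hli (μ := -(b⁻¹ * a)) (neg_ne_zero.2 (mul_ne_zero (inv_ne_zero hb) ha)) ?_
          ⟨b, hb, ?_⟩
        · intro p hp q hq hpq
          simp only [mem_ofPred_eq] at hp hq
          by_cases hp' : p < hi <;> by_cases hq' : q < hi
          · rw [hu1 p hp', hu1 q hq'] at hpq; exact hinj p q hp' hq' hpq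
          · rw [hu1 p hp', show q = 2 * r - 1 by omega, hu2] at hpq; exact (hzp p hp' hpq).elim
          · rw [hu1 q hq', show p = 2 * r - 1 by omega, hu2] at hpq
            exact (hzp q hq' hpq.symm).elim
          · omega
        · ext e; constructor
          · intro he
            by_cases hez : e = z
            · exact ⟨2 * r - 1, by simp only [mem_ofPred_eq]; omega, by rw [hu2, hez]⟩
            · obtain ⟨p, hp, rfl⟩ := hin e he hez
              exact ⟨p, by simp only [mem_ofPred_eq]; omega, hu1 p hp⟩
          · rintro ⟨p, hp, rfl⟩
            simp only [mem_ofPred_eq] at hp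
            by_cases hp' : p < hi
            · rw [hu1 p hp']; exact hmem p hp'
            · rw [show p = 2 * r - 1 by omega, hu2]; exact hz
        · intro p hp
          rw [hu1 p (by omega)]
          exact h.vec p (by omega) (by omega)
        · rw [hu2, hab, smul_sub, smul_smul, mul_neg, mul_inv_cancel_left₀ hb, neg_smul, sub_neg_eq_add,
            add_comm]
      · exfalso
        obtain ⟨σ, hσ⟩ := hσvec (r - 1) (by omega)
        obtain ⟨c1, hc1, hf1⟩ := h.vec (2 * (r - 2) + 1) (by omega) (by omega)
        rw [wv_odd, show r - 2 + 1 = r - 1 by omega] at hf1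
        refine ht.not_functional hf σ (hmem (2 * (r - 2) + 1) (by omega)) (b := z)
          (fun e he he0 he1 => ?_) ?_ hz
        · obtain ⟨p, hp, rfl⟩ := hin e he he1
          obtain ⟨c, -, hc⟩ := h.vec p (by omega) hp
          rcases Nat.even_or_odd' p with ⟨k, rfl | rfl⟩
          · rw [wv_even] at hc
            rw [hc, map_smul, hσ k (by omega), if_neg (by omega), smul_zero]
          · have : k ≠ r - 2 := by rintro rfl; exact he0 rfl
            rw [wv_odd] at hc
            rw [hc, map_smul, map_sub, hσ k (by omega), hσ (k + 1) (by omega), if_neg (by omega),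
              if_neg (by omega), sub_zero, smul_zero]
        · rw [hf1, map_smul, map_sub, hσ _ (by omega), hσ _ (by omega), if_neg (by omega), if_pos rfl]
          simpa using hc1
  · obtain ⟨μ, hμ⟩ := FanCoord.last_eq_smul hu0 hind
    rcases hr with hr | hr
    · exfalso
      obtain ⟨c1, hc1, hf1⟩ := h.vec (2 * (r - 1)) (by omega) (by omega)
      rw [wv_even, hμ] at hf1
      refine ht.not_smul hf (hmem (2 * (r - 1)) (by omega)) (hmem 0 (by omega)) ?_ (c1 * μ * c0⁻¹) ?_
      · intro he
        have := hinj _ _ (by omega) (by omega) he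
        omega
      · rw [hf0, hf1, smul_smul, smul_smul, inv_mul_cancel_right₀ hc0]
    · have hr3 : 3 ≤ r := by omega
      have hzA : z ∈ posSet 0 hi el := by
        by_contra hzA
        obtain ⟨a, b, hab⟩ := h.outside_eq ht hf hr2 (Or.inr hr) hz hE hzA
        refine ht.not_smul hf hz (hmem 0 (by omega)) (fun he => hzA ⟨0, by omega, by omega, he.symm⟩)
          ((a + b * μ) * c0⁻¹) ?_
        rw [hf0, hab, hμ, smul_smul, smul_smul, inv_mul_cancel_right₀ hc0, add_smul]
      have hEA : N.E = posSet 0 hi el := by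
        refine subset_antisymm (fun e he => ?_) ?_
        · by_cases hez : e = z
          · rwa [hez]
          · obtain ⟨p, hp, rfl⟩ := hin e he hez; exact ⟨p, by omega, hp, rfl⟩
        · rintro _ ⟨p, -, hp, rfl⟩; exact hmem p hp
      obtain ⟨c1, hc1, hf1⟩ := h.vec (2 * (r - 2) + 1) (by omega) (by omega)
      rw [wv_odd, show r - 2 + 1 = r - 1 by omega, hμ] at hf1
      have hμ0 : μ ≠ 0 := by
        rintro rfl
        obtain ⟨c2, hc2, hf2⟩ := h.vec (2 * (r - 2)) (by omega) (by omega)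
        rw [wv_even] at hf2
        refine ht.not_smul hf (hmem (2 * (r - 2) + 1) (by omega)) (hmem (2 * (r - 2)) (by omega)) ?_
          (c1 * c2⁻¹) ?_
        · intro he
          have := hinj _ _ (by omega) (by omega) he
          omega
        · rw [hf1, hf2, smul_smul, inv_mul_cancel_right₀ hc2, zero_smul, sub_zero]
      refine isWheel_or_isWhirl_of_vectors hf (m := r - 1) (by omega) (el := el) ?_
        (image_lt_eq_of_posSet hEA (by omega)) (h.linearIndepOn_pred hr2 hu0) hμ0 ?_ ⟨c1, hc1, ?_⟩
      · intro p hp q hq hpq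
        simp only [mem_ofPred_eq] at hp hq
        exact hinj p q (by omega) (by omega) hpq
      · intro p hp
        exact h.vec p (by omega) (by omega)
      · rw [show 2 * (r - 1) - 1 = 2 * (r - 2) + 1 by omega, hf1,
          show r - 1 - 1 = r - 2 by omega]

theorem PosFan.isWheel_or_isWhirl_of_rim_ends (hpos : N.PosFan 1 hi el)
    (h : FanCoord K N f 1 hi r el u g) (ht : N.Tame) (hf : N.IsRepresentedBy K f)
    (hlen : 4 ≤ hi) (hr : hi = 2 * r - 2)
    {z : α} (hz : z ∈ N.E) (hE : N.E \ posSet 1 hi el ⊆ {z}) :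
    N.IsWheel ∨ N.IsWhirl := by
  have hr3 : 3 ≤ r := by omega
  have hmem : ∀ p, 1 ≤ p → p < hi → el p ∈ N.E := fun p hp => hpos.mem_ground (by omega) hp
  have hin : ∀ e ∈ N.E, e ≠ z → ∃ p, 1 ≤ p ∧ p < hi ∧ el p = e := by
    intro e he hez
    by_contra hcon
    push Not at hcon
    refine hez (hE ⟨he, ?_⟩)
    rintro ⟨p, h0, h1, h2⟩
    exact hcon p h0 h1 h2
  obtain ⟨c0, hc0, hf0⟩ := h.vec (2 * 0 + 1) (by omega) (by omega)
  rw [wv_odd] at hf0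
  have hu0 : u 0 ≠ 0 := by
    intro h0
    obtain ⟨c1, hc1, hf1⟩ := h.vec (2 * 1) (by omega) (by omega)
    rw [wv_even] at hf1
    refine ht.not_smul hf (hmem (2 * 0 + 1) (by omega) (by omega)) (hmem (2 * 1) (by omega) (by omega))
      (hpos.ne (by omega) (by omega) (by omega)) (-(c0 * c1⁻¹)) ?_
    rw [hf1, hf0, h0, smul_smul, neg_mul, inv_mul_cancel_right₀ hc1]
    module
  -- a functional that vanishes on all the interior rim vertices is supported by the two end
  -- elements of the fan and `z`
  have hvan : ∀ σ : V →ₗ[K] K, (∀ k, 1 ≤ k → k + 1 < r → σ (u k) = 0) → ∀ e ∈ N.E, e ≠ z →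
      e ≠ el 1 → e ≠ el (2 * (r - 2) + 1) → σ (f e) = 0 := by
    intro σ hσ e he hez he1 he2
    obtain ⟨p, hp0, hp, rfl⟩ := hin e he hez
    obtain ⟨c, -, hc⟩ := h.vec p hp0 hp
    rcases Nat.even_or_odd' p with ⟨k, rfl | rfl⟩
    · rw [wv_even] at hc
      rw [hc, map_smul, hσ k (by omega) (by omega), smul_zero]
    · have hk : k ≠ r - 2 := by rintro rfl; exact he2 rfl
      have hk0 : k ≠ 0 := by rintro rfl; exact he1 rfl
      rw [wv_odd] at hc
      rw [hc, map_smul, map_sub, hσ k (by omega) (by omega), hσ (k + 1) (by omega) (by omega),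
        sub_zero, smul_zero]
  obtain ⟨c1, hc1, hf1⟩ := h.vec (2 * (r - 2) + 1) (by omega) (by omega)
  rw [wv_odd, show r - 2 + 1 = r - 1 by omega] at hf1
  by_cases hind : ∀ a b : K, a • u 0 + b • u (r - 1) = 0 → a = 0 ∧ b = 0
  · exfalso
    have hli := h.linearIndepOn (by omega) hind
    obtain ⟨σ, hσ⟩ := exists_functional_of_linearIndepOn hli (fun k => if k = 0 then 1 else 0)
    have hσ' : ∀ k, k < r → σ (u k) = if k = 0 then 1 else 0 := fun k hk => hσ k hk
    have hv := hvan σ fun k hk hk' => by rw [hσ' k (by omega), if_neg (by omega)]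
    refine ht.not_functional hf σ (hmem 1 (by omega) (by omega)) (b := z) (fun e he he1 hez => ?_)
      ?_ hz
    · by_cases he2 : e = el (2 * (r - 2) + 1)
      · rw [he2, hf1, map_smul, map_sub, hσ' _ (by omega), hσ' _ (by omega), if_neg (by omega),
          if_neg (by omega), sub_zero, smul_zero]
      · exact hv e he hez he1 he2
    · change σ (f (el (2 * 0 + 1))) ≠ 0
      rw [hf0, map_smul, map_sub, hσ' _ (by omega), hσ' _ (by omega), if_pos rfl,
        if_neg (by omega), sub_zero, smul_eq_mul, mul_one]
      exact hc0
  · obtain ⟨μ, hμ⟩ := FanCoord.last_eq_smul hu0 hind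
    have hli := h.linearIndepOn_pred (by omega) hu0
    obtain ⟨σ, hσ⟩ := exists_functional_of_linearIndepOn hli (fun k => if k = 0 then 1 else 0)
    have hσ' : ∀ k, k + 1 < r → σ (u k) = if k = 0 then 1 else 0 := fun k hk =>
      hσ k (show k < r - 1 by omega)
    have hzA : z ∉ posSet 1 hi el := by
      intro hzA
      have hv := hvan σ fun k hk hk' => by rw [hσ' k (by omega), if_neg (by omega)]
      refine ht.not_functional hf σ (hmem 1 (by omega) (by omega)) (b := el (2 * (r - 2) + 1))
        (fun e he he1 he2 => ?_) ?_ (hmem _ (by omega) (by omega))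
      · by_cases hez : e = z
        · obtain ⟨p, hp0, hp, rfl⟩ := hzA
          obtain ⟨c, -, hc⟩ := h.vec p hp0 hp
          subst hez
          rcases Nat.even_or_odd' p with ⟨k, rfl | rfl⟩
          · rw [wv_even] at hc
            rw [hc, map_smul, hσ' k (by omega), if_neg (by omega), smul_zero]
          · have hk : k ≠ r - 2 := by rintro rfl; exact he2 rfl
            have hk0 : k ≠ 0 := by rintro rfl; exact he1 rfl
            rw [wv_odd] at hc
            rw [hc, map_smul, map_sub, hσ' k (by omega), hσ' (k + 1) (by omega), if_neg hk0,
              if_neg (by omega), sub_zero, smul_zero]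
        · exact hv e he hez he1 he2
      · change σ (f (el (2 * 0 + 1))) ≠ 0
        rw [hf0, map_smul, map_sub, hσ' _ (by omega), hσ' _ (by omega), if_pos rfl,
          if_neg (by omega), sub_zero, smul_eq_mul, mul_one]
        exact hc0
    have hzp : ∀ p, 1 ≤ p → p < hi → el p ≠ z := fun p h1 hp hpz => hzA ⟨p, h1, hp, hpz⟩
    obtain ⟨a, b, hab⟩ := h.outside_eq ht hf (by omega) (Or.inr hr) hz hE hzA
    rw [hμ, smul_smul, ← add_smul] at hab
    have hab0 : a + b * μ ≠ 0 := by
      intro h0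
      exact ht.ne_zero hf hz (by rw [hab, h0, zero_smul])
    have hμ0 : μ ≠ 0 := by
      rintro rfl
      obtain ⟨c2, hc2, hf2⟩ := h.vec (2 * (r - 2)) (by omega) (by omega)
      rw [wv_even] at hf2
      refine ht.not_smul hf (hmem (2 * (r - 2) + 1) (by omega) (by omega))
        (hmem (2 * (r - 2)) (by omega) (by omega))
        (hpos.ne (by omega) (by omega) (by omega)).symm (c1 * c2⁻¹) ?_
      rw [hf1, hf2, smul_smul, inv_mul_cancel_right₀ hc2, hμ, zero_smul, sub_zero]
    have hu1 : ∀ p, p ≠ 0 → Function.update el 0 z p = el p := fun p hp =>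
      Function.update_of_ne hp _ _
    have hu2 : Function.update el 0 z 0 = z := Function.update_self _ _ _
    refine isWheel_or_isWhirl_of_vectors hf (m := r - 1) (by omega) (el := Function.update el 0 z)
      ?_ ?_ hli hμ0 ?_ ⟨c1, hc1, ?_⟩
    · intro p hp q hq hpq
      simp only [mem_ofPred_eq] at hp hq
      by_cases hp' : p = 0 <;> by_cases hq' : q = 0
      · omega
      · rw [hu1 q hq', hp', hu2] at hpq; exact (hzp q (by omega) (by omega) hpq.symm).elim
      · rw [hu1 p hp', hq', hu2] at hpq; exact (hzp p (by omega) (by omega) hpq).elim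
      · rw [hu1 p hp', hu1 q hq'] at hpq
        exact hpos.inj p q (by omega) (by omega) (by omega) (by omega) hpq
    · ext e; constructor
      · intro he
        by_cases hez : e = z
        · exact ⟨0, by simp only [mem_ofPred_eq]; omega, by rw [hu2, hez]⟩
        · obtain ⟨p, hp0, hp, rfl⟩ := hin e he hez
          exact ⟨p, by simp only [mem_ofPred_eq]; omega, hu1 p (by omega)⟩
      · rintro ⟨p, hp, rfl⟩
        simp only [mem_ofPred_eq] at hp
        by_cases hp' : p = 0
        · rw [hp', hu2]; exact hz
        · rw [hu1 p hp']; exact hmem p (by omega) (by omega)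
    · intro p hp
      by_cases hp' : p = 0
      · subst hp'
        rw [hu2, show wv u 0 = u 0 from wv_even u 0]
        exact ⟨_, hab0, hab⟩
      · rw [hu1 p hp']
        exact h.vec p (by omega) (by omega)
    · rw [hu1 _ (by omega), show 2 * (r - 1) - 1 = 2 * (r - 2) + 1 by omega, hf1,
        show r - 1 - 1 = r - 2 by omega, hμ]

/-- A 3-connected represented matroid with a fan that misses at most one element is a wheel or a
whirl. -/
theorem PosFan.two_le_encard_compl (hpos : N.PosFan lo hi el) (ht : N.Tame)
    (hf : N.IsRepresentedBy K f) (hlo : lo ≤ 1) (hlen : lo + 3 ≤ hi)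
    (hwheel : ¬ N.IsWheel) (hwhirl : ¬ N.IsWhirl) : 2 ≤ (N.E \ posSet lo hi el).encard := by
  by_contra hcon
  have hle : (N.E \ posSet lo hi el).encard ≤ 1 := Order.le_of_lt_add_one (not_le.1 hcon)
  have hE1 : el lo ∈ N.E := hpos.mem_ground hlen le_rfl (by omega)
  obtain ⟨z, hz, hE⟩ : ∃ z ∈ N.E, N.E \ posSet lo hi el ⊆ {z} := by
    rcases encard_le_one_iff_eq.1 hle with h0 | ⟨z, hz⟩
    · exact ⟨el lo, hE1, by rw [h0]; exact empty_subset _⟩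
    · exact ⟨z, (hz.symm.subset rfl).1, hz.subset⟩
  set r := (hi + 2) / 2 with hr
  have hr' : hi = 2 * r - 1 ∨ hi = 2 * r - 2 := by omega
  obtain ⟨u, g, h⟩ := exists_fanCoord ht hf hpos hlo hlen hr' (by omega)
  suffices N.IsWheel ∨ N.IsWhirl from this.elim hwheel hwhirl
  by_cases hlo0 : lo = 0
  · subst hlo0
    exact hpos.isWheel_or_isWhirl_of_first_spoke h ht hf (by omega) hr' hz hE
  have hlo1 : lo = 1 := by omega
  by_cases hhi : hi = 2 * r - 1
  · have hrev := h.reverse (by omega) hlen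
    have hprev := hpos.reverse (r := r)
    have hset : posSet (2 * r - 1 - hi) (2 * r - 1 - lo) (fun p => el (2 * r - 2 - p)) =
      posSet lo hi el := posSet_reverse (by omega)
    rw [← hset] at hE
    rw [show 2 * r - 1 - hi = 0 by omega] at hrev hprev hE
    exact hprev.isWheel_or_isWhirl_of_first_spoke hrev ht hf (by omega) (by omega) hz hE
  · subst hlo1
    exact hpos.isWheel_or_isWhirl_of_rim_ends h ht hf (by omega) (by omega) hz hE

end LargeFan

/-! ### Generalized parallel connections of vector matroids -/

section VectorFlats

variable {K V α : Type*} [Field K] [AddCommGroup V] [Module K V] {g : α → V} {E E₁ E₂ F T X : Set α}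

theorem vectorMatroid_mem_closure_iff (hX : X ⊆ E) {e : α} (he : e ∈ E) :
    e ∈ (vectorMatroid K g E).closure X ↔ g e ∈ Submodule.span K (g '' X) :=
  (vectorMatroid_isRepresentedBy g E).mem_closure_iff hX he

theorem vectorMatroid_isFlat_iff : (vectorMatroid K g E).IsFlat F ↔
    F ⊆ E ∧ ∀ e ∈ E, g e ∈ Submodule.span K (g '' F) → e ∈ F := by
  rw [isFlat_iff_closure_eq]
  constructor
  · intro h
    have hF : F ⊆ E := h ▸ closure_subset_ground _ _
    refine ⟨hF, fun e he hes => ?_⟩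
    rw [← h]
    exact (vectorMatroid_mem_closure_iff hF he).2 hes
  · rintro ⟨hF, h⟩
    refine subset_antisymm (fun e he => ?_) (subset_closure _ _ hF)
    have heE : e ∈ E := mem_ground_of_mem_closure he
    exact h e heE ((vectorMatroid_mem_closure_iff hF heE).1 he)

theorem vectorMatroid_isCircuit_pair_iff {x y : α} (hx : x ∈ E) (hy : y ∈ E) (hxy : x ≠ y) :
    (vectorMatroid K g E).IsCircuit {x, y} ↔ g y ≠ 0 ∧ ∃ c : K, c ≠ 0 ∧ g x = c • g y := by
  set M := vectorMatroid K g E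
  have hM : M.IsRepresentedBy K g := vectorMatroid_isRepresentedBy g E
  have hsing : ∀ z ∈ E, M.Indep {z} ↔ g z ≠ 0 := fun z hz => by
    rw [vectorMatroid_indep_iff, and_iff_right (singleton_subset_iff.2 hz)]
    exact linearIndepOn_singleton_iff K
  constructor
  · intro h
    have hx1 : M.Indep {x} := by
      have := h.sdiff_singleton_indep (show y ∈ _ by simp)
      rwa [show ({x, y} : Set α) \ {y} = {x} by grind] at this
    have hy1 : M.Indep {y} := by
      have := h.sdiff_singleton_indep (show x ∈ _ by simp)
      rwa [show ({x, y} : Set α) \ {x} = {y} by grind] at this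
    have hcl := h.mem_closure_sdiff_singleton_of_mem (show x ∈ _ by simp)
    rw [show ({x, y} : Set α) \ {x} = {y} by grind,
      vectorMatroid_mem_closure_iff (singleton_subset_iff.2 hy) hx, image_singleton,
      Submodule.mem_span_singleton] at hcl
    obtain ⟨c, hc⟩ := hcl
    refine ⟨(hsing y hy).1 hy1, c, ?_, hc.symm⟩
    rintro rfl
    exact (hsing x hx).1 hx1 (by rw [← hc, zero_smul])
  · rintro ⟨h0, c, hc0, hc⟩
    have hx0 : g x ≠ 0 := hc ▸ smul_ne_zero hc0 h0
    rw [isCircuit_iff_forall_ssubset]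
    refine ⟨⟨fun hi => ?_, by rintro z (rfl | rfl) <;> assumption⟩, fun I hI => ?_⟩
    · refine hi.notMem_closure_sdiff_of_mem (show x ∈ _ by simp) ?_
      exact hM.cyc_pair_of_smul hx hy hxy hc0 hc x (by simp)
    · rcases subset_pair_iff_eq.1 hI.subset with rfl | rfl | rfl | rfl
      · exact M.empty_indep
      · exact (hsing x hx).2 hx0
      · exact (hsing y hy).2 h0
      · exact (hI.ne rfl).elim

/-- A generalized parallel connection of vector matroids that lie in the same space: the spans of
the two ground sets meet in the span of the common part `T`, and in the second matroid the span of
each flat meets the span of `T` in the span of a part of `T`. -/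
theorem isGenParallelConnection_vectorMatroid (hT : E₁ ∩ E₂ = T) (hfin : E₂.Finite)
    (hspan : Submodule.span K (g '' E₁) ⊓ Submodule.span K (g '' E₂) ≤ Submodule.span K (g '' T))
    (hmod : ∀ F, (vectorMatroid K g E₂).IsFlat F →
      Submodule.span K (g '' F) ⊓ Submodule.span K (g '' T) ≤ Submodule.span K (g '' (F ∩ T)))
    (hcl : ∀ x ∈ (vectorMatroid K g E₂).closure T \ T, (vectorMatroid K g E₂).IsLoop x ∨
      ∃ y ∈ T, (vectorMatroid K g E₂).IsCircuit {x, y}) :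
    (vectorMatroid K g E₁).IsGenParallelConnection (vectorMatroid K g E₂) T
      (vectorMatroid K g (E₁ ∪ E₂)) := by
  have hT1 : T ⊆ E₁ := hT ▸ inter_subset_left
  have hT2 : T ⊆ E₂ := hT ▸ inter_subset_right
  refine ⟨hT, ?_, ⟨isFlat_closure _, fun G hG => ?_⟩, hcl, rfl, fun F => ?_⟩
  · refine ext_indep rfl fun I hI => ?_
    have hI' : I ⊆ T := hI
    rw [restrict_indep_iff, restrict_indep_iff, vectorMatroid_indep_iff, vectorMatroid_indep_iff]
    simp [hI', hI'.trans hT1, hI'.trans hT2]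
  · have hM := vectorMatroid_isRepresentedBy (K := K) g E₂
    set M := vectorMatroid K g E₂
    have hGE : G ⊆ M.E := hG.subset_ground
    have hCE : M.closure T ⊆ M.E := M.closure_subset_ground T
    have hfin' : ∀ X ⊆ M.E, X.Finite := fun X hX => hfin.subset hX
    have hspT : Submodule.span K (g '' M.closure T) = Submodule.span K (g '' T) := by
      refine le_antisymm (Submodule.span_le.2 ?_)
        (Submodule.span_mono (image_mono (M.subset_closure T hT2)))
      rintro _ ⟨e, he, rfl⟩
      exact (vectorMatroid_mem_closure_iff hT2 (hCE he)).1 he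
    have hinf : Submodule.span K (g '' (M.closure T ∩ G)) =
        Submodule.span K (g '' M.closure T) ⊓ Submodule.span K (g '' G) := by
      refine le_antisymm (le_inf (Submodule.span_mono (image_mono inter_subset_left))
        (Submodule.span_mono (image_mono inter_subset_right))) ?_
      rw [hspT, inf_comm]
      refine (hmod G hG).trans (Submodule.span_mono (image_mono ?_))
      rw [inter_comm]
      exact inter_subset_inter_left _ (M.subset_closure T hT2)
    rw [hM.eRk_eq_finrank hCE (hfin' _ hCE), hM.eRk_eq_finrank hGE (hfin' _ hGE),
      hM.eRk_eq_finrank (inter_subset_left.trans hCE) (hfin' _ (inter_subset_left.trans hCE)),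
      hM.eRk_eq_finrank (union_subset hCE hGE) (hfin' _ (union_subset hCE hGE)), hinf, image_union,
      Submodule.span_union]
    have : FiniteDimensional K (Submodule.span K (g '' M.closure T)) :=
      FiniteDimensional.span_of_finite K ((hfin' _ hCE).image g)
    have : FiniteDimensional K (Submodule.span K (g '' G)) :=
      FiniteDimensional.span_of_finite K ((hfin' _ hGE).image g)
    have := Submodule.finrank_sup_add_finrank_inf_eq (Submodule.span K (g '' M.closure T))
      (Submodule.span K (g '' G))
    rw [add_comm] at this
    exact_mod_cast this.symm
  · simp only [vectorMatroid_ground]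
    have hmod' : ∀ F ⊆ E₂, (∀ e ∈ E₂, g e ∈ Submodule.span K (g '' F) → e ∈ F) → ∀ x,
        x ∈ Submodule.span K (g '' F) → x ∈ Submodule.span K (g '' T) →
        x ∈ Submodule.span K (g '' (F ∩ T)) := fun F hF h x h1 h2 =>
      hmod F (vectorMatroid_isFlat_iff.2 ⟨hF, h⟩) ⟨h1, h2⟩
    rw [vectorMatroid_isFlat_iff, vectorMatroid_isFlat_iff, vectorMatroid_isFlat_iff]
    constructor
    · rintro ⟨hF, h⟩
      refine ⟨hF, ⟨inter_subset_right, fun e he hes => ⟨h e (.inl he) ?_, he⟩⟩,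
        ⟨inter_subset_right, fun e he hes => ⟨h e (.inr he) ?_, he⟩⟩⟩ <;>
      exact Submodule.span_mono (image_mono inter_subset_left) hes
    · rintro ⟨hF, ⟨-, h1⟩, ⟨-, h2⟩⟩
      refine ⟨hF, fun e he hes => ?_⟩
      have hsplit : Submodule.span K (g '' F) =
          Submodule.span K (g '' (F ∩ E₁)) ⊔ Submodule.span K (g '' (F ∩ E₂)) := by
        rw [← Submodule.span_union, ← image_union, ← inter_union_distrib_left,
          inter_eq_self_of_subset_left hF]
      rw [hsplit, Submodule.mem_sup] at hes
      obtain ⟨x₁, hx₁, x₂, hx₂, hxe⟩ := hes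
      have hx₁E : x₁ ∈ Submodule.span K (g '' E₁) :=
        Submodule.span_mono (image_mono inter_subset_right) hx₁
      have hx₂E : x₂ ∈ Submodule.span K (g '' E₂) :=
        Submodule.span_mono (image_mono inter_subset_right) hx₂
      have hT12 : F ∩ E₂ ∩ T ⊆ F ∩ E₁ := fun y hy => ⟨hy.1.1, hT1 hy.2⟩
      rcases he with he | he
      · have hx₂T : x₂ ∈ Submodule.span K (g '' T) := by
          refine hspan ⟨?_, hx₂E⟩
          rw [show x₂ = g e - x₁ by rw [← hxe]; abel]
          exact Submodule.sub_mem _ (Submodule.subset_span ⟨e, he, rfl⟩) hx₁E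
        have := hmod' _ inter_subset_right h2 x₂ hx₂ hx₂T
        refine (h1 e he ?_).1
        rw [← hxe]
        exact Submodule.add_mem _ hx₁ (Submodule.span_mono (image_mono hT12) this)
      · have hx₁T : x₁ ∈ Submodule.span K (g '' T) := by
          refine hspan ⟨hx₁E, ?_⟩
          rw [show x₁ = g e - x₂ by rw [← hxe]; abel]
          exact Submodule.sub_mem _ (Submodule.subset_span ⟨e, he, rfl⟩) hx₂E
        -- the flat of the second matroid spanned by `F ∩ E₂` and `x₁` meets `T` in the same
        -- elements as `F`, since their vectors are spanned by `F ∩ E₁`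
        set Z := Submodule.span K (g '' (F ∩ E₂)) ⊔ Submodule.span K {x₁} with hZ
        set F' := {y | y ∈ E₂ ∧ g y ∈ Z} with hF'
        have hF'Z : Submodule.span K (g '' F') ≤ Z := by
          refine Submodule.span_le.2 ?_
          rintro _ ⟨y, hy, rfl⟩
          exact hy.2
        have hFF' : F ∩ E₂ ⊆ F' := fun y hy =>
          ⟨hy.2, Submodule.mem_sup_left (Submodule.subset_span ⟨y, hy, rfl⟩)⟩
        have heF' : e ∈ F' := by
          refine ⟨he, ?_⟩
          rw [← hxe, add_comm]
          exact Submodule.add_mem_sup hx₂ (Submodule.mem_span_singleton_self x₁)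
        have hx₁F' : x₁ ∈ Submodule.span K (g '' F') := by
          rw [show x₁ = g e - x₂ by rw [← hxe]; abel]
          exact Submodule.sub_mem _ (Submodule.subset_span ⟨e, heF', rfl⟩)
            (Submodule.span_mono (image_mono hFF') hx₂)
        have hx₁F'T := hmod' F' (fun y hy => hy.1) (fun y hy hys => ⟨hy, hF'Z hys⟩) x₁ hx₁F' hx₁T
        have hsub : F' ∩ T ⊆ F ∩ E₂ := by
          rintro y ⟨⟨hyE, hyZ⟩, hyT⟩
          obtain ⟨z, hz, z', hz', hzy⟩ := Submodule.mem_sup.1 hyZ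
          obtain ⟨c, rfl⟩ := Submodule.mem_span_singleton.1 hz'
          have hzT : z ∈ Submodule.span K (g '' T) := by
            rw [show z = g y - c • x₁ by rw [← hzy]; abel]
            exact Submodule.sub_mem _ (Submodule.subset_span ⟨y, hyT, rfl⟩)
              (Submodule.smul_mem _ _ hx₁T)
          have hz1 := Submodule.span_mono (image_mono hT12)
            (hmod' _ inter_subset_right h2 z hz hzT)
          refine ⟨(h1 y (hT1 hyT) ?_).1, hyE⟩
          rw [← hzy]
          exact Submodule.add_mem _ hz1 (Submodule.smul_mem _ _ hx₁)
        refine (h2 e he ?_).1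
        rw [← hxe]
        exact Submodule.add_mem _ (Submodule.span_mono (image_mono hsub) hx₁F'T) hx₂

end VectorFlats

/-! ### The triangle of a wheel along which it is glued -/

section WheelTriangle

variable {K V : Type*} [Field K] [AddCommGroup V] [Module K V] {R : ℕ} {vec : ℕ → V}
  {b : Option ℕ → V} {S : Set ℕ}

/-- The positions of the triangle along which a wheel is glued to another matroid. -/
def wheelTriangle (R : ℕ) : Set ℕ := {0, 2 * R - 1, 2 * R - 2}

theorem none_mem_wheelVerts : none ∈ wheelVerts R := fun k hk => by simp at hk

theorem some_mem_wheelVerts {k : ℕ} (hk : k < R) : some k ∈ wheelVerts R := fun l hl => by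
  simp only [Option.mem_def, Option.some.injEq] at hl
  omega

/-- The span of a flat of a wheel meets the span of the triangle in the span of a part of the
triangle. -/
theorem WheelRep.span_inf_le (h : WheelRep K R vec b) (hR : 2 ≤ R) (hS : S ⊆ {p | p < 2 * R})
    (hflat : ∀ p, p < 2 * R → vec p ∈ Submodule.span K (vec '' S) → p ∈ S) :
    Submodule.span K (vec '' S) ⊓ Submodule.span K (vec '' wheelTriangle R) ≤
      Submodule.span K (vec '' (S ∩ wheelTriangle R)) := by
  have hmem : ∀ p, p < 2 * R → (p ∈ S ↔ WheelConn R S (wheelSrc p) (wheelTgt R p)) := by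
    intro p hp
    rw [← h.vec_mem_span_iff hS hp]
    exact ⟨fun hpS => Submodule.subset_span ⟨p, hpS, rfl⟩, hflat p hp⟩
  have hs0 : wheelSrc 0 = some 0 := rfl
  have ht0 : wheelTgt R 0 = none := rfl
  have hs1 : wheelSrc (2 * R - 2) = some (R - 1) := by rw [wheelSrc]; congr 1; omega
  have ht1 : wheelTgt R (2 * R - 2) = none := if_pos ⟨R - 1, by omega⟩
  have hs2 : wheelSrc (2 * R - 1) = some (R - 1) := by rw [wheelSrc]; congr 1; omega
  have ht2 : wheelTgt R (2 * R - 1) = some 0 := by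
    rw [wheelTgt, if_neg (by rw [Nat.not_even_iff_odd]; exact ⟨R - 1, by omega⟩),
      show (2 * R - 1) / 2 + 1 = R by omega, Nat.mod_self]
  have hm0 := hmem 0 (by omega)
  have hm1 := hmem (2 * R - 2) (by omega)
  have hm2 := hmem (2 * R - 1) (by omega)
  obtain ⟨c0, hc0, hv0⟩ := h.vec 0 (by omega)
  obtain ⟨c1, hc1, hv1⟩ := h.vec (2 * R - 2) (by omega)
  obtain ⟨c2, hc2, hv2⟩ := h.vec (2 * R - 1) (by omega)
  rw [hs0, ht0] at hm0 hv0
  rw [hs1, ht1] at hm1 hv1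
  rw [hs2, ht2] at hm2 hv2
  set x0 := b (some 0) - b none with hx0
  set x1 := b (some (R - 1)) - b none with hx1
  have hv2' : vec (2 * R - 1) = c2 • (x1 - x0) := by rw [hv2, hx0, hx1]; congr 1; abel
  have hin : ∀ p, p ∈ S → p ∈ wheelTriangle R → ∀ (c : K) (y : V), c ≠ 0 → vec p = c • y →
      y ∈ Submodule.span K (vec '' (S ∩ wheelTriangle R)) := by
    intro p hp hpT c y hc hy
    rw [← Submodule.smul_mem_iff _ hc, ← hy]
    exact Submodule.subset_span ⟨p, ⟨hp, hpT⟩, rfl⟩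
  have hT0 : 0 ∈ wheelTriangle R := by simp [wheelTriangle]
  have hT1 : 2 * R - 2 ∈ wheelTriangle R := by simp [wheelTriangle]
  have hT2 : 2 * R - 1 ∈ wheelTriangle R := by simp [wheelTriangle]
  rintro x ⟨hxS, hxT⟩
  obtain ⟨α, β, rfl⟩ : ∃ α β : K, x = α • x0 + β • x1 := by
    have : Submodule.span K (vec '' wheelTriangle R) ≤ Submodule.span K {x0, x1} := by
      refine Submodule.span_le.2 ?_
      rintro _ ⟨p, rfl | rfl | rfl, rfl⟩
      · exact Submodule.mem_span_pair.2 ⟨c0, 0, by rw [hv0]; module⟩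
      · exact Submodule.mem_span_pair.2 ⟨-c2, c2, by rw [hv2']; module⟩
      · exact Submodule.mem_span_pair.2 ⟨0, c1, by rw [hv1]; module⟩
    obtain ⟨α, β, hαβ⟩ := Submodule.mem_span_pair.1 (this hxT)
    exact ⟨α, β, hαβ.symm⟩
  have hn := none_mem_wheelVerts (R := R)
  have hn0 := some_mem_wheelVerts (R := R) (show 0 < R by omega)
  have hn1 := some_mem_wheelVerts (R := R) (show R - 1 < R by omega)
  have hfun : ∀ z, ∃ θ : V →ₗ[K] K, (θ (α • x0 + β • x1) = 0) ∧ (θ x0 =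
        {x | WheelConn R S z x}.indicator 1 (some 0) - {x | WheelConn R S z x}.indicator 1 none) ∧
      (θ x1 = {x | WheelConn R S z x}.indicator 1 (some (R - 1)) -
        {x | WheelConn R S z x}.indicator 1 none) := fun z => by
    obtain ⟨θ, hker, hθ⟩ := h.exists_functional hS z
    exact ⟨θ, hker _ hxS, hθ _ hn0 _ hn, hθ _ hn1 _ hn⟩
  have hrefl : ∀ z, z ∈ {x | WheelConn R S z x} := fun z => .refl _
  by_cases hS0 : 0 ∈ S <;> by_cases hS1 : 2 * R - 2 ∈ S
  · exact Submodule.add_mem _ (Submodule.smul_mem _ _ (hin _ hS0 hT0 _ _ hc0 hv0))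
      (Submodule.smul_mem _ _ (hin _ hS1 hT1 _ _ hc1 hv1))
  · obtain ⟨θ, h1, h2, h3⟩ := hfun (some (R - 1))
    have hno : none ∉ {x | WheelConn R S (some (R - 1)) x} := fun hc => hS1 (hm1.2 hc)
    have hno' : some 0 ∉ {x | WheelConn R S (some (R - 1)) x} := fun hc =>
      hS1 (hm1.2 (hc.trans _ _ _ (hm0.1 hS0)))
    rw [indicator_of_notMem hno, indicator_of_notMem hno'] at h2
    rw [indicator_of_mem (hrefl _), indicator_of_notMem hno] at h3
    rw [map_add, map_smul, map_smul, h2, h3] at h1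
    have hβ : β = 0 := by simpa using h1
    rw [hβ, zero_smul, add_zero]
    exact Submodule.smul_mem _ _ (hin _ hS0 hT0 _ _ hc0 hv0)
  · obtain ⟨θ, h1, h2, h3⟩ := hfun (some 0)
    have hno : none ∉ {x | WheelConn R S (some 0) x} := fun hc => hS0 (hm0.2 hc)
    have hno' : some (R - 1) ∉ {x | WheelConn R S (some 0) x} := fun hc =>
      hS0 (hm0.2 (hc.trans _ _ _ (hm1.1 hS1)))
    rw [indicator_of_notMem hno, indicator_of_notMem hno'] at h3
    rw [indicator_of_mem (hrefl _), indicator_of_notMem hno] at h2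
    rw [map_add, map_smul, map_smul, h2, h3] at h1
    have hα : α = 0 := by simpa using h1
    rw [hα, zero_smul, zero_add]
    exact Submodule.smul_mem _ _ (hin _ hS1 hT1 _ _ hc1 hv1)
  · obtain ⟨θ, h1, h2, h3⟩ := hfun none
    have hno : some 0 ∉ {x | WheelConn R S none x} := fun hc => hS0 (hm0.2 (hc.symm _ _))
    have hno' : some (R - 1) ∉ {x | WheelConn R S none x} := fun hc => hS1 (hm1.2 (hc.symm _ _))
    rw [indicator_of_notMem hno, indicator_of_mem (hrefl _)] at h2
    rw [indicator_of_notMem hno', indicator_of_mem (hrefl _)] at h3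
    rw [map_add, map_smul, map_smul, h2, h3] at h1
    have hα : α = -β := by
      simp only [Pi.one_apply, zero_sub, smul_eq_mul, mul_neg, mul_one] at h1
      linear_combination -h1
    have hx : α • x0 + β • x1 = β • (x1 - x0) := by rw [hα]; module
    by_cases hS2 : 2 * R - 1 ∈ S
    · rw [hx]
      exact Submodule.smul_mem _ _ (hin _ hS2 hT2 _ _ hc2 hv2')
    · obtain ⟨θ, h1, h2, h3⟩ := hfun (some 0)
      have hno : none ∉ {x | WheelConn R S (some 0) x} := fun hc => hS0 (hm0.2 hc)
      have hno' : some (R - 1) ∉ {x | WheelConn R S (some 0) x} := fun hc =>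
        hS2 (hm2.2 (hc.symm _ _))
      rw [indicator_of_notMem hno, indicator_of_notMem hno'] at h3
      rw [indicator_of_mem (hrefl _), indicator_of_notMem hno] at h2
      rw [map_add, map_smul, map_smul, h2, h3] at h1
      have hα' : α = 0 := by simpa using h1
      have hβ : β = 0 := by rw [hα', eq_comm, neg_eq_zero] at hα; exact hα
      rw [hx, hβ, zero_smul]
      exact Submodule.zero_mem _

/-- Only in the wheel of rank two there is an element in the span of the triangle but not in the
triangle: its rim elements are parallel. -/
theorem WheelRep.eq_of_mem_span_triangle (h : WheelRep K R vec b) (hR : 2 ≤ R) {p : ℕ}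
    (hp : p < 2 * R) (hpT : p ∉ wheelTriangle R)
    (hmem : vec p ∈ Submodule.span K (vec '' wheelTriangle R)) :
    R = 2 ∧ p = 1 ∧ ∃ c : K, c ≠ 0 ∧ vec 1 = c • vec 3 := by
  have hTs : wheelTriangle R ⊆ {p | p < 2 * R} := by
    rintro _ (rfl | rfl | rfl) <;> simp only [mem_ofPred_eq] <;> omega
  rw [h.vec_mem_span_iff hTs hp] at hmem
  have key : ∀ x y, WheelConn R (wheelTriangle R) x y → x = y ∨
      ((x = none ∨ x = some 0 ∨ x = some (R - 1)) ∧ (y = none ∨ y = some 0 ∨ y = some (R - 1))) := by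
    intro x y hxy
    induction hxy with
    | rel x y hxy =>
      right
      obtain ⟨p, rfl | rfl | rfl, rfl, rfl⟩ := hxy
      · exact ⟨by right; left; rfl, by left; rfl⟩
      · refine ⟨(by right; right; rw [wheelSrc]; congr 1; omega), Or.inr (Or.inl ?_)⟩
        rw [wheelTgt, if_neg (by rw [Nat.not_even_iff_odd]; exact ⟨R - 1, by omega⟩),
          show (2 * R - 1) / 2 + 1 = R by omega, Nat.mod_self]
      · exact ⟨(by right; right; rw [wheelSrc]; congr 1; omega), by left; exact if_pos ⟨R - 1, by omega⟩⟩
    | refl => exact .inl rfl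
    | symm x y _ ih => exact ih.imp Eq.symm And.symm
    | trans x y z _ _ ih1 ih2 =>
      rcases ih1 with rfl | ih1
      · exact ih2
      · rcases ih2 with rfl | ih2
        · exact .inr ih1
        · exact .inr ⟨ih1.1, ih2.2⟩
  simp only [wheelTriangle, mem_insert_iff, mem_singleton_iff, not_or] at hpT
  have hk := key _ _ hmem
  rcases Nat.even_or_odd' p with ⟨k, rfl | rfl⟩
  · rw [show wheelSrc (2 * k) = some k by rw [wheelSrc]; congr 1; omega,
      show wheelTgt R (2 * k) = none from if_pos (by simp)] at hk
    simp only [reduceCtorEq, Option.some.injEq, false_or, true_or, and_true] at hk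
    omega
  · rw [show wheelSrc (2 * k + 1) = some k by rw [wheelSrc]; congr 1; omega,
      show wheelTgt R (2 * k + 1) = some ((k + 1) % R) by
        rw [wheelTgt, if_neg (by simp)]; congr 2; omega] at hk
    simp only [reduceCtorEq, Option.some.injEq, false_or] at hk
    by_cases hkR : k = R - 1
    · omega
    rw [Nat.mod_eq_of_lt (by omega)] at hk
    have hR2 : R = 2 := by omega
    subst hR2
    have hk0 : k = 0 := by omega
    subst hk0
    refine ⟨rfl, rfl, ?_⟩
    obtain ⟨c, hc, hc'⟩ := h.vec 1 (by omega)
    obtain ⟨d, hd, hd'⟩ := h.vec 3 (by omega)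
    refine ⟨-(c * d⁻¹), neg_ne_zero.2 (mul_ne_zero hc (inv_ne_zero hd)), ?_⟩
    rw [hc', hd', smul_smul, neg_mul, inv_mul_cancel_right₀ hd]
    change c • (b (some 0) - b (some 1)) = -c • (b (some 1) - b (some 0))
    module

end WheelTriangle

/-! ### Triangles and triads inside a fan -/

section Contiguous

variable {K V α : Type*} [Field K] [AddCommGroup V] [Module K V] {N : Matroid α} {f : α → V}
  {lo hi r : ℕ} {el : ℕ → α} {u : ℕ → V} {g : ℕ → V →ₗ[K] K} {L L' : List α}

/-- A triangle inside a fan consists of consecutive elements: each rim vertex of the wheel that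
is met by an element of the triangle is met by at least two. -/
theorem FanCoord.consecutive_of_cyc (h : FanCoord K N f lo hi r el u g) (ht : N.Tame)
    (hf : N.IsRepresentedBy K f) (hpos : N.PosFan lo hi el)
    (hr : hi = 2 * r - 1 ∨ hi = 2 * r - 2) (hli : LinearIndepOn K u (Iio r)) {p q s : ℕ}
    (hp : lo ≤ p) (hpq : p < q) (hqs : q < s) (hs : s < hi) (hc : N.Cyc {el p, el q, el s}) :
    q = p + 1 ∧ s = q + 1 := by
  obtain ⟨x, y, z, hx, hy, hz, hrel⟩ := ht.relation_of_cyc_triple hf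
    (hpos.ne hp hpq (by omega)) (hpos.ne hp (by omega) hs) hc
  have hdual : ∀ m, m < r → ∃ σ : V →ₗ[K] K, ∀ k, k < r → σ (u k) = if k = m then 1 else 0 := by
    intro m _
    obtain ⟨σ, hσ⟩ := exists_functional_of_linearIndepOn hli (fun k => if k = m then 1 else 0)
    exact ⟨σ, fun k hk => hσ k hk⟩
  -- the functional dual to the vertex `m` is nonzero on exactly the positions that meet `m`
  have hval : ∀ m, m < r → ∃ σ : V →ₗ[K] K, ∀ p, lo ≤ p → p < hi →
      (σ (f (el p)) ≠ 0 ↔ p = 2 * m ∨ p = 2 * m + 1 ∨ p + 1 = 2 * m) := by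
    intro m hm
    obtain ⟨σ, hσ⟩ := hdual m hm
    refine ⟨σ, fun p hp1 hp2 => ?_⟩
    obtain ⟨c, hc0, hc⟩ := h.vec p hp1 hp2
    rcases Nat.even_or_odd' p with ⟨k, rfl | rfl⟩
    · rw [wv_even] at hc
      rw [hc, map_smul, hσ k (by omega)]
      by_cases hk : k = m
      · simp [hk, hc0]
      · simp only [hk, if_false, smul_zero, ne_eq, not_true_eq_false, false_iff]; omega
    · rw [wv_odd] at hc
      rw [hc, map_smul, map_sub, hσ k (by omega), hσ (k + 1) (by omega)]
      by_cases hk : k = m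
      · simp [hk, hc0]
      · by_cases hk' : k + 1 = m
        · subst hk'
          rw [if_neg hk, if_pos rfl, zero_sub, smul_neg, smul_eq_mul, mul_one]
          exact iff_of_true (neg_ne_zero.2 hc0) (by omega)
        · simp only [hk, hk', if_false, sub_zero, smul_zero, ne_eq, not_true_eq_false, false_iff]
          omega
  have hcover : ∀ m, m < r → ∀ P : ℕ → Prop,
      (∀ p, P p ↔ (p = 2 * m ∨ p = 2 * m + 1 ∨ p + 1 = 2 * m)) →
      (P p → P q ∨ P s) ∧ (P q → P p ∨ P s) ∧ (P s → P p ∨ P q) := by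
    intro m hm P hP
    obtain ⟨σ, hσ⟩ := hval m hm
    have h0 := congr_arg σ hrel
    rw [map_add, map_add, map_smul, map_smul, map_smul, map_zero] at h0
    have ep := (hσ p hp (by omega)).trans (hP p).symm
    have eq := (hσ q (by omega) (by omega)).trans (hP q).symm
    have es := (hσ s (by omega) hs).trans (hP s).symm
    simp only [smul_eq_mul] at h0
    refine ⟨fun h1 => ?_, fun h1 => ?_, fun h1 => ?_⟩ <;> by_contra hcon <;>
      rw [not_or] at hcon
    · rw [← eq, ← es, not_not, not_not] at hcon
      rw [hcon.1, hcon.2, mul_zero, mul_zero, add_zero, add_zero] at h0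
      exact mul_ne_zero hx (ep.2 h1) h0
    · rw [← ep, ← es, not_not, not_not] at hcon
      rw [hcon.1, hcon.2, mul_zero, mul_zero, zero_add, add_zero] at h0
      exact mul_ne_zero hy (eq.2 h1) h0
    · rw [← ep, ← eq, not_not, not_not] at hcon
      rw [hcon.1, hcon.2, mul_zero, mul_zero, zero_add, zero_add] at h0
      exact mul_ne_zero hz (es.2 h1) h0
  rcases Nat.even_or_odd' p with ⟨a, rfl | rfl⟩
  · have h1 := (hcover a (by omega) _ fun p => Iff.rfl).1 (by omega)
    have h2 := hcover (a + 1) (by omega) _ fun p => Iff.rfl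
    have hq : q = 2 * a + 1 := by omega
    subst hq
    refine ⟨rfl, ?_⟩
    have h3 := h2.2.1 (by omega)
    by_contra hne
    have hs3 : s = 2 * a + 3 := by omega
    subst hs3
    have := (hcover (a + 2) (by omega) _ fun p => Iff.rfl).2.2 (by omega)
    omega
  · have h1 := (hcover a (by omega) _ fun p => Iff.rfl).1 (by omega)
    omega

/-- A triad inside a fan consists of consecutive elements. A functional supported by the triad
vanishes on the two ends, which are spanned by the elements off the fan; so it is nonzero on some
interval of interior rim vertices, and the triad consists of the spokes at these vertices and of the
two rim elements at the ends of the interval. -/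
theorem FanCoord.consecutive_of_dual_cyc (h : FanCoord K N f lo hi r el u g) (ht : N.Tame)
    (hf : N.IsRepresentedBy K f) (hpos : N.PosFan lo hi el) (hlo : lo ≤ 1) (hlen : lo + 3 ≤ hi)
    (hr : hi = 2 * r - 1 ∨ hi = 2 * r - 2)
    (h0 : u 0 ∈ Submodule.span K (f '' (N.E \ posSet lo hi el)))
    (h1 : u (r - 1) ∈ Submodule.span K (f '' (N.E \ posSet lo hi el))) {p q s : ℕ}
    (hp : lo ≤ p) (hpq : p < q) (hqs : q < s) (hs : s < hi) (hc : N✶.Cyc {el p, el q, el s}) :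
    q = p + 1 ∧ s = q + 1 := by
  obtain ⟨σ, hσ0, hσp, hσq, hσs⟩ := ht.functional_of_dual_cyc_triple hf hc
  have hmem : ∀ e ∈ ({el p, el q, el s} : Set α), e ∈ posSet lo hi el := by
    rintro e (rfl | rfl | rfl)
    exacts [⟨p, hp, by omega, rfl⟩, ⟨q, by omega, by omega, rfl⟩, ⟨s, by omega, hs, rfl⟩]
  have hker : Submodule.span K (f '' (N.E \ posSet lo hi el)) ≤ LinearMap.ker σ := by
    refine Submodule.span_le.2 ?_
    rintro _ ⟨e, he, rfl⟩
    exact hσ0 e he.1 fun hcon => he.2 (hmem e hcon)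
  have hy0 : σ (u 0) = 0 := hker h0
  have hy1 : σ (u (r - 1)) = 0 := hker h1
  have hval : ∀ m, lo ≤ m → m < hi → (σ (wv u m) ≠ 0 ↔ (m = p ∨ m = q ∨ m = s)) := by
    intro m hm1 hm2
    obtain ⟨c, hc0, hc⟩ := h.vec m hm1 hm2
    have : σ (wv u m) ≠ 0 ↔ σ (f (el m)) ≠ 0 := by
      rw [hc, map_smul, smul_eq_mul, ne_eq, ne_eq, mul_eq_zero, or_iff_right hc0]
    rw [this]
    constructor
    · intro hne
      by_contra hcon
      push Not at hcon
      refine hne (hσ0 _ (hpos.mem_ground hlen hm1 hm2) ?_)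
      simp only [mem_insert_iff, mem_singleton_iff, not_or]
      refine ⟨fun he => hcon.1 ?_, fun he => hcon.2.1 ?_, fun he => hcon.2.2 ?_⟩
      · exact hpos.inj _ _ hm1 hm2 hp (by omega) he
      · exact hpos.inj _ _ hm1 hm2 (by omega) (by omega) he
      · exact hpos.inj _ _ hm1 hm2 (by omega) hs he
    · rintro (rfl | rfl | rfl) <;> assumption
  have hsp : ∀ k, k < r → σ (u k) ≠ 0 → 1 ≤ k ∧ k + 2 ≤ r ∧ (2 * k = p ∨ 2 * k = q ∨ 2 * k = s) := by
    intro k hk hne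
    have hk0 : k ≠ 0 := by rintro rfl; exact hne hy0
    have hk1 : k ≠ r - 1 := by rintro rfl; exact hne hy1
    refine ⟨by omega, by omega, (hval (2 * k) (by omega) (by omega)).1 ?_⟩
    rwa [wv_even]
  have hsp' : ∀ k, lo ≤ 2 * k → 2 * k < hi → (2 * k = p ∨ 2 * k = q ∨ 2 * k = s) → σ (u k) ≠ 0 := by
    intro k hk1 hk2 hk
    have := (hval (2 * k) hk1 hk2).2 hk
    rwa [wv_even] at this
  have hrim : ∀ k, k + 1 < r → (σ (u k) ≠ σ (u (k + 1)) ↔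
      (2 * k + 1 = p ∨ 2 * k + 1 = q ∨ 2 * k + 1 = s)) := by
    intro k hk
    rw [← hval (2 * k + 1) (by omega) (by omega), wv_odd, map_sub, sub_ne_zero]
  rcases Nat.even_or_odd' p with ⟨k, rfl | rfl⟩
  · exfalso
    have hk := hsp' k hp (by omega) (Or.inl rfl)
    have hk1 := hsp k (by omega) hk
    have : σ (u (k - 1)) = σ (u (k - 1 + 1)) := by
      by_contra hcon
      have := (hrim (k - 1) (by omega)).1 hcon
      omega
    rw [show k - 1 + 1 = k by omega] at this
    have := (hsp (k - 1) (by omega) (by rwa [this])).2.2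
    omega
  · have hne := (hrim k (by omega)).2 (Or.inl rfl)
    have hk0 : σ (u k) = 0 := by
      by_contra hcon
      have := (hsp k (by omega) hcon).2.2
      omega
    have hk1 : σ (u (k + 1)) ≠ 0 := by rw [← hk0]; exact hne.symm
    have hb := hsp (k + 1) (by omega) hk1
    have hq : q = 2 * k + 2 := by omega
    subst hq
    refine ⟨rfl, ?_⟩
    by_contra hs3
    have e1 : σ (u (k + 1)) = σ (u (k + 1 + 1)) := by
      by_contra hcon
      have := (hrim (k + 1) (by omega)).1 hcon
      omega
    have hb2 := hsp (k + 1 + 1) (by omega) (by rwa [← e1])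
    have e2 : σ (u (k + 1 + 1)) = σ (u (k + 1 + 1 + 1)) := by
      by_contra hcon
      have := (hrim (k + 1 + 1) (by omega)).1 hcon
      omega
    have hb3 := hsp (k + 1 + 1 + 1) (by omega) (by rwa [← e2, ← e1])
    omega

/-- A fan that is a subsequence of a fan is contiguous in it. -/
theorem PosFan.infix_of_sublist [N.Finite] (hpos : N.PosFan lo hi el)
    (hN : N.IsConnectedOfOrder 3) (ht : N.Tame) (hf : N.IsRepresentedBy K f) (hlo : lo ≤ 1)
    (hlen : lo + 3 ≤ hi) (hout : 2 ≤ (N.E \ posSet lo hi el).encard) (hL : N.IsFan L)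
    (hsub : L.Sublist (posList lo hi el)) : L <:+: posList lo hi el := by
  have hr' : hi = 2 * ((hi + 2) / 2) - 1 ∨ hi = 2 * ((hi + 2) / 2) - 2 := by omega
  generalize (hi + 2) / 2 = r at hr'
  obtain ⟨u, g, h⟩ := exists_fanCoord ht hf hpos hlo hlen hr' (by omega)
  obtain ⟨h0, h1, hind⟩ := h.ends hN hf hlo hlen hr' hpos hout
  have hli := h.linearIndepOn (by omega) hind
  obtain ⟨lo', hi', el', hlo', hlen', rfl, hpos'⟩ := hL.exists_posFan
  obtain ⟨φ, hφ⟩ := List.sublist_iff_exists_orderEmbedding_getElem?_eq.1 hsub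
  have hel : ∀ i, lo' + i < hi' → lo + φ i < hi ∧ el (lo + φ i) = el' (lo' + i) := by
    intro i hi1
    have := hφ i
    rw [getElem?_posList hi1, eq_comm, getElem?_posList_eq_some] at this
    exact this
  have hstep : ∀ i, lo' + i + 2 < hi' → φ (i + 1) = φ i + 1 ∧ φ (i + 2) = φ (i + 1) + 1 := by
    intro i hi1
    have e0 := hel i (by omega)
    have e1 := hel (i + 1) (by omega)
    have e2 := hel (i + 2) (by omega)
    have m1 : φ i < φ (i + 1) := φ.strictMono (by omega)
    have m2 : φ (i + 1) < φ (i + 2) := φ.strictMono (by omega)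
    have key : lo + φ (i + 1) = lo + φ i + 1 ∧ lo + φ (i + 2) = lo + φ (i + 1) + 1 := by
      rcases Nat.even_or_odd (lo' + i) with he | he
      · have hc := hpos'.triangle he (by omega) hi1
        rw [add_assoc lo' i 1, add_assoc lo' i 2, ← e0.2, ← e1.2, ← e2.2] at hc
        exact h.consecutive_of_cyc ht hf hpos hr' hli (by omega) (by omega) (by omega) e2.1 hc
      · have hc := hpos'.triad he (by omega) hi1
        rw [add_assoc lo' i 1, add_assoc lo' i 2, ← e0.2, ← e1.2, ← e2.2] at hc
        exact h.consecutive_of_dual_cyc ht hf hpos hlo hlen hr' h0 h1 (by omega) (by omega)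
          (by omega) e2.1 hc
    omega
  have hφi : ∀ i, lo' + i < hi' → φ i = φ 0 + i := by
    intro i
    induction i with
    | zero => intro _; rfl
    | succ i ih =>
      intro hi1
      have := ih (by omega)
      by_cases hi2 : lo' + i + 2 < hi'
      · have := (hstep i hi2).1; omega
      · have := (hstep (i - 1) (by omega)).2
        rw [show i - 1 + 2 = i + 1 by omega, show i - 1 + 1 = i by omega] at this
        omega
  rw [List.infix_iff_getElem?]
  refine ⟨φ 0, ?_, fun i hi1 => ?_⟩
  · have := (hel (hi' - lo' - 1) (by omega)).1
    rw [hφi _ (by omega)] at this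
    rw [length_posList, length_posList]
    omega
  · rw [length_posList] at hi1
    have := hφ i
    rw [hφi i (by omega), add_comm] at this
    rw [← this, List.getElem?_eq_getElem]

theorem PosFan.enclosed_of_consistent [N.Finite] (hpos : N.PosFan lo hi el)
    (hN : N.IsConnectedOfOrder 3) (ht : N.Tame) (hf : N.IsRepresentedBy K f) (hlo : lo ≤ 1)
    (hlen : lo + 3 ≤ hi) (hout : 2 ≤ (N.E \ posSet lo hi el).encard) (hL : N.IsFan L)
    (hsub : Consistent L (posList lo hi el)) : Enclosed L (posList lo hi el) := by
  rcases hsub with hsub | hsub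
  · exact .inl (hpos.infix_of_sublist hN ht hf hlo hlen hout hL hsub)
  · right
    have hr : hi ≤ 2 * ((hi + 2) / 2) - 1 := by omega
    have hr' : 2 * ((hi + 2) / 2) - 1 - hi ≤ 1 := by omega
    generalize (hi + 2) / 2 = r at hr hr'
    rw [posList_reverse hr] at hsub
    have := hpos.reverse.infix_of_sublist hN ht hf hr' (by omega)
      (by rwa [posSet_reverse hr]) hL hsub
    rw [← posList_reverse hr] at this
    rwa [← List.reverse_infix, List.reverse_reverse] at this

theorem consistent_filter {P : α → Bool} (h : Consistent L L') (hP : ∀ x ∈ L, P x = true) :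
    Consistent L (L'.filter P) := by
  have hfil : L.filter P = L := List.filter_eq_self.2 hP
  rcases h with h | h
  · left; rw [← hfil]; exact h.filter P
  · right; rw [← hfil, ← List.filter_reverse]; exact h.filter P

end Contiguous

/-! ### The fan of a minor inside a fan -/

section VertexMap

variable {α : Type*} {lo hi lo' hi' r R : ℕ} {el el' : ℕ → α}

theorem posList_append {p : ℕ} (h1 : lo ≤ p) (h2 : p ≤ hi) :
    posList lo hi el = posList lo p el ++ posList p hi el := by
  rw [posList, posList, posList, ← List.map_append]
  congr 1
  have := List.range'_append_1 (s := lo) (m := p - lo) (n := hi - p)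
  rw [show lo + (p - lo) = p by omega, show p - lo + (hi - p) = hi - lo by omega] at this
  exact this.symm

theorem posList_cons (h : lo < hi) : posList lo hi el = el lo :: posList (lo + 1) hi el := by
  rw [posList_append (show lo ≤ lo + 1 by omega) (by omega)]
  simp [posList]

open Classical in
/-- If the elements with property `P` of a sequence in the positions `[lo, hi)` of a wheel form a
sequence in the positions `[lo', hi')` of a smaller wheel, where spokes go to spokes and rim elements
to rim elements, then this comes from the map of rim vertices that contracts the rim elements
without property `P`. -/
theorem exists_vertexMap {P : α → Prop} {τ : α → Bool}
    (hfil : (posList lo hi el).filter (fun x => P x) = posList lo' hi' el')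
    (hlo : lo ≤ 1) (hlen : lo + 3 ≤ hi) (hR : hi = 2 * R - 1 ∨ hi = 2 * R - 2)
    (hlo' : lo' ≤ 1) (hlen' : lo' + 3 ≤ hi') (hr : hi' = 2 * r - 1 ∨ hi' = 2 * r - 2)
    (hτ : ∀ p, lo ≤ p → p < hi → τ (el p) = decide (Odd p))
    (hτ' : ∀ p, lo' ≤ p → p < hi' → τ (el' p) = decide (Odd p)) :
    ∃ π : ℕ → ℕ, π 0 = 0 ∧ π (R - 1) = r - 1 ∧
      (∀ k, lo ≤ 2 * k → 2 * k < hi → P (el (2 * k)) →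
        lo' ≤ 2 * π k ∧ 2 * π k < hi' ∧ el' (2 * π k) = el (2 * k)) ∧
      (∀ k, 2 * k + 1 < hi → P (el (2 * k + 1)) →
        π (k + 1) = π k + 1 ∧ 2 * π k + 1 < hi' ∧ el' (2 * π k + 1) = el (2 * k + 1)) ∧
      (∀ k, 2 * k + 1 < hi → ¬ P (el (2 * k + 1)) → π (k + 1) = π k) := by
  -- `q p` is the position of the first remaining element that is not before position `p`
  let q : ℕ → ℕ := fun p => lo' + ((posList lo p el).filter (fun x => P x)).length
  have hq0 : ∀ p, p ≤ lo → q p = lo' := fun p hp => by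
    simp [q, posList, Nat.sub_eq_zero_of_le hp]
  have hq1 : ∀ p, lo ≤ p → P (el p) → q (p + 1) = q p + 1 := fun p hp hP => by
    simp only [q]
    rw [posList_append hp (Nat.le_succ p), List.filter_append, List.length_append,
      posList_cons (Nat.lt_succ_self p)]
    simp [hP, posList, add_assoc]
  have hq2 : ∀ p, lo ≤ p → ¬ P (el p) → q (p + 1) = q p := fun p hp hP => by
    simp only [q]
    rw [posList_append hp (Nat.le_succ p), List.filter_append, List.length_append,
      posList_cons (Nat.lt_succ_self p)]
    simp [hP, posList]
  have hqhi : q hi = hi' := by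
    simp only [q]; rw [hfil, length_posList]; omega
  have hqel : ∀ p, lo ≤ p → p < hi → P (el p) → q p < hi' ∧ el' (q p) = el p := by
    intro p h1 h2 hP
    have : ((posList lo hi el).filter (fun x => P x))[((posList lo p el).filter
        (fun x => P x)).length]? = some (el p) := by
      rw [posList_append h1 h2.le, List.filter_append, posList_cons h2]
      simp [hP]
    rw [hfil, getElem?_posList_eq_some] at this
    exact this
  have hpar : ∀ p, lo ≤ p → p < hi → P (el p) → (Odd (q p) ↔ Odd p) := by
    intro p h1 h2 hP
    obtain ⟨h3, h4⟩ := hqel p h1 h2 hP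
    have e1 := hτ p h1 h2
    rw [← h4, hτ' (q p) (by simp [q]) h3] at e1
    simpa using e1
  have hparE : ∀ k, lo ≤ 2 * k → 2 * k < hi → P (el (2 * k)) → q (2 * k) % 2 = 0 := by
    intro k h1 h2 hP
    have := hpar _ h1 h2 hP
    rw [← Nat.even_iff, ← Nat.not_odd_iff_even, this]; simp
  have hparO : ∀ k, 2 * k + 1 < hi → P (el (2 * k + 1)) → q (2 * k + 1) % 2 = 1 := by
    intro k h2 hP
    have := hpar _ (by omega) h2 hP
    rw [← Nat.odd_iff, this]; simp
  have hspoke : ∀ k, (lo ≤ 2 * k ∧ P (el (2 * k)) ∧ q (2 * k + 1) = q (2 * k) + 1) ∨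
      q (2 * k + 1) = q (2 * k) := by
    intro k
    by_cases h1 : lo ≤ 2 * k
    · by_cases hP : P (el (2 * k))
      · exact .inl ⟨h1, hP, hq1 _ h1 hP⟩
      · exact .inr (hq2 _ h1 hP)
    · right
      rw [hq0 _ (by omega), hq0 _ (by omega)]
  refine ⟨fun k => q (2 * k) / 2, ?_, ?_, fun k h1 h2 hP => ?_, fun k h2 hP => ?_, fun k h2 hP => ?_⟩
  · change q (2 * 0) / 2 = 0
    rw [hq0 _ (by omega)]; omega
  · change q (2 * (R - 1)) / 2 = r - 1
    by_cases hhi : hi = 2 * R - 2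
    · rw [show 2 * (R - 1) = hi by omega, hqhi]; omega
    · have h2 : 2 * (R - 1) + 1 = hi := by omega
      rcases hspoke (R - 1) with ⟨h1, hP, h3⟩ | h3
      · have := hparE _ h1 (by omega) hP
        rw [h2, hqhi] at h3; omega
      · rw [h2, hqhi] at h3; omega
  · have := hparE k h1 h2 hP
    have h3 : 2 * (q (2 * k) / 2) = q (2 * k) := by omega
    change lo' ≤ 2 * (q (2 * k) / 2) ∧ 2 * (q (2 * k) / 2) < hi' ∧ el' (2 * (q (2 * k) / 2)) = _
    rw [h3]
    exact ⟨by simp [q], hqel _ h1 h2 hP⟩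
  · have h3 := hparO k h2 hP
    have h4 := hq1 (2 * k + 1) (by omega) hP
    have h5 : q (2 * k) / 2 = q (2 * k + 1) / 2 := by
      rcases hspoke k with ⟨h6, hP', h7⟩ | h7
      · have := hparE k h6 (by omega) hP'; omega
      · rw [h7]
    have h6 : 2 * (q (2 * k) / 2) + 1 = q (2 * k + 1) := by omega
    change q (2 * (k + 1)) / 2 = q (2 * k) / 2 + 1 ∧ 2 * (q (2 * k) / 2) + 1 < hi' ∧
      el' (2 * (q (2 * k) / 2) + 1) = _
    rw [h6, show 2 * (k + 1) = 2 * k + 1 + 1 by ring, h4]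
    exact ⟨by omega, hqel _ (by omega) h2 hP⟩
  · have h4 := hq2 (2 * k + 1) (by omega) hP
    change q (2 * k + 1 + 1) / 2 = q (2 * k) / 2
    rcases hspoke k with ⟨h6, hP', h7⟩ | h7
    · have := hparE k h6 (by omega) hP'; omega
    · rw [h4, h7]

end VertexMap

section FanPair

variable {K V α : Type*} [Field K] [AddCommGroup V] [Module K V] {M N : Matroid α} {f : α → V}
  {lo hi r R : ℕ} {el : ℕ → α} {u : ℕ → V} {g : ℕ → V →ₗ[K] K} {π : ℕ → ℕ}

/-- A fan of `M`, in positions `[lo, hi)` of a wheel of rank `R`, together with coordinates for the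
elements of it that belong to the minor `N` of `M`. These form a fan in a wheel of rank `r`, with
vectors `u m` for the rim vertices and dual functionals `g m`, and `π` is the map of rim vertices
that contracts the rim elements outside `N`. -/
structure FanPair (K : Type*) {V α : Type*} [Field K] [AddCommGroup V] [Module K V]
    (M N : Matroid α) (f : α → V) (lo hi r R : ℕ) (el : ℕ → α) (u : ℕ → V)
    (g : ℕ → V →ₗ[K] K) (π : ℕ → ℕ) : Prop where
  posFan : M.PosFan lo hi el
  lo_le : lo ≤ 1
  len : lo + 3 ≤ hi
  hi_eq : hi = 2 * R - 1 ∨ hi = 2 * R - 2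
  two_le : 2 ≤ r
  map_zero : π 0 = 0
  map_last : π (R - 1) = r - 1
  map_succ : ∀ k, 2 * k + 1 < hi → el (2 * k + 1) ∈ N.E → π (k + 1) = π k + 1
  map_eq : ∀ k, 2 * k + 1 < hi → el (2 * k + 1) ∉ N.E → π (k + 1) = π k
  vec : ∀ p, lo ≤ p → p < hi → el p ∈ N.E → ∃ c : K, c ≠ 0 ∧ f (el p) = c • wv (fun k => u (π k)) p
  mem_span : ∀ m, m < r → u m ∈ Submodule.span K (f '' (posSet lo hi el ∩ N.E))
  ends : ∀ a b : K, a • u 0 + b • u (r - 1) = 0 → a = 0 ∧ b = 0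
  dual_self : ∀ l, 1 ≤ l → l + 2 ≤ r → g l (u l) = 1
  dual_ne : ∀ l, 1 ≤ l → l + 2 ≤ r → ∀ m, m < r → m ≠ l → g l (u m) = 0
  dual_off : ∀ l, 1 ≤ l → l + 2 ≤ r → ∀ e ∈ N.E, e ∉ posSet lo hi el → g l (f e) = 0

open Classical in
/-- The elements of a fan of `M` that belong to a 3-connected represented minor `N` form a fan of
`N` with coordinates, if there are at least three of them. -/
theorem PosFan.exists_fanPair [N.Finite] (hpos : M.PosFan lo hi el) (hlo : lo ≤ 1)
    (hlen : lo + 3 ≤ hi) (hR : hi = 2 * R - 1 ∨ hi = 2 * R - 2) (hNM : N ≤m M)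
    (hN : N.IsConnectedOfOrder 3) (ht : N.Tame) (hf : N.IsRepresentedBy K f)
    (hwheel : ¬ N.IsWheel) (hwhirl : ¬ N.IsWhirl) {τ : α → Bool}
    (hτ : ∀ p, lo ≤ p → p < hi → τ (el p) = decide (Odd p))
    (h3 : 3 ≤ ({y | y ∈ posList lo hi el} ∩ N.E).encard) :
    ∃ lo' hi' el', lo' ≤ 1 ∧ lo' + 3 ≤ hi' ∧
      (posList lo hi el).filter (fun x => x ∈ N.E) = posList lo' hi' el' ∧
      N.PosFan lo' hi' el' ∧ 2 ≤ (N.E \ posSet lo' hi' el').encard ∧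
      ∃ r u g π, FanPair K M N f lo hi r R el u g π ∧
        (∃ c : K, c ≠ 0 ∧ endVector K N f (posList lo' hi' el') = c • u 0) ∧
        (∃ c : K, c ≠ 0 ∧ rimVector K N f (posList lo' hi' el') = c • (u 0 - u (r - 1))) ∧
        (∃ c : K, c ≠ 0 ∧ endVector K N f (posList lo' hi' el').reverse = c • u (r - 1)) := by
  have hw := hpos.weakFan hτ
  have hw' := WeakFan.filter _ M _ rfl ht hNM hw h3
  set L := (posList lo hi el).filter (fun x => x ∈ N.E) with hL
  have hset : {y | y ∈ L} = {y | y ∈ posList lo hi el} ∩ N.E := by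
    ext x; simp [hL, List.mem_filter]
  have hlen' : 3 ≤ L.length := by
    rw [← hset] at h3
    have h4 : {y | y ∈ L} = (L.toFinset : Set α) := by ext; simp
    rw [h4, encard_coe_eq_coe_finsetCard] at h3
    have h5 : 3 ≤ L.toFinset.card := by exact_mod_cast h3
    exact h5.trans L.toFinset_card_le
  obtain ⟨lo', hlo', hodd⟩ : ∃ lo' : ℕ, lo' ≤ 1 ∧
      τ (L.head (by rintro h; simp [h] at hlen')) = decide (Odd lo') := by
    by_cases hb : τ (L.head (by rintro h; simp [h] at hlen')) = true
    · exact ⟨1, le_rfl, by simp [hb]⟩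
    · exact ⟨0, by omega, by simpa using hb⟩
  obtain ⟨el', hel'⟩ := exists_eq_posList (L := L) lo' (by rintro h; simp [h] at hlen')
  set hi' := lo' + L.length with hhi'
  have hlen'' : lo' + 3 ≤ hi' := by omega
  have hhead : L.head (by rintro h; simp [h] at hlen') = el' lo' := by
    have h1 := head?_posList (el := el') (show lo' < hi' by omega)
    rw [← hel', List.head?_eq_some_head (by rintro h; simp [h] at hlen')] at h1
    exact Option.some.inj h1
  rw [hhead] at hodd
  rw [hel'] at hw'
  obtain ⟨hpos', hτ'⟩ := hw'.posFan hodd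
  have hr' : hi' = 2 * ((hi' + 2) / 2) - 1 ∨ hi' = 2 * ((hi' + 2) / 2) - 2 := by omega
  have hr2 : 2 ≤ (hi' + 2) / 2 := by omega
  generalize (hi' + 2) / 2 = r at hr' hr2
  obtain ⟨u, g, h⟩ := exists_fanCoord ht hf hpos' hlo' hlen'' hr' hr2
  have hout := hpos'.two_le_encard_compl ht hf hlo' hlen'' hwheel hwhirl
  obtain ⟨h0, h1, hind⟩ := h.ends hN hf hlo' hlen'' hr' hpos' hout
  obtain ⟨π, hπ0, hπ1, hπs, hπr, hπe⟩ := exists_vertexMap (P := fun x => x ∈ N.E) (hL.symm.trans hel')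
    hlo hlen hR hlo' hlen'' hr' hτ hτ'
  have hposSet : posSet lo' hi' el' = posSet lo hi el ∩ N.E := by
    rw [← listSet_posList, ← hel', ← listSet_posList]
    exact hset
  refine ⟨lo', hi', el', hlo', hlen'', hel', hpos', hout, r, u, g, π, ?_,
    hpos'.exists_endVector_eq h hN ht hf hlo' hlen'' hr' hout,
    hpos'.exists_rimVector_eq h hN ht hf hlo' hlen'' hr' hout,
    hpos'.exists_endVector_reverse_eq h hN ht hf hlo' hlen'' hr' hout⟩
  refine ⟨hpos, hlo, hlen, hR, hr2, hπ0, hπ1, fun k h1 h2 => (hπr k h1 h2).1, hπe, ?_, ?_, hind,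
    h.dual_self, h.dual_ne, ?_⟩
  · intro p hp1 hp2 hpN
    rcases Nat.even_or_odd' p with ⟨k, rfl | rfl⟩
    · obtain ⟨e1, e2, e3⟩ := hπs k hp1 hp2 hpN
      obtain ⟨c, hc0, hc⟩ := h.vec _ e1 e2
      refine ⟨c, hc0, ?_⟩
      rw [e3, wv_even] at hc
      rw [hc, wv_even]
    · obtain ⟨e1, e2, e3⟩ := hπr k hp2 hpN
      obtain ⟨c, hc0, hc⟩ := h.vec (2 * π k + 1) (by omega) e2
      refine ⟨c, hc0, ?_⟩
      rw [e3, wv_odd] at hc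
      rw [hc, wv_odd, e1]
  · intro m hm
    rw [← hposSet]
    exact h.mem_span hlo' hlen'' hr' hm
  · intro l hl1 hl2 e he hel
    exact h.dual_off l hl1 hl2 e he (by rw [hposSet]; exact fun hc => hel hc.1)

end FanPair

/-! ### Vectors for the gluing of wheels -/

section Glue

variable {K V β : Type*} [Field K] [AddCommGroup V] [Module K V] {t : ℕ}

variable (K) in
/-- The vectors of the rim vertices of the wheels that are glued to a vector configuration in `V`.
The two vertices at the ends of the triangle of the `j`-th wheel get the vectors `a j` and `b j` of
`V`, and the other ones are new independent vectors; the hub has the vector `0`. -/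
noncomputable def glueVertex (R : Fin t → ℕ) (a b : Fin t → V) (j : Fin t) (k : ℕ) :
    V × (Fin t × ℕ →₀ K) :=
  if k = 0 then (a j, 0) else if k + 1 = R j then (b j, 0) else (0, Finsupp.single (j, k) 1)

variable (K) in
/-- The vectors of the elements of the base, and of the other elements of the wheels glued to it. -/
noncomputable def glueVec (base : β → V) (R : Fin t → ℕ) (a b : Fin t → V) :
    β ⊕ (Fin t × ℕ) → V × (Fin t × ℕ →₀ K) :=
  Sum.elim (fun q => (base q, 0)) (fun q => wv (glueVertex K R a b q.1) q.2)

variable (K V) in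
/-- The coordinate of a vector at the new rim vertex `k` of the `j`-th wheel. -/
noncomputable def glueCoord (j : Fin t) (k : ℕ) : V × (Fin t × ℕ →₀ K) →ₗ[K] K :=
  Finsupp.lapply (j, k) ∘ₗ LinearMap.snd K V _

variable {R : Fin t → ℕ} {a b : Fin t → V}

theorem glueCoord_apply (j : Fin t) (k : ℕ) (x : V × (Fin t × ℕ →₀ K)) :
    glueCoord K V j k x = x.2 (j, k) := rfl

theorem glueCoord_self {j : Fin t} {k : ℕ} (h1 : 1 ≤ k) (h2 : k + 2 ≤ R j) :
    glueCoord K V j k (glueVertex K R a b j k) = 1 := by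
  rw [glueVertex, if_neg (by omega), if_neg (by omega), glueCoord_apply, Finsupp.single_eq_same]

theorem glueCoord_ne {i j : Fin t} {k l : ℕ} (h : (i, l) ≠ (j, k)) :
    glueCoord K V i l (glueVertex K R a b j k) = 0 := by
  rw [glueVertex, glueCoord_apply]
  split_ifs
  · rfl
  · rfl
  · exact Finsupp.single_eq_of_ne h

theorem glueVertex_zero {K V : Type*} [Field K] [AddCommGroup V] {R : Fin t → ℕ} {a b : Fin t → V}
    (j : Fin t) : glueVertex K R a b j 0 = (a j, 0) := if_pos rfl

theorem glueVertex_last {K V : Type*} [Field K] [AddCommGroup V] {R : Fin t → ℕ} {a b : Fin t → V}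
    {j : Fin t} (h : 2 ≤ R j) : glueVertex K R a b j (R j - 1) = (b j, 0) := by
  rw [glueVertex, if_neg (by omega), if_pos (by omega)]

theorem glueCoord_eq_zero_of_ne {i j : Fin t} (h : i ≠ j) (l p : ℕ) :
    glueCoord K V i l (wv (glueVertex K R a b j) p) = 0 := by
  have hne : ∀ k, (i, l) ≠ (j, k) := fun k hc => h (Prod.mk.inj hc).1
  rcases Nat.even_or_odd' p with ⟨k, rfl | rfl⟩
  · rw [wv_even, glueCoord_ne (hne k)]
  · rw [wv_odd, map_sub, glueCoord_ne (hne k), glueCoord_ne (hne _), sub_zero]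

/-- The combinations of the vectors of the rim vertices without new coordinates are combinations of
the two ends. -/
theorem glueVertex_eq_ends {j : Fin t} (hR : 2 ≤ R j) {c : ℕ → K}
    (h : ∀ l, glueCoord K V j l (∑ k ∈ Finset.range (R j), c k • glueVertex K R a b j k) = 0) :
    (∀ l, 1 ≤ l → l + 2 ≤ R j → c l = 0) ∧
    ∑ k ∈ Finset.range (R j), c k • glueVertex K R a b j k =
      c 0 • glueVertex K R a b j 0 + c (R j - 1) • glueVertex K R a b j (R j - 1) := by
  have h1 : ∀ l, 1 ≤ l → l + 2 ≤ R j → c l = 0 := by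
    intro l hl1 hl2
    have h2 := h l
    rw [map_sum, Finset.sum_eq_single l] at h2
    · rwa [map_smul, glueCoord_self hl1 hl2, smul_eq_mul, mul_one] at h2
    · intro m _ hml
      rw [map_smul, glueCoord_ne (fun hc => hml (Prod.mk.inj hc).2.symm), smul_zero]
    · intro hl; exact absurd (Finset.mem_range.2 (by omega)) hl
  exact ⟨h1, sum_range_eq_ends hR h1⟩

theorem linearIndepOn_glueVertex {j : Fin t} (hR : 2 ≤ R j)
    (hab : ∀ x y : K, x • a j + y • b j = 0 → x = 0 ∧ y = 0) :
    LinearIndepOn K (glueVertex K R a b j) (Iio (R j)) := by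
  rw [← Finset.coe_range, linearIndepOn_finset_iff]
  intro c hc
  obtain ⟨h1, h2⟩ := glueVertex_eq_ends hR (c := c) (fun l => by rw [hc, map_zero])
  rw [h2, glueVertex_zero, glueVertex_last hR] at hc
  obtain ⟨h3, h4⟩ := hab _ _ (congr_arg Prod.fst hc)
  intro i hi
  rw [Finset.mem_range] at hi
  by_cases hi0 : i = 0
  · rwa [hi0]
  by_cases hir : i = R j - 1
  · rwa [hir]
  exact h1 i (by omega) (by omega)

end Glue

section BlueprintVec

variable {K V β γ : Type*} [Field K] [AddCommGroup V] [Module K V] {t : ℕ} {B : Blueprint β t}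
  {base : β → V} {a b : Fin t → V} {i j : Fin t} {p : ℕ}

theorem Blueprint.label_zero : B.label j 0 = Sum.inl (B.corner j 0) := if_pos rfl

theorem Blueprint.label_last_spoke : B.label j (2 * B.rank j - 2) = Sum.inl (B.corner j 2) := by
  have := B.two_le_rank j
  rw [Blueprint.label, if_neg (by omega), if_pos rfl]

theorem Blueprint.label_last_rim : B.label j (2 * B.rank j - 1) = Sum.inl (B.corner j 1) := by
  have := B.two_le_rank j
  rw [Blueprint.label, if_neg (by omega), if_neg (by omega), if_pos rfl]

theorem Blueprint.label_of_lt (h1 : 1 ≤ p) (h2 : p + 2 < 2 * B.rank j) :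
    B.label j p = Sum.inr (j, p) := by
  rw [Blueprint.label, if_neg (by omega), if_neg (by omega), if_neg (by omega)]

theorem Blueprint.label_cases (hp : p < 2 * B.rank j) : p = 0 ∨ p = 2 * B.rank j - 2 ∨
    p = 2 * B.rank j - 1 ∨ (1 ≤ p ∧ p + 2 < 2 * B.rank j) := by
  omega

theorem Blueprint.corner_injective : Function.Injective (B.corner j) := by
  have h := (B.isTriangle j).2
  rw [← image_univ] at h
  have hcard : (univ : Set (Fin 3)).encard = 3 := by simp
  have := (finite_univ (α := Fin 3)).injOn_of_encard_image_eq (h.trans hcard.symm)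
  exact injOn_univ.1 this

theorem Blueprint.corner_mem (c : Fin 3) : B.corner j c ∈ B.base.E :=
  (B.isTriangle j).1.subset_ground (mem_range_self c)

theorem Blueprint.label_injOn : InjOn (B.label j) {p | p < 2 * B.rank j} := by
  have hR := B.two_le_rank j
  have hinj := B.corner_injective (j := j)
  have h01 : B.corner j 0 ≠ B.corner j 1 := fun h => by simpa using hinj h
  have h02 : B.corner j 0 ≠ B.corner j 2 := fun h => by simpa using hinj h
  have h12 : B.corner j 1 ≠ B.corner j 2 := fun h => by simpa using hinj h
  intro p hp q hq hpq
  rcases Blueprint.label_cases hp with rfl | rfl | rfl | ⟨hp1, hp2⟩ <;>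
  rcases Blueprint.label_cases hq with rfl | rfl | rfl | ⟨hq1, hq2⟩ <;>
  simp only [Blueprint.label_zero, Blueprint.label_last_spoke, Blueprint.label_last_rim,
    Blueprint.label_of_lt, Sum.inl.injEq, Sum.inr.injEq, reduceCtorEq, Prod.mk.injEq, *] at hpq <;>
  first
  | rfl
  | exact (h01 hpq).elim
  | exact (h02 hpq).elim
  | exact (h12 hpq).elim
  | exact (h01 hpq.symm).elim
  | exact (h02 hpq.symm).elim
  | exact (h12 hpq.symm).elim
  | exact hpq.2

/-- The vectors `a j`, `b j` and `a j - b j` are, up to scaling, those of the corners of the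
triangles of a blueprint. -/
structure CornerVec (K : Type*) {V β : Type*} [Field K] [AddCommGroup V] [Module K V] {t : ℕ}
    (B : Blueprint β t) (base : β → V) (a b : Fin t → V) : Prop where
  zero : ∀ j, ∃ c : K, c ≠ 0 ∧ base (B.corner j 0) = c • a j
  one : ∀ j, ∃ c : K, c ≠ 0 ∧ base (B.corner j 1) = c • (a j - b j)
  two : ∀ j, ∃ c : K, c ≠ 0 ∧ base (B.corner j 2) = c • b j
  indep : ∀ j, ∀ x y : K, x • a j + y • b j = 0 → x = 0 ∧ y = 0

theorem CornerVec.exists_glueVec_label_eq (h : CornerVec K B base a b) (hp : p < 2 * B.rank j) :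
    ∃ c : K, c ≠ 0 ∧ glueVec K base B.rank a b (B.label j p) =
      c • (if Even p then glueVertex K B.rank a b j (p / 2) else
        glueVertex K B.rank a b j (p / 2) -
          glueVertex K B.rank a b j ((p / 2 + 1) % B.rank j)) := by
  have hR := B.two_le_rank j
  rcases Blueprint.label_cases hp with rfl | rfl | rfl | ⟨hp1, hp2⟩
  · obtain ⟨c, hc0, hc⟩ := h.zero j
    refine ⟨c, hc0, ?_⟩
    rw [if_pos (by simp), Blueprint.label_zero, glueVec, Sum.elim_inl, hc, Nat.zero_div,
      glueVertex_zero, Prod.smul_mk, smul_zero]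
  · obtain ⟨c, hc0, hc⟩ := h.two j
    refine ⟨c, hc0, ?_⟩
    rw [if_pos ⟨B.rank j - 1, by omega⟩, Blueprint.label_last_spoke, glueVec, Sum.elim_inl, hc,
      show (2 * B.rank j - 2) / 2 = B.rank j - 1 by omega,
      glueVertex_last hR, Prod.smul_mk, smul_zero]
  · obtain ⟨c, hc0, hc⟩ := h.one j
    refine ⟨-c, neg_ne_zero.2 hc0, ?_⟩
    rw [if_neg (by rw [Nat.not_even_iff_odd]; exact ⟨B.rank j - 1, by omega⟩),
      Blueprint.label_last_rim, glueVec, Sum.elim_inl, hc,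
      show (2 * B.rank j - 1) / 2 = B.rank j - 1 by omega,
      show B.rank j - 1 + 1 = B.rank j by omega, Nat.mod_self,
      glueVertex_last hR, glueVertex_zero, Prod.mk_sub_mk, Prod.smul_mk, sub_zero, smul_zero]
    congr 1; module
  · refine ⟨1, one_ne_zero, ?_⟩
    rw [Blueprint.label_of_lt hp1 hp2, glueVec, Sum.elim_inr, one_smul, wv]
    rcases Nat.even_or_odd' p with ⟨k, rfl | rfl⟩
    · simp
    · rw [if_neg (by simp), if_neg (by simp), Nat.mod_eq_of_lt (by omega)]

theorem CornerVec.exists_glueVec_label_eq_wv (h : CornerVec K B base a b)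
    (hp : p + 1 < 2 * B.rank j) : ∃ c : K, c ≠ 0 ∧
      glueVec K base B.rank a b (B.label j p) = c • wv (glueVertex K B.rank a b j) p := by
  obtain ⟨c, hc0, hc⟩ := h.exists_glueVec_label_eq (j := j) (p := p) (by omega)
  refine ⟨c, hc0, ?_⟩
  rw [hc, wv]
  rcases Nat.even_or_odd' p with ⟨k, rfl | rfl⟩
  · simp
  · rw [if_neg (by simp), if_neg (by simp), Nat.mod_eq_of_lt (by omega)]

/-- With the corner `b`, whose vector is a multiple of the difference of the two end vertices, the
rim of the glued wheel is closed to a cycle. -/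
theorem CornerVec.wheelRep (h : CornerVec K B base a b) (j : Fin t) :
    WheelRep K (B.rank j) (fun p => glueVec K base B.rank a b (B.label j p))
      (fun x => x.elim 0 (glueVertex K B.rank a b j)) :=
  wheelRep_of_linearIndepOn (linearIndepOn_glueVertex (B.two_le_rank j) (h.indep j))
    fun _ hp => h.exists_glueVec_label_eq hp

theorem CornerVec.wheel_map_eq (h : CornerVec K B base a b) (j : Fin t)
    (hinj : InjOn (B.label j) (wheel (B.rank j)).E) :
    (wheel (B.rank j)).map (B.label j) hinj =
      vectorMatroid K (glueVec K base B.rank a b) (B.label j '' {p | p < 2 * B.rank j}) := by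
  refine ext_indep rfl fun I hI => ?_
  rw [map_ground] at hI
  obtain ⟨I', hI', rfl⟩ := subset_image_iff.1 hI
  rw [wheel_ground] at hI'
  rw [map_indep_iff, vectorMatroid_indep_iff, and_iff_right (image_mono hI')]
  constructor
  · rintro ⟨I'', h1, h2⟩
    rw [(hinj.image_eq_image_iff hI' h1.subset_ground).1 h2]
    exact LinearIndepOn.image_of_comp _ _
      (((h.wheelRep j).wheel_indep_iff h1.subset_ground).1 h1)
  · intro h1
    exact ⟨I', ((h.wheelRep j).wheel_indep_iff hI').2 (h1.comp_of_image (hinj.mono hI')), rfl⟩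

/-- The elements of the base and of the wheels with index less than `n`. -/
def Blueprint.glueGround (B : Blueprint β t) (n : ℕ) : Set (β ⊕ (Fin t × ℕ)) :=
  Sum.inl '' B.base.E ∪ {x | ∃ j : Fin t, (j : ℕ) < n ∧ ∃ p < 2 * B.rank j, B.label j p = x}

theorem Blueprint.image_label_wheelTriangle :
    B.label j '' wheelTriangle (B.rank j) = Sum.inl '' range (B.corner j) := by
  ext x; constructor
  · rintro ⟨_, rfl | rfl | rfl, rfl⟩
    · exact ⟨_, ⟨0, rfl⟩, label_zero.symm⟩
    · exact ⟨_, ⟨1, rfl⟩, label_last_rim.symm⟩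
    · exact ⟨_, ⟨2, rfl⟩, label_last_spoke.symm⟩
  · rintro ⟨_, ⟨c, rfl⟩, rfl⟩
    fin_cases c
    · exact ⟨0, by simp [wheelTriangle], label_zero⟩
    · exact ⟨_, by simp [wheelTriangle], label_last_rim⟩
    · exact ⟨_, by simp [wheelTriangle], label_last_spoke⟩

theorem Blueprint.wheelTriangle_subset : wheelTriangle (B.rank j) ⊆ {p | p < 2 * B.rank j} := by
  have := B.two_le_rank j
  rintro _ (rfl | rfl | rfl) <;> simp only [mem_ofPred_eq] <;> omega

theorem Blueprint.glueGround_inter :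
    B.glueGround i ∩ B.label i '' {p | p < 2 * B.rank i} = Sum.inl '' range (B.corner i) := by
  refine subset_antisymm ?_ (subset_inter ?_ ?_)
  · rintro _ ⟨hx, p, hp, rfl⟩
    rw [← image_label_wheelTriangle]
    refine mem_image_of_mem _ ?_
    rcases label_cases hp with rfl | rfl | rfl | ⟨hp1, hp2⟩
    · simp [wheelTriangle]
    · simp [wheelTriangle]
    · simp [wheelTriangle]
    · exfalso
      rw [label_of_lt hp1 hp2] at hx
      rcases hx with ⟨y, -, hy⟩ | ⟨j, hj, q, hq, hjq⟩
      · simp at hy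
      · rcases label_cases hq with rfl | rfl | rfl | ⟨hq1, hq2⟩
        · simp [label_zero] at hjq
        · simp [label_last_spoke] at hjq
        · simp [label_last_rim] at hjq
        · rw [label_of_lt hq1 hq2] at hjq
          have := congr_arg Prod.fst (Sum.inr.inj hjq)
          simp only at this
          subst this
          omega
  · rintro _ ⟨_, ⟨c, rfl⟩, rfl⟩
    exact .inl ⟨_, corner_mem c, rfl⟩
  · rw [← image_label_wheelTriangle]
    exact image_mono wheelTriangle_subset

theorem CornerVec.glueCoord_eq_zero (n : ℕ) (hi : n ≤ i) (l : ℕ) {x : V × (Fin t × ℕ →₀ K)}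
    (hx : x ∈ Submodule.span K (glueVec K base B.rank a b '' B.glueGround n)) :
    glueCoord K V i l x = 0 := by
  have : Submodule.span K (glueVec K base B.rank a b '' B.glueGround n) ≤
      LinearMap.ker (glueCoord K V i l) := by
    refine Submodule.span_le.2 ?_
    rintro _ ⟨y, hy, rfl⟩
    rw [SetLike.mem_coe, LinearMap.mem_ker]
    rcases hy with ⟨q, -, rfl⟩ | ⟨j, hj, p, hp, rfl⟩
    · rfl
    · have hij : i ≠ j := by rintro rfl; omega
      rcases Blueprint.label_cases hp with rfl | rfl | rfl | ⟨hp1, hp2⟩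
      · rw [Blueprint.label_zero]; rfl
      · rw [Blueprint.label_last_spoke]; rfl
      · rw [Blueprint.label_last_rim]; rfl
      · rw [Blueprint.label_of_lt hp1 hp2]
        exact glueCoord_eq_zero_of_ne hij l p
  exact this hx

/-- Gluing one wheel. Vectors spanned both by the wheel and by what was glued before have no new
coordinates, so they are spanned by the triangle. -/
theorem CornerVec.isGenParallelConnection (h : CornerVec K B base a b) (i : Fin t)
    (hinj : InjOn (B.label i) (wheel (B.rank i)).E) :
    (vectorMatroid K (glueVec K base B.rank a b) (B.glueGround i)).IsGenParallelConnection
      ((wheel (B.rank i)).map (B.label i) hinj) (Sum.inl '' range (B.corner i))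
      (vectorMatroid K (glueVec K base B.rank a b) (B.glueGround (i + 1))) := by
  have hR := B.two_le_rank i
  have hground : B.glueGround (i + 1) =
      B.glueGround i ∪ B.label i '' {p | p < 2 * B.rank i} := by
    ext x; constructor
    · rintro (hx | ⟨j, hj, p, hp, rfl⟩)
      · exact .inl (.inl hx)
      · by_cases hji : j = i
        · subst hji; exact .inr ⟨p, hp, rfl⟩
        · have : (j : ℕ) ≠ i := fun hc => hji (Fin.ext hc)
          exact .inl (.inr ⟨j, by omega, p, hp, rfl⟩)
    · rintro ((hx | ⟨j, hj, hx⟩) | ⟨p, hp, rfl⟩)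
      · exact .inl hx
      · exact .inr ⟨j, by omega, hx⟩
      · exact .inr ⟨i, by omega, p, hp, rfl⟩
  have himage : ∀ S : Set ℕ, glueVec K base B.rank a b '' (B.label i '' S) =
      (fun p => glueVec K base B.rank a b (B.label i p)) '' S := fun S => image_image _ _ _
  rw [h.wheel_map_eq, hground]
  refine isGenParallelConnection_vectorMatroid Blueprint.glueGround_inter
    ((finite_lt_nat _).image _) ?_ (fun F hF => ?_) (fun x hx => ?_)
  · rintro x ⟨hx1, hx2⟩
    have hle : Submodule.span K (glueVec K base B.rank a b '' (B.label i '' {p | p < 2 * B.rank i})) ≤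
        Submodule.span K (glueVertex K B.rank a b i '' Iio (B.rank i)) := by
      refine Submodule.span_le.2 ?_
      rintro _ ⟨_, ⟨p, hp, rfl⟩, rfl⟩
      have hp' : p < 2 * B.rank i := hp
      obtain ⟨c, -, hc⟩ := h.exists_glueVec_label_eq hp
      rw [hc]
      refine Submodule.smul_mem _ _ ?_
      split_ifs
      · exact Submodule.subset_span ⟨_, by simp only [mem_Iio]; omega, rfl⟩
      · exact Submodule.sub_mem _ (Submodule.subset_span ⟨_, by simp only [mem_Iio]; omega, rfl⟩)
          (Submodule.subset_span ⟨_, Nat.mod_lt _ (by omega), rfl⟩)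
    obtain ⟨c, rfl⟩ := exists_coeff_of_mem_span_image_Iio (hle hx2)
    rw [(glueVertex_eq_ends hR fun l => CornerVec.glueCoord_eq_zero _ le_rfl l hx1).2,
      glueVertex_zero, glueVertex_last hR]
    refine Submodule.add_mem _ (Submodule.smul_mem _ _ ?_) (Submodule.smul_mem _ _ ?_)
    · obtain ⟨d, hd0, hd⟩ := h.zero i
      rw [← Submodule.smul_mem_iff _ hd0, Prod.smul_mk, ← hd, smul_zero]
      exact Submodule.subset_span ⟨_, ⟨_, ⟨0, rfl⟩, rfl⟩, rfl⟩
    · obtain ⟨d, hd0, hd⟩ := h.two i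
      rw [← Submodule.smul_mem_iff _ hd0, Prod.smul_mk, ← hd, smul_zero]
      exact Submodule.subset_span ⟨_, ⟨_, ⟨2, rfl⟩, rfl⟩, rfl⟩
  · obtain ⟨hFE, hFcl⟩ := vectorMatroid_isFlat_iff.1 hF
    obtain ⟨S, hS, rfl⟩ := subset_image_iff.1 hFE
    rw [himage, ← Blueprint.image_label_wheelTriangle, himage]
    refine ((h.wheelRep i).span_inf_le hR hS fun p hp hps => ?_).trans (Submodule.span_mono ?_)
    · have := hFcl _ (mem_image_of_mem _ hp) (by rwa [himage])
      obtain ⟨q, hq, hqp⟩ := this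
      rwa [Blueprint.label_injOn (hS hq) hp hqp] at hq
    · rw [← himage]
      refine image_mono ?_
      rintro _ ⟨p, ⟨hp1, hp2⟩, rfl⟩
      exact ⟨⟨p, hp1, rfl⟩, ⟨p, hp2, rfl⟩⟩
  · right
    obtain ⟨hxcl, hxT⟩ := hx
    obtain ⟨p, hp, rfl⟩ : x ∈ B.label i '' {p | p < 2 * B.rank i} := mem_ground_of_mem_closure hxcl
    rw [← Blueprint.image_label_wheelTriangle] at hxcl hxT ⊢
    rw [vectorMatroid_mem_closure_iff (image_mono Blueprint.wheelTriangle_subset)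
      (mem_image_of_mem _ hp), himage] at hxcl
    obtain ⟨hR2, rfl, hpar⟩ := (h.wheelRep i).eq_of_mem_span_triangle hR hp
      (fun hpT => hxT ⟨p, hpT, rfl⟩) hxcl
    have h3 : 3 = 2 * B.rank i - 1 := by omega
    refine ⟨B.label i 3, ⟨3, by rw [wheelTriangle, hR2]; simp, rfl⟩, ?_⟩
    have h3' : 3 < 2 * B.rank i := by omega
    rw [vectorMatroid_isCircuit_pair_iff (mem_image_of_mem _ hp) (mem_image_of_mem _ h3')]
    · refine ⟨?_, hpar⟩
      rw [h3, Blueprint.label_last_rim]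
      obtain ⟨c, hc0, hc⟩ := h.one i
      intro hz
      have hz' : base (B.corner i 1) = 0 := congr_arg Prod.fst hz
      rw [hc, smul_eq_zero, or_iff_right hc0] at hz'
      exact one_ne_zero (h.indep i 1 (-1) (by rw [one_smul, neg_one_smul, ← sub_eq_add_neg, hz'])).1
    · intro he
      have := Blueprint.label_injOn hp h3' he
      omega

/-- The vector matroid of the glued vectors is obtained from the base by gluing wheels. -/
theorem CornerVec.isGluing (h : CornerVec K B base a b) (hB : B.base.IsRepresentedBy K base) :
    B.IsGluing (vectorMatroid K (glueVec K base B.rank a b)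
      (B.glueGround t \ Sum.inl '' B.del)) := by
  refine ⟨fun n => vectorMatroid K (glueVec K base B.rank a b) (B.glueGround n), ?_, fun i => ?_, ?_⟩
  · have hg0 : B.glueGround 0 = Sum.inl '' B.base.E := by
      ext x; simp [Blueprint.glueGround]
    simp only [Fin.val_zero, hg0]
    refine ext_indep rfl fun I hI => ?_
    obtain ⟨I', hI', rfl⟩ := subset_image_iff.1 hI
    have hinl : LinearIndepOn K (glueVec K base B.rank a b) (Sum.inl '' I') ↔
        LinearIndepOn K base I' := by
      have hcomp : glueVec K base B.rank a b ∘ Sum.inl =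
          LinearMap.inl K V (Fin t × ℕ →₀ K) ∘ base := rfl
      constructor
      · intro hi
        have := hi.comp_of_image Sum.inl_injective.injOn
        rw [hcomp] at this
        exact LinearIndepOn.of_comp _ this
      · intro hi
        refine LinearIndepOn.image_of_comp _ _ ?_
        rw [hcomp]
        exact hi.map_injOn _ (LinearMap.inl_injective.injOn)
    rw [vectorMatroid_indep_iff, and_iff_right (image_mono hI'), map_indep_iff, hinl]
    constructor
    · exact fun hi => ⟨I', (hB I' hI').2 hi, rfl⟩
    · rintro ⟨I'', h1, h2⟩
      rw [Sum.inl_injective.image_injective h2]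
      exact (hB I'' h1.subset_ground).1 h1
  · exact ⟨Blueprint.label_injOn, h.isGenParallelConnection i _⟩
  · refine ext_indep rfl fun I hI => ?_
    have hI' : I ⊆ B.glueGround t \ Sum.inl '' B.del := hI
    rw [delete_indep_iff, vectorMatroid_indep_iff, vectorMatroid_indep_iff, and_iff_right hI',
      Fin.val_last, and_iff_right (hI'.trans sdiff_subset),
      and_iff_left (disjoint_of_subset_left hI' disjoint_sdiff_left)]

/-- The elements of a vector matroid that carry the glued vectors of consecutive positions of the
`j`-th wheel form a fan. -/
theorem CornerVec.posFan (h : CornerVec K B base a b) {lab : γ → β ⊕ (Fin t × ℕ)} {E : Set γ}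
    {lo hi : ℕ} {el : ℕ → γ} (hhi : hi ≤ 2 * B.rank j - 1)
    (hel : ∀ p, lo ≤ p → p < hi → el p ∈ E ∧ lab (el p) = B.label j p)
    (hE : ∀ e ∈ E, ∀ p, lab e = Sum.inr (j, p) → lo ≤ p ∧ p < hi ∧ e = el p) :
    (vectorMatroid K (glueVec K base B.rank a b ∘ lab) E).PosFan lo hi el := by
  have hrep := vectorMatroid_isRepresentedBy (K := K) (glueVec K base B.rank a b ∘ lab) E
  have hR := B.two_le_rank j
  have hinj : ∀ p q, lo ≤ p → p < hi → lo ≤ q → q < hi → el p = el q → p = q := by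
    intro p q hp1 hp2 hq1 hq2 he
    have := congr_arg lab he
    rw [(hel p hp1 hp2).2, (hel q hq1 hq2).2] at this
    exact Blueprint.label_injOn (by simp only [mem_ofPred_eq]; omega)
      (by simp only [mem_ofPred_eq]; omega) this
  have hne : ∀ p q, lo ≤ p → p < q → q < hi → el p ≠ el q := fun p q hp hpq hq he =>
    hpq.ne (hinj p q hp (by omega) (by omega) hq he)
  have hvec : ∀ p, lo ≤ p → p < hi → ∃ c : K, c ≠ 0 ∧ (glueVec K base B.rank a b ∘ lab) (el p) =
      c • wv (glueVertex K B.rank a b j) p := by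
    intro p h1 h2
    rw [Function.comp_apply, (hel p h1 h2).2]
    exact h.exists_glueVec_label_eq_wv (by omega)
  refine ⟨hinj, fun p h1 h2 => ?_⟩
  rcases Nat.even_or_odd' p with ⟨k, rfl | rfl⟩
  · refine ⟨fun _ => ?_, fun hb => by simp at hb⟩
    obtain ⟨c0, hc0, e0⟩ := hvec (2 * k) h1 (by omega)
    obtain ⟨c1, hc1, e1⟩ := hvec (2 * k + 1) (by omega) (by omega)
    obtain ⟨c2, hc2, e2⟩ := hvec (2 * (k + 1)) (by omega) h2
    rw [wv_even] at e0 e2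
    rw [wv_odd] at e1
    refine hrep.cyc_triple_of_relation (hel _ h1 (by omega)).1 (hel _ (by omega) (by omega)).1
      (hel _ (by omega) h2).1 (hne _ _ h1 (by omega) (by omega)) (hne _ _ h1 (by omega) h2)
      (hne _ _ (by omega) (by omega) h2) (x := c0⁻¹) (y := -c1⁻¹) (z := -c2⁻¹) (inv_ne_zero hc0)
      (neg_ne_zero.2 (inv_ne_zero hc1)) (neg_ne_zero.2 (inv_ne_zero hc2)) ?_
    rw [show 2 * k + 2 = 2 * (k + 1) by ring, e0, e1, e2, smul_smul, smul_smul, smul_smul, neg_mul,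
      neg_mul, inv_mul_cancel₀ hc0, inv_mul_cancel₀ hc1, inv_mul_cancel₀ hc2]
    module
  · refine ⟨fun hb => by simp at hb, fun _ => ?_⟩
    have hval : ∀ p, p + 1 < 2 * B.rank j →
        (glueCoord K V j (k + 1) (wv (glueVertex K B.rank a b j) p) ≠ 0 ↔
          p = 2 * k + 1 ∨ p = 2 * k + 2 ∨ p = 2 * k + 3) := by
      intro p hp
      have h0 : ∀ m, m ≠ k + 1 → glueCoord K V j (k + 1) (glueVertex K B.rank a b j m) = 0 :=
        fun m hm => glueCoord_ne (fun hc => hm (Prod.mk.inj hc).2.symm)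
      have h1 : glueCoord K V j (k + 1) (glueVertex K B.rank a b j (k + 1)) = 1 :=
        glueCoord_self (by omega) (by omega)
      rcases Nat.even_or_odd' p with ⟨m, rfl | rfl⟩
      · rw [wv_even]
        by_cases hm : m = k + 1
        · subst hm; rw [h1]; exact iff_of_true one_ne_zero (by omega)
        · rw [h0 m hm]; exact iff_of_false (by simp) (by omega)
      · rw [wv_odd, map_sub]
        by_cases hm : m = k + 1
        · subst hm; rw [h1, h0 _ (by omega), sub_zero]; exact iff_of_true one_ne_zero (by omega)
        · by_cases hm' : m = k
          · subst hm'; rw [h1, h0 _ hm, zero_sub]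
            exact iff_of_true (neg_ne_zero.2 one_ne_zero) (by omega)
          · rw [h0 m hm, h0 (m + 1) (by omega), sub_zero]; exact iff_of_false (by simp) (by omega)
    refine hrep.dual_cyc_of_functional ?_ (glueCoord K V j (k + 1)) ?_ ?_
    · rintro _ (rfl | rfl | rfl)
      · exact (hel _ h1 (by omega)).1
      · exact (hel _ (by omega) (by omega)).1
      · exact (hel _ (by omega) (by omega)).1
    · intro e he heT
      rw [Function.comp_apply]
      rcases hl : lab e with q | ⟨i, p⟩
      · rfl
      · by_cases hij : j = i
        · subst hij
          obtain ⟨hp1, hp2, rfl⟩ := hE e he p hl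
          by_contra hcon
          refine heT ?_
          have := (hval p (by omega)).1 hcon
          rcases this with rfl | rfl | rfl <;> simp
        · exact glueCoord_eq_zero_of_ne hij _ _
    · have hnz : ∀ p, lo ≤ p → p < hi → (p = 2 * k + 1 ∨ p = 2 * k + 2 ∨ p = 2 * k + 3) →
          glueCoord K V j (k + 1) ((glueVec K base B.rank a b ∘ lab) (el p)) ≠ 0 := by
        intro p hp1 hp2 hp
        obtain ⟨c, hc0, hc⟩ := hvec p hp1 hp2
        rw [hc, map_smul, smul_eq_mul]
        exact mul_ne_zero hc0 ((hval p (by omega)).2 hp)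
      rintro _ (rfl | rfl | rfl)
      · exact hnz _ h1 (by omega) (by omega)
      · exact hnz _ (by omega) (by omega) (by omega)
      · exact hnz _ (by omega) (by omega) (by omega)

end BlueprintVec

/-! ### A minor of the glued vector configuration -/

section Minor

variable {K V V' α : Type*} [Field K] [AddCommGroup V] [Module K V] [AddCommGroup V'] [Module K V']
  {N : Matroid α} {f : α → V} {h : α → V'} {E C : Set α}

/-- A criterion for a represented matroid `N` to be a minor of a vector matroid: a linear map takes
the vectors of the elements to be contracted to `0` and the vectors of the elements of `N` to
multiples of their vectors in `N`, and it is injective on these modulo the contracted vectors. -/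
theorem IsRepresentedBy.isMinor_vectorMatroid (hf : N.IsRepresentedBy K f) (hNE : N.E ⊆ E)
    (hCE : C ⊆ E) (hdisj : Disjoint C N.E) (Φ : V' →ₗ[K] V) (Ψ : V →ₗ[K] V')
    (h0 : ∀ e ∈ C, Φ (h e) = 0) (h1 : ∀ e ∈ N.E, ∃ c : K, c ≠ 0 ∧ Φ (h e) = c • f e)
    (h2 : ∀ e ∈ N.E, Ψ (Φ (h e)) - h e ∈ Submodule.span K (h '' C)) :
    N ≤m vectorMatroid K h E := by
  set G := vectorMatroid K h E
  suffices hN : N = (G ／ C) ↾ N.E by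
    rw [hN, ← delete_compl (show N.E ⊆ (G ／ C).E from subset_sdiff.2 ⟨hNE, hdisj.symm⟩)]
    exact contract_delete_isMinor _ _ _
  refine ext_indep rfl fun I hI => ?_
  obtain ⟨J, hJ⟩ := G.exists_isBasis C hCE
  have hJi := ((vectorMatroid_indep_iff _ _ _).1 hJ.indep).2
  set Q := Submodule.span K (h '' C) with hQ
  have hspan : Submodule.span K (h '' J) = Q :=
    (vectorMatroid_isRepresentedBy h E).span_eq_of_isBasis hJ
  have hdI : Disjoint C I := hdisj.mono_right hI
  have hdJ : Disjoint J I := hdI.mono_left hJ.subset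
  rw [restrict_indep_iff, and_iff_left hI, hJ.contract_indep_iff, and_iff_left hdI,
    vectorMatroid_indep_iff,
    and_iff_right (union_subset (hI.trans hNE) (hJ.subset.trans hCE)), union_comm,
    linearIndepOn_union_iff_quotient hdJ, and_iff_right hJi, hspan, hf I hI]
  have hΦ : Q ≤ LinearMap.ker Φ := by
    refine Submodule.span_le.2 ?_
    rintro _ ⟨e, he, rfl⟩
    exact h0 e he
  choose! c hc0 hc using h1
  have hscale : LinearIndepOn K f I ↔ LinearIndepOn K (Φ ∘ h) I := by
    constructor
    · intro hi
      have := LinearIndependent.units_smul hi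
        (fun e : I => Units.mk0 (c e) (hc0 e (hI e.2)))
      refine LinearIndepOn.congr (v := fun e => c e • f e) this fun e he => ?_
      exact (hc e (hI he)).symm
    · intro hi
      have := LinearIndependent.units_smul hi
        (fun e : I => Units.mk0 (c e)⁻¹ (inv_ne_zero (hc0 e (hI e.2))))
      refine LinearIndepOn.congr (v := fun e => (c e)⁻¹ • (Φ ∘ h) e) this fun e he => ?_
      simp only [Function.comp_apply]
      rw [hc e (hI he), smul_smul, inv_mul_cancel₀ (hc0 e (hI he)), one_smul]
  rw [hscale]
  constructor
  · intro hi
    have : LinearIndepOn K (Q.liftQ Φ hΦ ∘ (Q.mkQ ∘ h)) I := hi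
    exact LinearIndepOn.of_comp _ this
  · intro hi
    refine LinearIndepOn.of_comp (Q.mkQ ∘ₗ Ψ) (hi.congr fun e he => ?_)
    have := h2 e (hI he)
    rw [← neg_mem_iff, neg_sub] at this
    exact (Submodule.Quotient.eq Q).2 this

end Minor

section GlueMinor

variable {K V β α : Type*} [Field K] [AddCommGroup V] [Module K V] {t : ℕ} {M N : Matroid α}
  {f : α → V} {lo hi r R : Fin t → ℕ} {el : Fin t → ℕ → α} {u : Fin t → ℕ → V}
  {g : Fin t → ℕ → V →ₗ[K] K} {π : Fin t → ℕ → ℕ}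

/-- A family of disjoint fans of `M` that contain all the elements outside the minor `N`, with
coordinates for `N`. -/
structure FanPairs (K : Type*) {V α : Type*} [Field K] [AddCommGroup V] [Module K V] {t : ℕ}
    (M N : Matroid α) (f : α → V) (lo hi r R : Fin t → ℕ) (el : Fin t → ℕ → α)
    (u : Fin t → ℕ → V) (g : Fin t → ℕ → V →ₗ[K] K) (π : Fin t → ℕ → ℕ) : Prop where
  pair : ∀ j, FanPair K M N f (lo j) (hi j) (r j) (R j) (el j) (u j) (g j) (π j)
  disj : ∀ i j, i ≠ j → ∀ e ∈ posSet (lo i) (hi i) (el i), e ∉ posSet (lo j) (hi j) (el j)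
  cover : ∀ e ∈ M.E, e ∉ N.E → ∃ j, e ∈ posSet (lo j) (hi j) (el j)
  subset : N.E ⊆ M.E

/-- The vectors of the rim vertices in the glued configuration. -/
noncomputable abbrev fanVertex (K : Type*) {V : Type*} [Field K] [AddCommGroup V] {t : ℕ}
    (r R : Fin t → ℕ) (u : Fin t → ℕ → V) : Fin t → ℕ → V × (Fin t × ℕ →₀ K) :=
  glueVertex K R (fun j => u j 0) (fun j => u j (r j - 1))

/-- The linear map from the glued configuration to the configuration of `N` that contracts the
missing rim elements. -/
noncomputable def contractMap (u : Fin t → ℕ → V) (π : Fin t → ℕ → ℕ) :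
    V × (Fin t × ℕ →₀ K) →ₗ[K] V :=
  LinearMap.coprod LinearMap.id
    (Finsupp.linearCombination K (fun q : Fin t × ℕ => u q.1 (π q.1 q.2)))

/-- A right inverse of `contractMap` on the span of `N`: it lifts the interior rim vertex `m` of the
`j`-th fan of `N` to the rim vertex `κ j m`. -/
noncomputable def liftMap (r R : Fin t → ℕ) (u : Fin t → ℕ → V) (g : Fin t → ℕ → V →ₗ[K] K)
    (κ : Fin t → ℕ → ℕ) : V →ₗ[K] V × (Fin t × ℕ →₀ K) :=
  LinearMap.inl K V _ + ∑ j, ∑ l ∈ Finset.Ico 1 (r j - 1),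
    (g j l).smulRight (fanVertex K r R u j (κ j l) - (u j l, 0))

theorem FanPairs.two_le_rank (h : FanPairs K M N f lo hi r R el u g π) (j : Fin t) : 2 ≤ R j := by
  have h1 := (h.pair j).len
  have h2 := (h.pair j).hi_eq
  omega

theorem FanPairs.contractMap_vertex (h : FanPairs K M N f lo hi r R el u g π) (j : Fin t) (k : ℕ)
    : contractMap u π (fanVertex K r R u j k) = u j (π j k) := by
  rw [fanVertex, glueVertex]
  split_ifs with h0 h1
  · simp [contractMap, h0, (h.pair j).map_zero]
  · have : k = R j - 1 := by omega
    simp [contractMap, this, (h.pair j).map_last]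
  · simp [contractMap]

theorem FanPairs.contractMap_wv (h : FanPairs K M N f lo hi r R el u g π) (j : Fin t) (p : ℕ) :
    contractMap u π (wv (fanVertex K r R u j) p) = wv (fun k => u j (π j k)) p := by
  rcases Nat.even_or_odd' p with ⟨k, rfl | rfl⟩
  · rw [wv_even, wv_even, h.contractMap_vertex]
  · rw [wv_odd, wv_odd, map_sub, h.contractMap_vertex, h.contractMap_vertex]

theorem FanPair.map_step {lo hi r R : ℕ} {el : ℕ → α} {u : ℕ → V} {g : ℕ → V →ₗ[K] K}
    {π : ℕ → ℕ} (h : FanPair K M N f lo hi r R el u g π) {k : ℕ} (hk : k + 1 < R) :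
    π k ≤ π (k + 1) ∧ π (k + 1) ≤ π k + 1 := by
  have hr := h.hi_eq
  by_cases hN : el (2 * k + 1) ∈ N.E
  · have := h.map_succ k (by omega) hN; omega
  · have := h.map_eq k (by omega) hN; omega

theorem FanPair.map_mono {lo hi r R : ℕ} {el : ℕ → α} {u : ℕ → V} {g : ℕ → V →ₗ[K] K}
    {π : ℕ → ℕ} (h : FanPair K M N f lo hi r R el u g π) {k l : ℕ} (hkl : k ≤ l) (hl : l < R) :
    π k ≤ π l := by
  induction l, hkl using Nat.le_induction with
  | base => exact le_rfl
  | succ l _ ih => exact (ih (by omega)).trans (h.map_step hl).1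

theorem FanPair.map_lt {lo hi r R : ℕ} {el : ℕ → α} {u : ℕ → V} {g : ℕ → V →ₗ[K] K}
    {π : ℕ → ℕ} (h : FanPair K M N f lo hi r R el u g π) {k : ℕ} (hk : k < R) : π k < r := by
  have h1 := h.map_mono (show k ≤ R - 1 by omega) (by omega)
  have h2 := h.two_le
  rw [h.map_last] at h1
  omega

theorem FanPair.exists_map_eq {lo hi r R : ℕ} {el : ℕ → α} {u : ℕ → V} {g : ℕ → V →ₗ[K] K}
    {π : ℕ → ℕ} (h : FanPair K M N f lo hi r R el u g π) {m : ℕ} (hm : m < r) :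
    ∃ k, k < R ∧ π k = m := by
  have hlen := h.len
  have hr := h.hi_eq
  have key : ∀ l, l < R → m ≤ π l → ∃ k, k < R ∧ π k = m := by
    intro l
    induction l with
    | zero =>
      intro hl hml
      rw [h.map_zero] at hml
      exact ⟨0, hl, by rw [h.map_zero]; omega⟩
    | succ l ih =>
      intro hl hml
      by_cases hml' : m ≤ π l
      · exact ih (by omega) hml'
      · have := (h.map_step hl).2
        exact ⟨l + 1, hl, by omega⟩
  exact key (R - 1) (by omega) (by rw [h.map_last]; omega)

theorem FanPairs.liftMap_vertex (h : FanPairs K M N f lo hi r R el u g π) {κ : Fin t → ℕ → ℕ}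
    (hκ : ∀ j m, m < r j → κ j m < R j ∧ π j (κ j m) = m) (j : Fin t) {m : ℕ} (hm : m < r j) :
    ∃ k, k < R j ∧ π j k = m ∧ liftMap r R u g κ (u j m) = fanVertex K r R u j k := by
  have hR := h.two_le_rank j
  have hr2 := (h.pair j).two_le
  have hother : ∀ i, i ≠ j → ∀ l ∈ Finset.Ico 1 (r i - 1),
      (g i l).smulRight (fanVertex K r R u i (κ i l) - (u i l, 0)) (u j m) = 0 := by
    intro i hij l hl
    rw [Finset.mem_Ico] at hl
    have : Submodule.span K (f '' (posSet (lo j) (hi j) (el j) ∩ N.E)) ≤ LinearMap.ker (g i l) := by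
      refine Submodule.span_le.2 ?_
      rintro _ ⟨e, ⟨he1, he2⟩, rfl⟩
      exact (h.pair i).dual_off l hl.1 (by omega) e he2 (h.disj j i hij.symm e he1)
    have h0 : g i l (u j m) = 0 := this ((h.pair j).mem_span m hm)
    rw [LinearMap.smulRight_apply, h0, zero_smul]
  have hsum : liftMap r R u g κ (u j m) = (u j m, 0) + ∑ l ∈ Finset.Ico 1 (r j - 1),
      (g j l (u j m)) • (fanVertex K r R u j (κ j l) - (u j l, 0)) := by
    rw [liftMap, LinearMap.add_apply, LinearMap.inl_apply, LinearMap.sum_apply,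
      Finset.sum_eq_single j]
    · rw [LinearMap.sum_apply]; rfl
    · intro i _ hij
      rw [LinearMap.sum_apply]
      exact Finset.sum_eq_zero (hother i hij)
    · intro hj; exact absurd (Finset.mem_univ j) hj
  by_cases hint : 1 ≤ m ∧ m + 2 ≤ r j
  · refine ⟨κ j m, (hκ j m hm).1, (hκ j m hm).2, ?_⟩
    rw [hsum, Finset.sum_eq_single m, (h.pair j).dual_self m hint.1 hint.2, one_smul]
    · abel
    · intro l hl hlm
      rw [Finset.mem_Ico] at hl
      rw [(h.pair j).dual_ne l hl.1 (by omega) m hm hlm.symm, zero_smul]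
    · intro hl; exact absurd (Finset.mem_Ico.2 ⟨hint.1, by omega⟩) hl
  · have h0 : liftMap r R u g κ (u j m) = (u j m, 0) := by
      rw [hsum, Finset.sum_eq_zero, add_zero]
      intro l hl
      rw [Finset.mem_Ico] at hl
      rw [(h.pair j).dual_ne l hl.1 (by omega) m hm (by omega), zero_smul]
    by_cases hm0 : m = 0
    · subst hm0
      exact ⟨0, by omega, (h.pair j).map_zero, by
        rw [h0, fanVertex, glueVertex, if_pos rfl]⟩
    · have : m = r j - 1 := by omega
      subst this
      exact ⟨R j - 1, by omega, (h.pair j).map_last, by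
        rw [h0, fanVertex, glueVertex, if_neg (by omega), if_pos (by omega)]⟩

/-- The glued configuration has `N` as a minor: the missing rim elements are contracted, and the
missing spoke elements are deleted. -/
theorem FanPairs.isMinor (h : FanPairs K M N f lo hi r R el u g π) (hf : N.IsRepresentedBy K f)
    {v : α → V × (Fin t × ℕ →₀ K)}
    (hv : ∀ j p, lo j ≤ p → p < hi j →
      ∃ c : K, c ≠ 0 ∧ v (el j p) = c • wv (fanVertex K r R u j) p)
    (hv' : ∀ e ∈ N.E, (∀ j, e ∉ posSet (lo j) (hi j) (el j)) → ∃ c : K, c ≠ 0 ∧ v e = (c • f e, 0)) :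
    N ≤m vectorMatroid K v M.E := by
  set C : Set α := {e | e ∈ M.E ∧ e ∉ N.E ∧ ∃ j k, 2 * k + 1 < hi j ∧ el j (2 * k + 1) = e} with hC
  have hsur : ∀ j m, m < r j → ∃ k, k < R j ∧ π j k = m := fun j m hm =>
    (h.pair j).exists_map_eq hm
  choose! κ hκ using hsur
  set Q := Submodule.span K (v '' C) with hQ
  -- rim vertices with the same image are equal modulo the contracted rim elements
  have hmod : ∀ j k l, k ≤ l → l < R j → π j k = π j l →
      fanVertex K r R u j k - fanVertex K r R u j l ∈ Q := by
    intro j k l hkl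
    induction l, hkl using Nat.le_induction with
    | base => intro _ _; rw [sub_self]; exact Q.zero_mem
    | succ l hkl ih =>
      intro hl hπ
      have h1 := (h.pair j).map_mono hkl (by omega)
      have h2 := (h.pair j).map_step hl
      have hhi := (h.pair j).hi_eq
      have hlo := (h.pair j).lo_le
      rw [← sub_add_sub_cancel _ (fanVertex K r R u j l)]
      refine Q.add_mem (ih (by omega) (by omega)) ?_
      obtain ⟨c, hc0, hc⟩ := hv j (2 * l + 1) (by omega) (by omega)
      rw [wv_odd] at hc
      rw [← Submodule.smul_mem_iff _ hc0, ← hc]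
      have hN : el j (2 * l + 1) ∉ N.E := by
        intro hN
        have := (h.pair j).map_succ l (by omega) hN
        omega
      exact Submodule.subset_span ⟨_, ⟨(h.pair j).posFan.mem_ground (h.pair j).len (by omega)
        (by omega), hN, j, l, by omega, rfl⟩, rfl⟩
  have hlift : ∀ j k, k < R j →
      liftMap r R u g κ (contractMap u π (fanVertex K r R u j k)) - fanVertex K r R u j k ∈ Q := by
    intro j k hk
    obtain ⟨l, hl, hlk, hlift⟩ := h.liftMap_vertex hκ j ((h.pair j).map_lt hk)
    rw [h.contractMap_vertex, hlift]
    rcases le_total l k with hle | hle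
    · exact hmod j l k hle hk hlk
    · rw [← neg_sub]; exact Q.neg_mem (hmod j k l hle hl hlk.symm)
  refine hf.isMinor_vectorMatroid h.subset (C := C) (fun e he => he.1)
    (disjoint_left.2 fun e he => he.2.1) (contractMap u π) (liftMap r R u g κ) ?_ ?_ ?_
  · rintro _ ⟨-, heN, j, k, hk, rfl⟩
    have hlo := (h.pair j).lo_le
    obtain ⟨c, hc0, hc⟩ := hv j (2 * k + 1) (by omega) hk
    rw [hc, map_smul, h.contractMap_wv, wv_odd, (h.pair j).map_eq k hk heN, sub_self, smul_zero]
  · intro e he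
    by_cases hfan : ∃ j, e ∈ posSet (lo j) (hi j) (el j)
    · obtain ⟨j, p, hp1, hp2, rfl⟩ := hfan
      obtain ⟨c, hc0, hc⟩ := hv j p hp1 hp2
      obtain ⟨d, hd0, hd⟩ := (h.pair j).vec p hp1 hp2 he
      refine ⟨c * d⁻¹, mul_ne_zero hc0 (inv_ne_zero hd0), ?_⟩
      rw [hc, hd, map_smul, h.contractMap_wv, smul_smul, inv_mul_cancel_right₀ hd0]
    · push Not at hfan
      obtain ⟨c, hc0, hc⟩ := hv' e he hfan
      exact ⟨c, hc0, by rw [hc]; simp [contractMap]⟩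
  · intro e he
    by_cases hfan : ∃ j, e ∈ posSet (lo j) (hi j) (el j)
    · obtain ⟨j, p, hp1, hp2, rfl⟩ := hfan
      have hhi := (h.pair j).hi_eq
      obtain ⟨c, hc0, hc⟩ := hv j p hp1 hp2
      rw [hc, map_smul, map_smul]
      suffices hQ' : liftMap r R u g κ (contractMap u π (wv (fanVertex K r R u j) p)) -
          wv (fanVertex K r R u j) p ∈ Q by
        have := Q.smul_mem c hQ'
        rwa [smul_sub] at this
      rcases Nat.even_or_odd' p with ⟨k, rfl | rfl⟩
      · rw [wv_even]; exact hlift j k (by omega)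
      · rw [wv_odd, map_sub, map_sub, sub_sub_sub_comm]
        exact Q.sub_mem (hlift j k (by omega)) (hlift j (k + 1) (by omega))
    · push Not at hfan
      obtain ⟨c, hc0, hc⟩ := hv' e he hfan
      have h1 : contractMap u π (v e) = c • f e := by rw [hc]; simp [contractMap]
      have h2 : liftMap r R u g κ (f e) = (f e, 0) := by
        rw [liftMap, LinearMap.add_apply, LinearMap.inl_apply, LinearMap.sum_apply,
          Finset.sum_eq_zero, add_zero]
        intro j _
        rw [LinearMap.sum_apply]
        refine Finset.sum_eq_zero fun l hl => ?_
        rw [Finset.mem_Ico] at hl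
        rw [LinearMap.smulRight_apply, (h.pair j).dual_off l hl.1 (by omega) e he (hfan j), zero_smul]
      rw [h1, map_smul, h2, hc, Prod.smul_mk, smul_zero, sub_self]
      exact Q.zero_mem

end GlueMinor

/-! ### Labelling the elements by those of the glued matroid -/

section Tools

variable {K V α β : Type*} [Field K] [AddCommGroup V] [Module K V] {N M : Matroid α} {f : α → V}

/-- Two independent vectors and their difference give a triangle. -/
theorem IsRepresentedBy.isTriangle (hf : N.IsRepresentedBy K f) {a b c : α} (ha : a ∈ N.E)
    (hb : b ∈ N.E) (hc : c ∈ N.E) (hab : a ≠ b) (hac : a ≠ c) (hbc : b ≠ c) {x y : V}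
    (hxy : ∀ s t : K, s • x + t • y = 0 → s = 0 ∧ t = 0) (hx : ∃ k : K, k ≠ 0 ∧ f a = k • x)
    (hx' : ∃ k : K, k ≠ 0 ∧ f b = k • (x - y)) (hy : ∃ k : K, k ≠ 0 ∧ f c = k • y) :
    N.IsTriangle {a, b, c} := by
  obtain ⟨k, hk, ea⟩ := hx
  obtain ⟨l, hl, eb⟩ := hx'
  obtain ⟨m, hm, ec⟩ := hy
  refine ⟨?_, encard_eq_three.2 ⟨a, b, c, hab, hac, hbc, rfl⟩⟩
  have hcyc : N.Cyc {a, b, c} := by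
    refine hf.cyc_triple_of_relation ha hb hc hab hac hbc (inv_ne_zero hk)
      (neg_ne_zero.2 (inv_ne_zero hl)) (neg_ne_zero.2 (inv_ne_zero hm)) ?_
    rw [ea, eb, ec, smul_smul, smul_smul, smul_smul, neg_mul, neg_mul, inv_mul_cancel₀ hk,
      inv_mul_cancel₀ hl, inv_mul_cancel₀ hm]
    module
  have iab : N.Indep {a, b} := by
    rw [hf _ (insert_subset ha (singleton_subset_iff.2 hb)), LinearIndepOn.pair_iff _ hab]
    intro s t hst
    have := hxy (s * k + t * l) (-(t * l)) (by rw [← hst, ea, eb]; module)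
    grind
  have iac : N.Indep {a, c} := by
    rw [hf _ (insert_subset ha (singleton_subset_iff.2 hc)), LinearIndepOn.pair_iff _ hac]
    intro s t hst
    have := hxy (s * k) (t * m) (by rw [← hst, ea, ec]; module)
    grind
  have ibc : N.Indep {b, c} := by
    rw [hf _ (insert_subset hb (singleton_subset_iff.2 hc)), LinearIndepOn.pair_iff _ hbc]
    intro s t hst
    have := hxy (s * l) (t * m - s * l) (by rw [← hst, eb, ec]; module)
    grind
  rw [isCircuit_iff_forall_ssubset]
  refine ⟨⟨fun hi => ?_, hcyc.subset_ground⟩, fun I hI => ?_⟩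
  · exact hi.notMem_closure_sdiff_of_mem (show a ∈ _ by simp) (hcyc a (by simp))
  · obtain ⟨z, hz, hzI⟩ := exists_of_ssubset hI
    have hI' : ∀ y ∈ I, y ≠ z ∧ (y = a ∨ y = b ∨ y = c) := fun y hy =>
      ⟨fun h => hzI (h ▸ hy), hI.subset hy⟩
    rcases hz with rfl | rfl | rfl
    · exact ibc.subset fun y hy => by have := hI' y hy; simp; tauto
    · exact iac.subset fun y hy => by have := hI' y hy; simp; tauto
    · exact iab.subset fun y hy => by have := hI' y hy; simp; tauto

theorem Cyc.of_map {φ : α → β} {hφ : InjOn φ M.E} {a b : α} (ha : a ∈ M.E) (hb : b ∈ M.E)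
    (h : (M.map φ hφ).Cyc {φ a, φ b}) : M.Cyc {a, b} := by
  have key : ∀ e ∈ ({a, b} : Set α), e ∈ M.closure ({a, b} \ {e}) := by
    intro e he
    have heE : e ∈ M.E := by rcases he with rfl | rfl <;> assumption
    have h1 := h (φ e) (by rcases he with rfl | rfl <;> simp)
    rw [map_closure_eq] at h1
    obtain ⟨e', he', hee⟩ := h1
    rw [hφ (mem_ground_of_mem_closure he') heE hee] at he'
    rw [← closure_inter_ground] at he'
    refine M.closure_subset_closure ?_ he'
    rintro x ⟨⟨hx1, hx2⟩, hxE⟩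
    refine ⟨?_, fun hxe => hx2 (by rw [mem_singleton_iff.1 hxe]; rfl)⟩
    rcases hx1 with hx1 | hx1
    · exact .inl (hφ hxE ha hx1)
    · exact .inr (hφ hxE hb hx1)
  exact key

theorem Tame.map (h : M.Tame) {φ : α → β} (hφ : InjOn φ M.E) : (M.map φ hφ).Tame := by
  have aux : ∀ {M : Matroid α} (hφ : InjOn φ M.E), (∀ a b, ¬ M.Cyc {a, b}) →
      ∀ a b, ¬ (M.map φ hφ).Cyc {a, b} := by
    intro M hφ h a b hab
    obtain ⟨a', ha', rfl⟩ := hab.subset_ground (show a ∈ _ by simp)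
    obtain ⟨b', hb', rfl⟩ := hab.subset_ground (show b ∈ _ by simp)
    exact h a' b' (hab.of_map ha' hb')
  refine fun a b => ⟨aux hφ (fun a b => (h a b).1) a b, ?_⟩
  rw [map_dual]
  exact aux (M := M✶) hφ (fun a b => (h a b).2) a b

/-- A matroid represented by vectors that are pulled back along an injection is carried by the
injection to the vector matroid on the image. -/
theorem IsRepresentedBy.map_eq_vectorMatroid {v : β → V} {φ : α → β}
    (hM : M.IsRepresentedBy K (v ∘ φ)) (hφ : InjOn φ M.E) :
    M.map φ hφ = vectorMatroid K v (φ '' M.E) := by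
  refine ext_indep rfl fun I hI => ?_
  obtain ⟨I', hI', rfl⟩ := subset_image_iff.1 (show I ⊆ φ '' M.E from hI)
  rw [map_indep_iff, vectorMatroid_indep_iff, and_iff_right (image_mono hI')]
  constructor
  · rintro ⟨I'', h1, h2⟩
    rw [h2]
    exact LinearIndepOn.image_of_comp _ _ ((hM _ h1.subset_ground).1 h1)
  · intro h1
    exact ⟨I', (hM _ hI').2 (h1.comp_of_image (hφ.mono hI')), rfl⟩

/-- Elements with the same vector would be parallel. -/
theorem IsRepresentedBy.injOn_of_comp {v : β → V} {φ : α → β} (hM : M.IsRepresentedBy K (v ∘ φ))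
    (ht : M.Tame) : InjOn φ M.E := by
  intro a ha b hb hab
  by_contra hne
  exact (ht a b).1 (hM.cyc_pair_of_smul ha hb hne one_ne_zero (by simp [hab]))

end Tools

section Labelling

variable {K V α : Type*} [Field K] [AddCommGroup V] [Module K V] {t : ℕ} {M N : Matroid α}
  {f : α → V} {lo hi r : Fin t → ℕ} {el : Fin t → ℕ → α} {u : Fin t → ℕ → V}
  {g : Fin t → ℕ → V →ₗ[K] K} {π : Fin t → ℕ → ℕ} {B : Blueprint (α ⊕ (Fin t × Fin 3)) t}
  {base : α ⊕ (Fin t × Fin 3) → V} {φ : α → (α ⊕ (Fin t × Fin 3)) ⊕ (Fin t × ℕ)} {j : Fin t} {p : ℕ}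

/-- `e` is parallel to one of the points `a` and `c`, namely the one with the index `q`. -/
def IsParallelToEnd (K : Type*) {V α : Type*} [Field K] [AddCommGroup V] [Module K V] {t : ℕ}
    (f : α → V) (base : α ⊕ (Fin t × Fin 3) → V) (e : α) (q : Fin t × Fin 3) : Prop :=
  q.2 ≠ 1 ∧ ∃ c : K, c ≠ 0 ∧ f e = c • base (Sum.inr q)

/-- `φ` labels the elements of `M` by elements of the matroid that is glued from the blueprint `B`:
an element of a fan gets the label of its position, an element outside the fans that is parallel to
a corner `a` or `c` gets the label of such a corner, and each other element labels itself. The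
base of `B` consists of the corners and of these other elements, and the corners that are not
labels are deleted. -/
structure IsLabelling (K : Type*) {V α : Type*} [Field K] [AddCommGroup V] [Module K V] {t : ℕ}
    (M N : Matroid α) (f : α → V) (lo hi : Fin t → ℕ) (el : Fin t → ℕ → α)
    (B : Blueprint (α ⊕ (Fin t × Fin 3)) t) (base : α ⊕ (Fin t × Fin 3) → V)
    (φ : α → (α ⊕ (Fin t × Fin 3)) ⊕ (Fin t × ℕ)) : Prop where
  corner : ∀ i c, B.corner i c = Sum.inr (i, c)
  inl_mem : ∀ e, Sum.inl e ∈ B.base.E ↔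
    e ∈ N.E ∧ (∀ j, e ∉ posSet (lo j) (hi j) (el j)) ∧ ∀ q, ¬ IsParallelToEnd K f base e q
  base_inl : ∀ e, base (Sum.inl e) = f e
  del : B.del = {x | ∃ q, Sum.inr q = x ∧ Sum.inl (Sum.inr q) ∉ φ '' M.E}
  fan : ∀ j p, lo j ≤ p → p < hi j → φ (el j p) = B.label j p
  off : ∀ e, (∀ j, e ∉ posSet (lo j) (hi j) (el j)) →
    (∃ q, IsParallelToEnd K f base e q ∧ φ e = Sum.inl (Sum.inr q)) ∨
      ((∀ q, ¬ IsParallelToEnd K f base e q) ∧ φ e = Sum.inl (Sum.inl e))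

theorem IsLabelling.inr_mem (h : IsLabelling K M N f lo hi el B base φ) (q : Fin t × Fin 3) :
    Sum.inr q ∈ B.base.E := by
  rw [← h.corner q.1 q.2]
  exact Blueprint.corner_mem _

theorem IsLabelling.mem_del (h : IsLabelling K M N f lo hi el B base φ) (q : Fin t × Fin 3) :
    Sum.inr q ∈ B.del ↔ Sum.inl (Sum.inr q) ∉ φ '' M.E := by
  rw [h.del]
  constructor
  · rintro ⟨q', hq, hq'⟩
    rwa [Sum.inr.inj hq] at hq'
  · exact fun hq => ⟨q, rfl, hq⟩

theorem Blueprint.inr_mem_glueGround {B : Blueprint (α ⊕ (Fin t × Fin 3)) t} :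
    Sum.inr (j, p) ∈ B.glueGround t ↔ 1 ≤ p ∧ p + 2 < 2 * B.rank j := by
  constructor
  · rintro (⟨y, -, hy⟩ | ⟨i, -, q, hq, hq'⟩)
    · simp at hy
    · rcases Blueprint.label_cases hq with rfl | rfl | rfl | ⟨h1, h2⟩
      · simp [label_zero] at hq'
      · simp [label_last_spoke] at hq'
      · simp [label_last_rim] at hq'
      · rw [label_of_lt h1 h2] at hq'
        obtain ⟨rfl, rfl⟩ := Prod.mk.inj (Sum.inr.inj hq')
        exact ⟨h1, h2⟩
  · rintro ⟨h1, h2⟩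
    exact .inr ⟨j, j.2, p, by omega, label_of_lt h1 h2⟩

theorem Blueprint.label_mem_glueGround {B : Blueprint (α ⊕ (Fin t × Fin 3)) t}
    (hp : p < 2 * B.rank j) : B.label j p ∈ B.glueGround t := .inr ⟨j, j.2, p, hp, rfl⟩

/-- The labels are the elements of the glued matroid that are not deleted. -/
theorem IsLabelling.image_eq (h : IsLabelling K M N f lo hi el B base φ)
    (hp : FanPairs K M N f lo hi r B.rank el u g π) :
    φ '' M.E = B.glueGround t \ Sum.inl '' B.del := by
  refine subset_antisymm ?_ ?_
  · intro x hx
    refine ⟨?_, ?_⟩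
    · obtain ⟨e, he, rfl⟩ := hx
      by_cases hfan : ∃ j, e ∈ posSet (lo j) (hi j) (el j)
      · obtain ⟨j, p, hp1, hp2, rfl⟩ := hfan
        have := (hp.pair j).hi_eq
        rw [h.fan j p hp1 hp2]
        exact Blueprint.label_mem_glueGround (by omega)
      · push Not at hfan
        left
        rcases h.off e hfan with ⟨q, -, hq⟩ | ⟨hq, he'⟩
        · rw [hq]; exact mem_image_of_mem _ (h.inr_mem q)
        · rw [he']
          refine mem_image_of_mem _ ((h.inl_mem e).2 ⟨?_, hfan, hq⟩)
          by_contra heN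
          obtain ⟨j, hj⟩ := hp.cover e he heN
          exact hfan j hj
    · rintro ⟨y, hy, rfl⟩
      have hy' := hy
      rw [h.del] at hy'
      obtain ⟨q, rfl, -⟩ := hy'
      exact (h.mem_del q).1 hy hx
  · rintro ((e | q) | ⟨j, p⟩) ⟨hx1, hx2⟩
    · have he : Sum.inl e ∈ B.base.E := by
        rcases hx1 with ⟨y, hy, hye⟩ | ⟨i, -, q, hq, hq'⟩
        · rwa [← Sum.inl.inj hye]
        · rcases Blueprint.label_cases hq with rfl | rfl | rfl | ⟨h1, h2⟩
          · simp [Blueprint.label_zero, h.corner] at hq'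
          · simp [Blueprint.label_last_spoke, h.corner] at hq'
          · simp [Blueprint.label_last_rim, h.corner] at hq'
          · simp [Blueprint.label_of_lt h1 h2] at hq'
      obtain ⟨heN, hfan, hpar⟩ := (h.inl_mem e).1 he
      refine ⟨e, hp.subset heN, ?_⟩
      rcases h.off e hfan with ⟨q, hq, -⟩ | ⟨-, h1⟩
      · exact (hpar q hq).elim
      · exact h1
    · by_contra hcon
      exact hx2 ⟨_, (h.mem_del q).2 hcon, rfl⟩
    · obtain ⟨h1, h2⟩ := Blueprint.inr_mem_glueGround.1 hx1
      have h3 := (hp.pair j).hi_eq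
      have h4 := (hp.pair j).lo_le
      refine ⟨el j p, (hp.pair j).posFan.mem_ground (hp.pair j).len (by omega) (by omega), ?_⟩
      rw [h.fan j p (by omega) (by omega), Blueprint.label_of_lt h1 h2]

theorem IsLabelling.eq_of_eq_inr (h : IsLabelling K M N f lo hi el B base φ)
    (hp : FanPairs K M N f lo hi r B.rank el u g π) {e : α} (hep : φ e = Sum.inr (j, p)) :
    lo j ≤ p ∧ p < hi j ∧ e = el j p := by
  by_cases hfan : ∃ j, e ∈ posSet (lo j) (hi j) (el j)
  · obtain ⟨i, q, hq1, hq2, rfl⟩ := hfan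
    have := (hp.pair i).hi_eq
    rw [h.fan i q hq1 hq2] at hep
    obtain h1 | h1 | h1 | ⟨h1, h2⟩ := Blueprint.label_cases (B := B) (j := i) (p := q) (by omega)
    · simp [h1, Blueprint.label_zero] at hep
    · simp [h1, Blueprint.label_last_spoke] at hep
    · simp [h1, Blueprint.label_last_rim] at hep
    · rw [Blueprint.label_of_lt h1 h2] at hep
      obtain ⟨rfl, rfl⟩ := Prod.mk.inj (Sum.inr.inj hep)
      exact ⟨hq1, hq2, rfl⟩
  · push Not at hfan
    rcases h.off e hfan with ⟨q, -, hq⟩ | ⟨-, hq⟩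
    · simp [hq] at hep
    · simp [hq] at hep

/-- The glued vectors represent `M`. Both `M` and the matroid they represent have `N` as a minor,
and they have the given fans. -/
theorem IsLabelling.isRepresentedBy [M.Finite] (h : IsLabelling K M N f lo hi el B base φ)
    (hp : FanPairs K M N f lo hi r B.rank el u g π)
    (hc : CornerVec K B base (fun j => u j 0) (fun j => u j (r j - 1)))
    (hf : N.IsRepresentedBy K f) (ht : N.Tame) (hNM : N ≤m M) {τ : Fin t → α → Bool}
    (hτ : ∀ j p, lo j ≤ p → p < hi j → τ j (el j p) = decide (Odd p))
    (h3 : ∀ j, 3 ≤ ({y | y ∈ posList (lo j) (hi j) (el j)} ∩ N.E).encard) :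
    M.IsRepresentedBy K
      (glueVec K base B.rank (fun j => u j 0) (fun j => u j (r j - 1)) ∘ φ) := by
  suffices hM : M = vectorMatroid K
      (glueVec K base B.rank (fun j => u j 0) (fun j => u j (r j - 1)) ∘ φ) M.E from
    hM ▸ vectorMatroid_isRepresentedBy _ M.E
  have hfin : (M.E \ N.E).Finite := M.ground_finite.subset sdiff_subset
  refine eq_of_weakFans ht τ (M.E \ N.E).ncard M _ (fun j => posList (lo j) (hi j) (el j))
    hfin.cast_ncard_eq.symm.le rfl hNM ?_ (fun j => (hp.pair j).posFan.weakFan (hτ j))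
    (fun j => (hc.posFan (j := j) ?_ ?_ ?_).weakFan (hτ j)) ?_ ?_ h3
  · refine hp.isMinor hf (fun j p hp1 hp2 => ?_) fun e he hfan => ?_
    · have := (hp.pair j).hi_eq
      rw [Function.comp_apply, h.fan j p hp1 hp2]
      exact hc.exists_glueVec_label_eq_wv (by omega)
    · rcases h.off e hfan with ⟨q, ⟨-, c, hc0, hce⟩, hq⟩ | ⟨-, hq⟩
      · refine ⟨c⁻¹, inv_ne_zero hc0, ?_⟩
        rw [Function.comp_apply, hq, glueVec, Sum.elim_inl, hce, smul_smul, inv_mul_cancel₀ hc0,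
          one_smul]
      · refine ⟨1, one_ne_zero, ?_⟩
        rw [Function.comp_apply, hq, glueVec, Sum.elim_inl, h.base_inl, one_smul]
  · have := (hp.pair j).hi_eq; omega
  · exact fun p hp1 hp2 => ⟨(hp.pair j).posFan.mem_ground (hp.pair j).len hp1 hp2,
      h.fan j p hp1 hp2⟩
  · exact fun e _ p hep => h.eq_of_eq_inr hp hep
  · intro i j hij x hxi hxj
    rw [mem_posList] at hxi hxj
    exact hp.disj i j hij x hxi hxj
  · rintro e ⟨he1, he2⟩
    obtain ⟨j, hj⟩ := hp.cover e he1 he2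
    exact ⟨j, mem_posList.2 hj⟩

/-- The canonical fan occupies consecutive positions that include those of the given fan. -/
theorem IsLabelling.exists_canonicalFan_eq (h : IsLabelling K M N f lo hi el B base φ)
    (hp : FanPairs K M N f lo hi r B.rank el u g π) (j : Fin t) :
    ∃ lo' hi', lo' ≤ lo j ∧ hi j ≤ hi' ∧ hi' ≤ 2 * B.rank j - 1 ∧
      B.canonicalFan j = posList lo' hi' (B.label j) ∧
      ∀ p, lo' ≤ p → p < hi' → B.label j p ∈ φ '' M.E := by
  classical
  have hR := B.two_le_rank j
  have hhi := (hp.pair j).hi_eq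
  have hlo := (hp.pair j).lo_le
  have hlen := (hp.pair j).len
  have himg := h.image_eq hp
  have hmem : ∀ p < 2 * B.rank j, (B.label j p ∈ φ '' M.E ↔ B.label j p ∉ Sum.inl '' B.del) :=
    fun p hp' => by
      rw [himg]; exact and_iff_right (Blueprint.label_mem_glueGround hp')
  have hfan : ∀ p, lo j ≤ p → p < hi j → B.label j p ∈ φ '' M.E := fun p h1 h2 =>
    ⟨el j p, (hp.pair j).posFan.mem_ground hlen h1 h2, h.fan j p h1 h2⟩
  have hcan : B.canonicalFan j =
      (posList 0 (2 * B.rank j - 1) (B.label j)).filter (fun x => x ∈ φ '' M.E) := by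
    rw [Blueprint.canonicalFan, posList, Nat.sub_zero, List.range_eq_range']
    refine List.filter_congr fun x hx => ?_
    obtain ⟨p, hp', rfl⟩ := List.mem_map.1 hx
    rw [List.mem_range'_1] at hp'
    have := hmem p (by omega)
    simp only [this]
  have hmid : ∀ p q, (∀ s, p ≤ s → s < q → B.label j s ∈ φ '' M.E) →
      (posList p q (B.label j)).filter (fun x => x ∈ φ '' M.E) = posList p q (B.label j) := by
    intro p q hpq
    refine List.filter_eq_self.2 fun x hx => ?_
    obtain ⟨s, h1, h2, rfl⟩ := mem_posList.1 hx
    exact decide_eq_true (hpq s h1 h2)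
  obtain ⟨lo', hlo', h1, h2⟩ : ∃ lo', lo' ≤ lo j ∧ (∀ s, lo' ≤ s → s < 1 → B.label j s ∈ φ '' M.E) ∧
      (posList 0 1 (B.label j)).filter (fun x => x ∈ φ '' M.E) = posList lo' 1 (B.label j) := by
    by_cases h0 : B.label j 0 ∈ φ '' M.E
    · refine ⟨0, by omega, fun s _ hs => ?_, hmid 0 1 fun s _ hs => ?_⟩ <;>
      · obtain rfl : s = 0 := by omega
        exact h0
    · have : lo j ≠ 0 := fun hl => h0 (hfan 0 (by omega) (by omega))
      refine ⟨1, by omega, by omega, ?_⟩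
      simp [posList, h0, -mem_image]
  obtain ⟨hi', hhi', hhi'', h3, h4⟩ : ∃ hi', hi j ≤ hi' ∧
      (hi' = 2 * B.rank j - 2 ∨ hi' = 2 * B.rank j - 1) ∧
      (∀ s, 2 * B.rank j - 2 ≤ s → s < hi' → B.label j s ∈ φ '' M.E) ∧
      (posList (2 * B.rank j - 2) (2 * B.rank j - 1) (B.label j)).filter (fun x => x ∈ φ '' M.E) =
        posList (2 * B.rank j - 2) hi' (B.label j) := by
    by_cases h0 : B.label j (2 * B.rank j - 2) ∈ φ '' M.E
    · refine ⟨2 * B.rank j - 1, by omega, by omega, fun s _ hs => ?_, hmid _ _ fun s _ hs => ?_⟩ <;>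
      · obtain rfl : s = 2 * B.rank j - 2 := by omega
        exact h0
    · have : hi j ≠ 2 * B.rank j - 1 := fun hl => h0 (hfan _ (by omega) (by omega))
      refine ⟨2 * B.rank j - 2, by omega, by omega, by omega, ?_⟩
      have h5 : 2 * B.rank j - 1 - (2 * B.rank j - 2) = 1 := by omega
      simp [posList, h0, h5, -mem_image]
  have h5 : ∀ s, 1 ≤ s → s < 2 * B.rank j - 2 → B.label j s ∈ φ '' M.E :=
    fun s hs1 hs2 => hfan s (by omega) (by omega)
  refine ⟨lo', hi', hlo', hhi', by omega, ?_, fun p hp1 hp2 => ?_⟩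
  · rw [hcan, posList_append (p := 1) (by omega) (by omega),
      posList_append (lo := 1) (p := 2 * B.rank j - 2) (by omega) (by omega), List.filter_append,
      List.filter_append, h2, hmid 1 _ h5, h4, ← posList_append (by omega) (by omega),
      ← posList_append (by omega) (by omega)]
  · rcases lt_or_ge p 1 with h6 | h6
    · exact h1 p hp1 h6
    · rcases lt_or_ge p (2 * B.rank j - 2) with h7 | h7
      · exact h5 p h6 h7
      · exact h3 p h7 hp2

/-- The given fan, relabelled, is enclosed in the canonical fan. -/
theorem IsLabelling.infix_canonicalFan (h : IsLabelling K M N f lo hi el B base φ)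
    (hp : FanPairs K M N f lo hi r B.rank el u g π) (j : Fin t) :
    (posList (lo j) (hi j) (el j)).map φ <:+: B.canonicalFan j := by
  obtain ⟨lo', hi', h1, h2, -, h4, -⟩ := h.exists_canonicalFan_eq hp j
  have hlen := (hp.pair j).len
  have hmap : (posList (lo j) (hi j) (el j)).map φ = posList (lo j) (hi j) (B.label j) := by
    rw [posList, posList, List.map_map]
    refine List.map_congr_left fun p hp' => ?_
    rw [List.mem_range'_1] at hp'
    exact h.fan j p (by omega) (by omega)
  rw [hmap, h4, posList_append (p := lo j) h1 (by omega),
    posList_append (lo := lo j) (p := hi j) (by omega) h2]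
  exact ⟨_, _, List.append_assoc _ _ _⟩

theorem IsLabelling.isFan_canonicalFan (h : IsLabelling K M N f lo hi el B base φ)
    (hp : FanPairs K M N f lo hi r B.rank el u g π) {a b : Fin t → V}
    (hc : CornerVec K B base a b)
    (hT : (vectorMatroid K (glueVec K base B.rank a b) (φ '' M.E)).Tame) (j : Fin t) :
    (vectorMatroid K (glueVec K base B.rank a b) (φ '' M.E)).IsFan (B.canonicalFan j) := by
  obtain ⟨lo', hi', h1, h2, h3, h4, h5⟩ := h.exists_canonicalFan_eq hp j
  have hlen := (hp.pair j).len
  have hhi := (hp.pair j).hi_eq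
  have hlo := (hp.pair j).lo_le
  rw [h4]
  refine PosFan.isFan ?_ hT (by omega)
  refine hc.posFan (lab := id) h3 (fun p hp1 hp2 => ⟨h5 p hp1 hp2, rfl⟩) ?_
  rintro e he p rfl
  rw [h.image_eq hp] at he
  obtain ⟨h6, h7⟩ := Blueprint.inr_mem_glueGround.1 he.1
  exact ⟨by omega, by omega, (Blueprint.label_of_lt h6 h7).symm⟩

end Labelling

/-! ### The blueprint -/

section BlueprintOfFans

variable {K V α : Type*} [Field K] [AddCommGroup V] [Module K V] {t : ℕ} {M N : Matroid α}
  {f : α → V} {lo hi R : Fin t → ℕ} {el : Fin t → ℕ → α} {a b : Fin t → V} {F₀ : Fin t → List α}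

variable (K) in
/-- The vectors of the points of `N⁺`. -/
noncomputable def plusVec (N : Matroid α) (f : α → V) (F₀ : Fin t → List α) :
    α ⊕ (Fin t × Fin 3) → V :=
  Sum.elim f (fun q => fanVector K N f (F₀ q.1) q.2)

theorem core_isRepresentedBy : (core K N f F₀).IsRepresentedBy K (plusVec K N f F₀) := by
  intro I hI
  have hI' := hI
  rw [core, delete_ground] at hI'
  rw [core, delete_indep_iff, and_iff_left (disjoint_of_subset_left hI' disjoint_sdiff_left)]
  exact vectorMatroid_isRepresentedBy _ _ I (hI'.trans sdiff_subset)

theorem inr_mem_core (q : Fin t × Fin 3) : Sum.inr q ∈ (core K N f F₀).E := by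
  rw [core, delete_ground]
  refine ⟨.inr ⟨q, rfl⟩, ?_⟩
  rintro ⟨e, -, he⟩
  simp at he

theorem inl_mem_core (h0 : ∀ q : Fin t × Fin 3, q.2 ≠ 1 → plusVec K N f F₀ (Sum.inr q) ≠ 0) {e : α} :
    Sum.inl e ∈ (core K N f F₀).E ↔
      e ∈ N.E ∧ (∀ j, e ∉ F₀ j) ∧ ∀ q, ¬ IsParallelToEnd K f (plusVec K N f F₀) e q := by
  have hpar : e ∈ N.E → ∀ q : Fin t × Fin 3, q.2 ≠ 1 →
      ((plusMatroid K N f F₀).IsCircuit {Sum.inl e, Sum.inr q} ↔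
        IsParallelToEnd K f (plusVec K N f F₀) e q) := by
    intro he q hq
    rw [plusMatroid, vectorMatroid_isCircuit_pair_iff (.inl ⟨e, he, rfl⟩) (.inr ⟨q, rfl⟩) (by simp)]
    exact ⟨fun h => ⟨hq, h.2⟩, fun h => ⟨h0 q hq, h.2⟩⟩
  have hground : Sum.inl e ∈ (plusMatroid K N f F₀).E ↔ e ∈ N.E := by
    rw [plusMatroid, vectorMatroid_ground]
    simp
  rw [core, delete_ground, mem_sdiff, hground, Sum.inl_injective.mem_set_image, mem_ofPred_eq]
  refine and_congr_right fun he => ?_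
  rw [and_iff_right he]
  push Not
  refine and_congr_right fun _ => ?_
  constructor
  · rintro h ⟨i, c⟩ hq
    fin_cases c
    · exact (h i).1 ((hpar he (i, 0) hq.1).2 hq)
    · exact hq.1 rfl
    · exact (h i).2 ((hpar he (i, 2) hq.1).2 hq)
  · intro h i
    exact ⟨fun hc => h _ ((hpar he (i, 0) (by simp)).1 hc),
      fun hc => h _ ((hpar he (i, 2) (by simp)).1 hc)⟩

/-- The label of a position in one of the glued wheels. -/
def wheelLabel (R : Fin t → ℕ) (j : Fin t) (p : ℕ) : (α ⊕ (Fin t × Fin 3)) ⊕ (Fin t × ℕ) :=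
  if p = 0 then Sum.inl (Sum.inr (j, 0))
  else if p = 2 * R j - 2 then Sum.inl (Sum.inr (j, 2))
  else if p = 2 * R j - 1 then Sum.inl (Sum.inr (j, 1))
  else Sum.inr (j, p)

theorem wheelLabel_ne_corner_one {j i : Fin t} {p : ℕ} (hp : p < 2 * R j - 1) :
    (wheelLabel R j p : (α ⊕ (Fin t × Fin 3)) ⊕ (Fin t × ℕ)) ≠ Sum.inl (Sum.inr (i, 1)) := by
  rw [wheelLabel, if_neg (show p ≠ 2 * R j - 1 by omega)]
  split_ifs <;> simp

/-- The blueprint whose base is the core of `N` and whose deleted elements are the corners that are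
not used as labels of elements of `M`. -/
theorem exists_isLabelling (hR : ∀ j, 2 ≤ R j) (hhi : ∀ j, hi j ≤ 2 * R j - 1)
    (hinj : ∀ j p q, lo j ≤ p → p < hi j → lo j ≤ q → q < hi j → el j p = el j q → p = q)
    (hdisj : ∀ i j, i ≠ j → ∀ e ∈ posSet (lo i) (hi i) (el i), e ∉ posSet (lo j) (hi j) (el j))
    (hF₀ : ∀ j, ∀ e, e ∈ F₀ j ↔ e ∈ posSet (lo j) (hi j) (el j) ∧ e ∈ N.E)
    (h0 : ∀ j, ∃ c : K, c ≠ 0 ∧ endVector K N f (F₀ j) = c • a j)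
    (h1 : ∀ j, ∃ c : K, c ≠ 0 ∧ rimVector K N f (F₀ j) = c • (a j - b j))
    (h2 : ∀ j, ∃ c : K, c ≠ 0 ∧ endVector K N f (F₀ j).reverse = c • b j)
    (hind : ∀ j, ∀ x y : K, x • a j + y • b j = 0 → x = 0 ∧ y = 0) :
    ∃ (B : Blueprint (α ⊕ (Fin t × Fin 3)) t) (φ : α → (α ⊕ (Fin t × Fin 3)) ⊕ (Fin t × ℕ)),
      B.base = core K N f F₀ ∧ B.rank = R ∧ CornerVec K B (plusVec K N f F₀) a b ∧
      IsLabelling K M N f lo hi el B (plusVec K N f F₀) φ := by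
  classical
  have hnz : ∀ q : Fin t × Fin 3, q.2 ≠ 1 → plusVec K N f F₀ (Sum.inr q) ≠ 0 := by
    rintro ⟨j, c⟩ hc
    fin_cases c
    · obtain ⟨k, hk, he⟩ := h0 j
      show endVector K N f (F₀ j) ≠ 0
      rw [he]
      refine smul_ne_zero hk fun ha => ?_
      simpa using (hind j 1 0 (by rw [ha]; simp)).1
    · exact (hc rfl).elim
    · obtain ⟨k, hk, he⟩ := h2 j
      show endVector K N f (F₀ j).reverse ≠ 0
      rw [he]
      refine smul_ne_zero hk fun hb => ?_
      simpa using (hind j 0 1 (by rw [hb]; simp)).2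
  obtain ⟨φ, hφ1, hφ2⟩ : ∃ φ : α → (α ⊕ (Fin t × Fin 3)) ⊕ (Fin t × ℕ),
      (∀ j p, lo j ≤ p → p < hi j → φ (el j p) = wheelLabel R j p) ∧
      (∀ e, (∀ j, e ∉ posSet (lo j) (hi j) (el j)) →
        (∃ q, IsParallelToEnd K f (plusVec K N f F₀) e q ∧ φ e = Sum.inl (Sum.inr q)) ∨
        ((∀ q, ¬ IsParallelToEnd K f (plusVec K N f F₀) e q) ∧ φ e = Sum.inl (Sum.inl e))) := by
    have key : ∀ e, ∃ x, (∀ j p, lo j ≤ p → p < hi j → el j p = e → x = wheelLabel R j p) ∧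
      ((∀ j, e ∉ posSet (lo j) (hi j) (el j)) →
        (∃ q, IsParallelToEnd K f (plusVec K N f F₀) e q ∧ x = Sum.inl (Sum.inr q)) ∨
        ((∀ q, ¬ IsParallelToEnd K f (plusVec K N f F₀) e q) ∧ x = Sum.inl (Sum.inl e))) := by
      intro e
      by_cases hfan : ∃ j, e ∈ posSet (lo j) (hi j) (el j)
      · obtain ⟨j, hj⟩ := hfan
        obtain ⟨p, hp1, hp2, rfl⟩ := id hj
        refine ⟨wheelLabel R j p, fun i q hq1 hq2 he => ?_, fun h => (h j hj).elim⟩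
        by_cases hij : i = j
        · subst hij
          rw [hinj i q p hq1 hq2 hp1 hp2 he]
        · exact (hdisj i j hij _ ⟨q, hq1, hq2, rfl⟩ (he ▸ hj)).elim
      · push Not at hfan
        by_cases hq : ∃ q, IsParallelToEnd K f (plusVec K N f F₀) e q
        · obtain ⟨q, hq⟩ := hq
          exact ⟨_, fun j p h1 h2 he => (hfan j ⟨p, h1, h2, he⟩).elim, fun _ => .inl ⟨q, hq, rfl⟩⟩
        · push Not at hq
          exact ⟨_, fun j p h1 h2 he => (hfan j ⟨p, h1, h2, he⟩).elim, fun _ => .inr ⟨hq, rfl⟩⟩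
    choose φ hφ using key
    exact ⟨φ, fun j p h1 h2 => (hφ _).1 j p h1 h2 rfl, fun e he => (hφ e).2 he⟩
  -- the points `b` are never labels, so they are always deleted
  have hb : ∀ i, Sum.inl (Sum.inr (i, 1)) ∉ φ '' M.E := by
    rintro i ⟨e, -, he⟩
    by_cases hfan : ∃ j, e ∈ posSet (lo j) (hi j) (el j)
    · obtain ⟨j, p, hp1, hp2, rfl⟩ := hfan
      rw [hφ1 j p hp1 hp2] at he
      exact wheelLabel_ne_corner_one (by have := hhi j; omega) he
    · push Not at hfan
      rcases hφ2 e hfan with ⟨q, hq, hqe⟩ | ⟨-, hqe⟩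
      · rw [hqe] at he
        have := Sum.inr.inj (Sum.inl.inj he)
        exact hq.1 (congr_arg Prod.snd this)
      · simp [hqe] at he
  let B : Blueprint (α ⊕ (Fin t × Fin 3)) t :=
    { base := core K N f F₀
      corner := fun i c => Sum.inr (i, c)
      rank := R
      del := {x | ∃ q, Sum.inr q = x ∧ Sum.inl (Sum.inr q) ∉ φ '' M.E}
      isTriangle := by
        intro i
        have hrange : range (fun c : Fin 3 => (Sum.inr (i, c) : α ⊕ (Fin t × Fin 3))) =
            {Sum.inr (i, 0), Sum.inr (i, 1), Sum.inr (i, 2)} := by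
          ext x; simp [Fin.exists_fin_succ, eq_comm]
        rw [hrange]
        exact core_isRepresentedBy.isTriangle (inr_mem_core _) (inr_mem_core _) (inr_mem_core _)
          (by simp) (by simp) (by simp) (hind i) (h0 i) (h1 i) (h2 i)
      two_le_rank := hR
      del_subset := by
        rintro _ ⟨q, rfl, -⟩
        exact mem_iUnion.2 ⟨q.1, q.2, rfl⟩
      of_notMem_del := fun i hi => (hi ⟨_, rfl, hb i⟩).elim }
  refine ⟨B, φ, rfl, rfl, ⟨h0, h1, h2, hind⟩, fun _ _ => rfl, fun e => ?_, fun _ => rfl, rfl,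
    hφ1, hφ2⟩
  rw [inl_mem_core hnz]
  refine and_congr_right fun he => and_congr_left fun _ => forall_congr' fun j => ?_
  rw [hF₀, and_iff_left he]

end BlueprintOfFans

section Covering

variable {α : Type*} {t : ℕ} {M N : Matroid α} {L L' : List α} {lo hi : ℕ} {el : ℕ → α}

theorem IsFan.subset_ground (h : N.IsFan L) {x : α} (hx : x ∈ L) : x ∈ N.E := by
  obtain ⟨lo, hi, el, -, hlen, rfl, hpos⟩ := h.exists_posFan
  obtain ⟨p, h1, h2, rfl⟩ := mem_posList.1 hx
  exact hpos.mem_ground hlen h1 h2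

theorem Consistent.subset (h : Consistent L L') : L ⊆ L' := by
  rcases h with h | h
  · exact h.subset
  · exact fun x hx => List.mem_reverse.1 (h.subset hx)

theorem IsFan.three_le_encard (h : N.IsFan L) : 3 ≤ (listSet L).encard := by
  classical
  have h4 : listSet L = (L.toFinset : Set α) := by ext; simp [listSet]
  rw [h4, encard_coe_eq_coe_finsetCard, List.toFinset_card_of_nodup h.2.1]
  exact_mod_cast h.1

theorem PosFan.exists_parity (h : N.PosFan lo hi el) :
    ∃ τ : α → Bool, ∀ p, lo ≤ p → p < hi → τ (el p) = decide (Odd p) := by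
  classical
  refine ⟨fun x => decide (∃ p, lo ≤ p ∧ p < hi ∧ el p = x ∧ Odd p), fun p h1 h2 => ?_⟩
  refine decide_eq_decide.2 ⟨?_, fun hp => ⟨p, h1, h2, rfl, hp⟩⟩
  rintro ⟨q, h3, h4, he, hq⟩
  rwa [h.inj p q h1 h2 h3 h4 he.symm]

end Covering

end Matroid

theorem mainTheorem3 {α : Type*} {K : Type*} {V : Type*} [Field K] [AddCommGroup V] [Module K V]
    (M N : Matroid α) [M.Finite]
    (f : α → V) (hf : N.IsRepresentedBy K f)
    (hN : N.IsConnectedOfOrder 3) (hcard : 4 ≤ N.E.encard)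
    (hwheel : ¬ N.IsWheel) (hwhirl : ¬ N.IsWhirl)
    {t : ℕ} (FN : Fin t → List α) (hFN : N.IsDisjointFanFamily FN)
    (hFN_sep : ∀ L, N.IsFan L → ∀ i j, i ≠ j →
      ¬ (Matroid.listSet (FN i) ⊆ Matroid.listSet L ∧ Matroid.listSet (FN j) ⊆ Matroid.listSet L))
    (hM : M.IsConnectedOfOrder 3) (hNM : N ≤m M)
    (hminors : ∀ M' : Matroid α, M' ≤m M → N ≤m M' → M'.IsThreeConnectedUpToSP)
    (F : Fin t → List α) (hF : M.IsCoveringFamily N FN F) :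
    ∃ F₀ : Fin t → List α, N.IsDisjointFanFamily F₀ ∧ Matroid.EnclosedFamily FN F₀ ∧
      ∃ B : Matroid.Blueprint (α ⊕ (Fin t × Fin 3)) t,
        B.base = Matroid.core K N f F₀ ∧
        (∀ i j, B.corner i j = Sum.inr (i, j)) ∧
        ∃ G, B.IsGluing G ∧
          ∃ (φ : α → (α ⊕ (Fin t × Fin 3)) ⊕ (Fin t × ℕ)) (hφ : InjOn φ M.E),
            M.map φ hφ = G ∧ (∀ i, G.IsFan (B.canonicalFan i)) ∧
            Matroid.EnclosedFamily (fun i => (F i).map φ) B.canonicalFan := by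
  classical
  have hNfin : N.Finite := ⟨M.ground_finite.subset hNM.subset⟩
  have hsub : N.E ⊆ M.E := hNM.subset
  have ht : N.Tame := hN.tame hcard
  have htM : M.Tame := hM.tame (hcard.trans (encard_le_encard hsub))
  obtain ⟨⟨hFfan, hFdisj⟩, hcons, hcover⟩ := hF
  choose lo hi el hlo hlen hFeq hpos using fun j => (hFfan j).exists_posFan
  obtain rfl : F = fun j => Matroid.posList (lo j) (hi j) (el j) := funext hFeq
  choose τ hτ using fun j => (hpos j).exists_parity
  obtain ⟨R, hR⟩ : ∃ R : Fin t → ℕ, ∀ j, hi j = 2 * R j - 1 ∨ hi j = 2 * R j - 2 :=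
    ⟨fun j => (hi j + 2) / 2, fun j => by have := hlen j; dsimp only; omega⟩
  have hpair := fun j h3 => (hpos j).exists_fanPair (hlo j) (hlen j) (hR j) hNM hN ht hf hwheel
    hwhirl (hτ j) h3
  -- every fan of the covering family covers exactly one member of `FN`
  choose s hs using hcons
  have hsN : ∀ i, Matroid.Consistent (FN i)
      ((Matroid.posList (lo (s i)) (hi (s i)) (el (s i))).filter (fun x => x ∈ N.E)) := fun i =>
    Matroid.consistent_filter (hs i) fun x hx => decide_eq_true ((hFN.1 i).subset_ground hx)
  have h3s : ∀ i, 3 ≤ ({y | y ∈ Matroid.posList (lo (s i)) (hi (s i)) (el (s i))} ∩ N.E).encard :=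
    fun i => (hFN.1 i).three_le_encard.trans (encard_le_encard fun x hx =>
      ⟨(hs i).subset hx, (hFN.1 i).subset_ground hx⟩)
  have hsinj : Function.Injective s := by
    intro i i' hii
    by_contra hne
    obtain ⟨lo', hi', el', -, hlen', hfil, hpos', -⟩ := hpair (s i) (h3s i)
    refine hFN_sep _ (hpos'.isFan ht hlen') i i' hne ⟨?_, ?_⟩
    · rw [← hfil]; exact (hsN i).subset
    · rw [← hfil, hii]; exact (hsN i').subset
  obtain ⟨σ, rfl⟩ : ∃ σ : Equiv.Perm (Fin t), σ = s :=
    ⟨Equiv.ofBijective s (Finite.injective_iff_bijective.1 hsinj), rfl⟩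
  have h3 : ∀ j, 3 ≤ ({y | y ∈ Matroid.posList (lo j) (hi j) (el j)} ∩ N.E).encard := fun j => by
    simpa using h3s (σ.symm j)
  choose lo' hi' el' hlo' hlen' hfil hpos' hout r u g π hFP h0 h1 h2 using fun j => hpair j (h3 j)
  have hmem : ∀ j e, e ∈ Matroid.posList (lo' j) (hi' j) (el' j) ↔
      e ∈ Matroid.posSet (lo j) (hi j) (el j) ∧ e ∈ N.E := fun j e => by
    rw [← hfil, List.mem_filter, Matroid.mem_posList, decide_eq_true_iff]; rfl
  have hdisj : ∀ i j, i ≠ j → ∀ e ∈ Matroid.posSet (lo i) (hi i) (el i),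
      e ∉ Matroid.posSet (lo j) (hi j) (el j) := fun i j hij e hei hej =>
    disjoint_left.1 (hFdisj i j hij) (Matroid.mem_posList.2 hei) (Matroid.mem_posList.2 hej)
  have hp : Matroid.FanPairs K M N f lo hi r R el u g π :=
    ⟨hFP, hdisj, fun e he heN => by
      obtain ⟨j, hj⟩ := hcover e ⟨he, heN⟩
      exact ⟨j, Matroid.mem_posList.1 hj⟩, hsub⟩
  obtain ⟨B, φ, hB, rfl, hcv, hlab⟩ := Matroid.exists_isLabelling (K := K) (M := M) (N := N) (f := f)
    (F₀ := fun j => Matroid.posList (lo' j) (hi' j) (el' j)) hp.two_le_rank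
    (fun j => by have := hR j; omega) (fun j => (hpos j).inj) hdisj hmem h0 h1 h2
    (fun j => (hFP j).ends)
  have hrep := hlab.isRepresentedBy hp hcv hf ht hNM hτ h3
  have hφ := hrep.injOn_of_comp htM
  have hmap := hrep.map_eq_vectorMatroid hφ
  refine ⟨_, ⟨fun j => (hpos' j).isFan ht (hlen' j), fun i j hij => ?_⟩,
    ⟨σ, fun i => (hpos' (σ i)).enclosed_of_consistent hN ht hf (hlo' _) (hlen' _) (hout _) (hFN.1 i)
      (by rw [← hfil]; exact hsN i)⟩,
    B, hB, hlab.corner, _, ?_, φ, hφ, hmap, fun j => ?_,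
    ⟨Equiv.refl _, fun j => .inl (hlab.infix_canonicalFan hp j)⟩⟩
  · exact disjoint_left.2 fun e hei hej =>
      hdisj i j hij e ((hmem i e).1 hei).1 ((hmem j e).1 hej).1
  · rw [hlab.image_eq hp]
    exact hcv.isGluing (hB ▸ Matroid.core_isRepresentedBy)
  · exact hlab.isFan_canonicalFan hp hcv (hmap ▸ htM.map hφ) j
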